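/- Let $\mathfrak g$ be a finite-dimensional simple simply-laced complex Lie algebra with dual Coxeter number $h^\vee$, let $\langle a,b\rangle=\frac1{2h^\vee}\operatorname{tr}(\operatorname{ad}_a\operatorname{ad}_b)$, and let $v^{(i)},w^{(i)}$ be dual bases of $\mathfrak g$ for this form. For a level $k$ let $\hat{\mathfrak g}_k$ denote the algebra generated by modes $a_n$ ($a\in\mathfrak g$, $n\in\mathbb Z$), linear in $a$, with $[a_m,b_n]=[a,b]_{m+n}+m\,\delta_{m,-n}\langle a,b\rangle k$. Let $\kappa$ be a formal variable, consider over $\mathbb C(\kappa)$ the product $U=\hat{\mathfrak g}_{\kappa-1}\times\hat{\mathfrak g}_1$ (two commuting sets of modes $a_n^{(\kappa-1)},a_n^{(1)}$), the diagonal modes $a_n^{(\kappa)}=a_n^{(\kappa-1)}+a_n^{(1)}$, and the integral form $U_R\subset U$ generated by all $a_n^{(\kappa-1)}/\kappa$ and $a_n^{(1)}$ over the ring $R\subset\mathbb C(\kappa)$ of rational functions regular at $\kappa=\infty$. The limit $\kappa\to\infty$ of $U_R$, or of a $U_R$-module $M$, is the quotient by $\kappa^{-1}$. A module is smooth if each vector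 is annihilated by all modes $a_n$ with $n$ sufficiently large. On smooth modules let $L_n^{(k)}=\frac{1}{2(k+h^\vee)}\sum_{n'+n''=n}\sum_i :\!v^{(i)}_{n'}w^{(i)}_{n''}\!:$ be the Sugawara operators built from the modes of level $k$, and let $L_n^{Coset}=L_n^{(\kappa-1)}+L_n^{(1)}-L_n^{(\kappa)}$. A $\mathfrak g$-connection $d+A$ on the formal punctured disc is given by $A=\sum_n A_nz^{-n-1}$, $A_n\in\mathfrak g$, with $A_n=0$ for $n\gg0$; the ring of functions $\mathcal O$ on the space of connections is the $\mathbb C$-algebra of functions generated by $d+A\mapsto\langle A_n,a\rangle$. (1) The limit $U_R/\kappa^{-1}U_R$ is a bundle over the space of $\mathfrak g$-connections: there is an algebra isomorphism $\mathcal O\otimes\hat{\mathfrak g}_1\cong U_R/\kappa^{-1}U_R$ that sends the function $d+A\mapsto\langle A_n,a\rangle$ to the class of $a_n^{(\kappa)}/\kappa$ and $a_n\in\hat{\mathfrak g}_1$ to the class of $a_n^{(1)}$. (2) For every connection $d+A$, the fibre over $d+A$, i.e. the coinvariants of the limit with respect to all $a_n^{(\kappa)}/\kappa-\langle A_n,a\rangle$,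 is isomorphic to $\hat{\mathfrak g}_1$ as a vector space, and indeed as a left $\hat{\mathfrak g}_1$-module, with $1\mapsto 1$. Likewise, if $N\ge 0$ and $A_n=0$ for all $n\ge N$, let $P_N$ be the quotient of $U$ by the left ideal generated by all modes of degree $\ge N$; it is a smooth module, and the fibre over $d+A$ of the $U_R$-submodule generated by the class of $1$ in $P_N$ is isomorphic, as a $\hat{\mathfrak g}_1$-module, to the quotient of $\hat{\mathfrak g}_1$ by the left ideal generated by the modes of degree $\geq N$, with class of $1\mapsto$ class of $1$. (3) Let $V$ be a smooth $U$-module, $M\subset V$ a $U_R$-submodule and $d+A$ a connection. Then $L_n^{Coset}M\subset M$ for all $n\in\mathbb Z$; the fibre of $M$ over $d+A$, i.e. the coinvariants of the limit of $M$ with respect to all $a_n^{(\kappa)}/\kappa-\langle A_n,a\rangle$, is a smooth $\hat{\mathfrak g}_1$-module; and $L_n^{Coset}$ descends to it as $$L_n^{d+A}=L_n-\sum_{n'+n''=n}(A_{n''})_{n'}+\frac12\sum_{n'+n''=n}\langle A_{n'},A_{n''}\rangle ,$$ where $L_n=L_n^{(1)}$ and $(A_{n''})_{n'}$ is the mode $n'$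 of $A_{n''}\in\mathfrak g$ in $\hat{\mathfrak g}_1$. (Equivalently, if all Sugawara operators are taken with the opposite overall sign, the formula reads $L_n+\sum(A_{n''})_{n'}-\frac12\sum\langle A_{n'},A_{n''}\rangle$.) (4) On every smooth $\hat{\mathfrak g}_1$-module the operators $L_n^{d+A}$ are a Virasoro action, $[L_m^{d+A},L_n^{d+A}]=(m-n)L_{m+n}^{d+A}+\frac{c}{12}(m^3-m)\delta_{m,-n}$ with $c=\frac{\dim\mathfrak g}{1+h^\vee}$. -/

import Mathlib

open scoped TensorProduct

noncomputable section

namespace AffineCoset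

section Finite

variable {g : Type*} [LieRing g] [LieAlgebra ℂ g] [FiniteDimensional ℂ g]
  [LieAlgebra.IsKilling ℂ g] (H : LieSubalgebra ℂ g) [H.IsCartanSubalgebra]

/-- All roots have the same length, i.e. all coroots have the same Killing norm. -/
def IsSimplyLaced : Prop :=
  ∀ α ∈ H.root, ∀ β ∈ H.root,
    killingForm ℂ g (LieAlgebra.IsKilling.coroot α : H) (LieAlgebra.IsKilling.coroot α : H) =
      killingForm ℂ g (LieAlgebra.IsKilling.coroot β : H) (LieAlgebra.IsKilling.coroot β : H)

/-- The dual Coxeter number `h^∨`, computed from a long root `θ`: it is the number such that the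
form `(2 h^∨)⁻¹ • Killing` gives the long roots squared length `2`, equivalently gives `θ^∨` the
squared length `2`. -/
def dualCoxeter (θ : LieModule.Weight ℂ H g) : ℂ :=
  killingForm ℂ g (LieAlgebra.IsKilling.coroot θ : H) (LieAlgebra.IsKilling.coroot θ : H) / 4

/-- The invariant form `⟨a, b⟩ = (2 h^∨)⁻¹ tr (ad a ad b)`. -/
def normalizedForm (θ : LieModule.Weight ℂ H g) : LinearMap.BilinForm ℂ g :=
  (2 * dualCoxeter H θ)⁻¹ • killingForm ℂ g

end Finite

section ModeAlgebra

variable (S : Type*) [CommRing S] [Algebra ℂ S] {σ : Type*}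
  {g : Type*} [LieRing g] [LieAlgebra ℂ g] (B : LinearMap.BilinForm ℂ g) (k : σ → S)

/-- Defining relations, over the base ring `S`, of the product over `s : σ` of the affine Lie
algebras of level `k s`: the generator `(s, a, n)` is the mode `a_n` of the factor `s`. -/
inductive ModeRel : FreeAlgebra S (σ × g × ℤ) → FreeAlgebra S (σ × g × ℤ) → Prop
  | add (s : σ) (a b : g) (n : ℤ) :
      ModeRel (FreeAlgebra.ι S (s, a + b, n))
        (FreeAlgebra.ι S (s, a, n) + FreeAlgebra.ι S (s, b, n))
  | smul (s : σ) (c : ℂ) (a : g) (n : ℤ) :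
      ModeRel (FreeAlgebra.ι S (s, c • a, n)) (algebraMap ℂ S c • FreeAlgebra.ι S (s, a, n))
  | comm (s : σ) (a b : g) (m n : ℤ) :
      ModeRel (FreeAlgebra.ι S (s, a, m) * FreeAlgebra.ι S (s, b, n))
        (FreeAlgebra.ι S (s, b, n) * FreeAlgebra.ι S (s, a, m) +
          FreeAlgebra.ι S (s, ⁅a, b⁆, m + n) +
          algebraMap S _ (if m + n = 0 then algebraMap ℂ S (m * B a b) * k s else 0))
  | comm_of_ne (s t : σ) (hst : s ≠ t) (a b : g) (m n : ℤ) :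
      ModeRel (FreeAlgebra.ι S (s, a, m) * FreeAlgebra.ι S (t, b, n))
        (FreeAlgebra.ι S (t, b, n) * FreeAlgebra.ι S (s, a, m))

/-- The mode algebra (enveloping algebra at fixed levels) of a product of affine Lie algebras. -/
def ModeAlgebra : Type _ := RingQuot (ModeRel S B k)

instance : Ring (ModeAlgebra S B k) := inferInstanceAs (Ring (RingQuot (ModeRel S B k)))

instance {T : Type*} [CommRing T] [Algebra T S] : Algebra T (ModeAlgebra S B k) :=
  inferInstanceAs (Algebra T (RingQuot (ModeRel S B k)))

instance {T : Type*} [CommRing T] [Algebra T S] : IsScalarTower T S (ModeAlgebra S B k) :=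
  inferInstanceAs (IsScalarTower T S (RingQuot (ModeRel S B k)))

/-- The projection from the free algebra on the modes. -/
def ModeAlgebra.proj : FreeAlgebra S (σ × g × ℤ) →ₐ[S] ModeAlgebra S B k :=
  RingQuot.mkAlgHom S (ModeRel S B k)

variable {S B k} in
lemma ModeAlgebra.proj_rel {x y : FreeAlgebra S (σ × g × ℤ)} (h : ModeRel S B k x y) :
    proj S B k x = proj S B k y :=
  RingQuot.mkAlgHom_rel S h

variable {S B k} in
/-- The universal property of the mode algebra. -/
def ModeAlgebra.lift {C : Type*} [Ring C] [Algebra S C] (f : FreeAlgebra S (σ × g × ℤ) →ₐ[S] C)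
    (hf : ∀ x y, ModeRel S B k x y → f x = f y) : ModeAlgebra S B k →ₐ[S] C :=
  RingQuot.liftAlgHom S ⟨f, fun x y h => hf x y h⟩

/-- The mode `a_n` of the factor `s`. -/
def mode (s : σ) (a : g) (n : ℤ) : ModeAlgebra S B k :=
  ModeAlgebra.proj S B k (FreeAlgebra.ι S (s, a, n))

/-- Smooth modules: every vector is killed by all modes of sufficiently large degree. -/
def IsSmooth (V : Type*) [AddCommGroup V] [Module (ModeAlgebra S B k) V] : Prop :=
  ∀ x : V, ∃ N : ℤ, ∀ n ≥ N, ∀ (s : σ) (a : g), mode S B k s a n • x = 0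

/-- The left ideal generated by all modes of degree at least `N`. -/
def highModes (N : ℕ) : Submodule (ModeAlgebra S B k) (ModeAlgebra S B k) :=
  Submodule.span _ {u | ∃ (s : σ) (a : g) (n : ℤ), (N : ℤ) ≤ n ∧ u = mode S B k s a n}

lemma mode_add (s : σ) (a b : g) (n : ℤ) :
    mode S B k s (a + b) n = mode S B k s a n + mode S B k s b n := by
  simpa [mode] using ModeAlgebra.proj_rel (ModeRel.add (B := B) (k := k) s a b n)

lemma mode_smul (s : σ) (c : ℂ) (a : g) (n : ℤ) :
    mode S B k s (c • a) n = algebraMap ℂ S c • mode S B k s a n := by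
  have h := ModeAlgebra.proj_rel (ModeRel.smul (B := B) (k := k) s c a n)
  rw [map_smul] at h
  exact h

lemma mode_mul (s : σ) (a b : g) (m n : ℤ) :
    mode S B k s a m * mode S B k s b n =
      mode S B k s b n * mode S B k s a m + mode S B k s ⁅a, b⁆ (m + n) +
      algebraMap S _ (if m + n = 0 then algebraMap ℂ S (m * B a b) * k s else 0) := by
  have h := ModeAlgebra.proj_rel (ModeRel.comm (B := B) (k := k) s a b m n)
  rw [map_mul, map_add, map_add, map_mul, AlgHom.commutes] at h
  exact h

end ModeAlgebra

section Sugawara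

variable {F : Type*} [Field F] {U : Type*} [Ring U] [Algebra F U] {W : Type*} [AddCommGroup W]
  [Module U W] {g ι : Type*} [Fintype ι]

/-- The normally ordered product `:a_m b_l:` for the modes `a_n = J a n`. -/
def normalOrdered (J : g → ℤ → U) (a b : g) (m l : ℤ) : U :=
  if m < 0 then J a m * J b l else J b l * J a m

/-- The Sugawara operator
`L_n = 1 / (2 (k + h)) * ∑_{n' + n'' = n} ∑_i :v^{(i)}_{n'} w^{(i)}_{n''}:` at level `k`,
acting on a vector `x`. On a smooth module the sum has finite support. -/
def sugawara (J : g → ℤ → U) (k h : F) (v w : ι → g) (n : ℤ) (x : W) : W :=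
  algebraMap F U (2 * (k + h))⁻¹ • ∑ᶠ m : ℤ, ∑ i, normalOrdered J (v i) (w i) m (n - m) • x

/-- The operators `L n`, `n : ℤ`, on the module `W` over a complex algebra `U` are linear and
satisfy the Virasoro relations with central charge `c`. -/
def IsVirasoroAction (U : Type*) [Ring U] [Algebra ℂ U] {W : Type*} [AddCommGroup W] [Module U W]
    (L : ℤ → W → W) (c : ℂ) : Prop :=
  (∀ n x y, L n (x + y) = L n x + L n y) ∧
  (∀ n (t : ℂ) x, L n (algebraMap ℂ U t • x) = algebraMap ℂ U t • L n x) ∧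
  ∀ m n x, L m (L n x) - L n (L m x) =
    algebraMap ℂ U (m - n) • L (m + n) x +
      algebraMap ℂ U (if m + n = 0 then c / 12 * ((m : ℂ) ^ 3 - m) else 0) • x

end Sugawara

section Connections

variable {g : Type*} [LieRing g] [LieAlgebra ℂ g] (B : LinearMap.BilinForm ℂ g)

/-- A `g`-connection `d + A` on the formal punctured disc: `A = ∑ A_n z^{-n-1}` is a formal
Laurent series in `z`, i.e. `A_n = 0` for large `n`. -/
def Connection (g : Type*) [LieRing g] : Type _ :=
  {A : ℤ → g // ∃ N : ℤ, ∀ n ≥ N, A n = 0}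

/-- The ring of functions on the space of connections, generated by `d + A ↦ ⟨A_n, a⟩`. -/
def functionRing : Subalgebra ℂ (Connection g → ℂ) :=
  Algebra.adjoin ℂ {f | ∃ (a : g) (n : ℤ), f = fun A => B (A.1 n) a}

/-- The function `d + A ↦ ⟨A_n, a⟩`. -/
def coord (a : g) (n : ℤ) : functionRing B :=
  ⟨fun A => B (A.1 n) a, Algebra.subset_adjoin ⟨a, n, rfl⟩⟩

end Connections

section Family

variable {g : Type*} [LieRing g] [LieAlgebra ℂ g] (B : LinearMap.BilinForm ℂ g)

/-- The level `κ` as the variable of the field `ℂ(κ)`. -/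
def kap : RatFunc ℂ := RatFunc.X

/-- The mode algebra of the affine Lie algebra of level `1`. -/
abbrev LevelOne : Type _ := ModeAlgebra ℂ B (fun _ : Unit => (1 : ℂ))

/-- The mode `a_n` of level `1`. -/
def modeOne (a : g) (n : ℤ) : LevelOne B := mode ℂ B _ () a n

/-- The mode algebra over `ℂ(κ)` of the product of affine Lie algebras of levels `κ - 1`, `1`. -/
abbrev Generic : Type _ := ModeAlgebra (RatFunc ℂ) B (![kap - 1, 1] : Fin 2 → RatFunc ℂ)

/-- The mode `a_n^{(κ-1)}`. -/
def modeX (a : g) (n : ℤ) : Generic B := mode (RatFunc ℂ) B _ 0 a n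

/-- The mode `a_n^{(1)}`. -/
def modeY (a : g) (n : ℤ) : Generic B := mode (RatFunc ℂ) B _ 1 a n

/-- The diagonally embedded mode `a_n^{(κ)} = a_n^{(κ-1)} + a_n^{(1)}`. -/
def modeDiag (a : g) (n : ℤ) : Generic B := modeX B a n + modeY B a n

/-- The integral form: generated by `a_n^{(κ-1)} / κ` and `a_n^{(1)}` over the ring of rational
functions of `κ` that are regular at `κ = ∞` (i.e. of degree at most `0`). -/
def intForm : Subalgebra ℂ (Generic B) :=
  Algebra.adjoin ℂ
    ({u | ∃ f : RatFunc ℂ, f.intDegree ≤ 0 ∧ u = algebraMap (RatFunc ℂ) _ f} ∪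
      {u | ∃ (a : g) (n : ℤ), u = kap⁻¹ • modeX B a n} ∪ {u | ∃ (a : g) (n : ℤ), u = modeY B a n})

lemma algebraMap_kap_inv_mem :
    algebraMap (RatFunc ℂ) (Generic B) kap⁻¹ ∈ intForm B := by
  refine Algebra.subset_adjoin (Or.inl (Or.inl ⟨_, ?_, rfl⟩))
  simp [kap, RatFunc.intDegree_inv]

lemma modeY_mem (a : g) (n : ℤ) : modeY B a n ∈ intForm B :=
  Algebra.subset_adjoin (Or.inr ⟨a, n, rfl⟩)

lemma modeDiag_mem (a : g) (n : ℤ) : kap⁻¹ • modeDiag B a n ∈ intForm B := by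
  rw [modeDiag, smul_add]
  refine add_mem (Algebra.subset_adjoin (Or.inl (Or.inr ⟨a, n, rfl⟩))) ?_
  rw [Algebra.smul_def]
  exact mul_mem (algebraMap_kap_inv_mem B) (modeY_mem B a n)

/-- The element `κ⁻¹` of the integral form. -/
def kapInv : intForm B := ⟨_, algebraMap_kap_inv_mem B⟩

/-- The element `a_n^{(κ)} / κ` of the integral form. -/
def scaledDiag (a : g) (n : ℤ) : intForm B := ⟨_, modeDiag_mem B a n⟩

/-- The inclusion `a_n ↦ a_n^{(1)}` of the second factor into the integral form. -/
def inclOne : LevelOne B →ₐ[ℂ] intForm B :=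
  ModeAlgebra.lift (FreeAlgebra.lift ℂ fun p => ⟨modeY B p.2.1 p.2.2, modeY_mem B _ _⟩) <| by
    intro x y h
    apply Subtype.ext
    induction h with
    | add s a b n => simpa [modeY] using mode_add (RatFunc ℂ) B ![kap - 1, 1] 1 a b n
    | smul s c a n =>
      have h := mode_smul (RatFunc ℂ) B ![kap - 1, 1] 1 c a n
      rw [algebraMap_smul] at h
      simpa [modeY] using h
    | comm s a b m n =>
      have h := mode_mul (RatFunc ℂ) B ![kap - 1, 1] 1 a b m n
      simp only [map_mul, map_add, FreeAlgebra.lift_ι_apply, AlgHom.commutes]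
      change modeY B a m * modeY B b n = modeY B b n * modeY B a m + modeY B ⁅a, b⁆ (m + n) +
        algebraMap ℂ (Generic B) _
      rw [IsScalarTower.algebraMap_apply ℂ (RatFunc ℂ) (Generic B)]
      refine h.trans ?_
      congr 2
      split_ifs <;> simp
    | comm_of_ne s t hst => exact absurd rfl hst

/-- The limit `κ → ∞`: the integral form modulo `κ⁻¹`. -/
abbrev Limit : Type _ := RingQuot (fun x y : intForm B => x = kapInv B ∧ y = 0)

/-- The projection of the integral form to the limit. -/
def toLimit : intForm B →ₐ[ℂ] Limit B := RingQuot.mkAlgHom ℂ _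

section Coinvariants

variable (A : Connection g) (M : Type*) [AddCommGroup M] [Module (intForm B) M]

/-- The submodule of `M` generated by `κ⁻¹ M` and all `(a_n^{(κ)} / κ - ⟨A_n, a⟩) M`. -/
def coinvKer : Submodule (intForm B) M :=
  Submodule.span _ ({y | ∃ x : M, y = kapInv B • x} ∪
    {y | ∃ (a : g) (n : ℤ) (x : M),
      y = (scaledDiag B a n - algebraMap ℂ (intForm B) (B (A.1 n) a)) • x})

/-- The fibre at `d + A` of the limit of `M`: the coinvariants of the limit `M / κ⁻¹ M` with
respect to all `a_n^{(κ)} / κ - ⟨A_n, a⟩`. -/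
def Coinv : Type _ := M ⧸ coinvKer B A M

instance : AddCommGroup (Coinv B A M) := inferInstanceAs (AddCommGroup (M ⧸ coinvKer B A M))

instance : Module (intForm B) (Coinv B A M) :=
  inferInstanceAs (Module (intForm B) (M ⧸ coinvKer B A M))

/-- The fibre is a module over the second factor through `a_n ↦ a_n^{(1)}`. -/
instance : Module (LevelOne B) (Coinv B A M) :=
  Module.compHom (Coinv B A M) (inclOne B).toRingHom

variable {M}

/-- The class of a vector in the fibre at `d + A`. -/
def Coinv.mk (x : M) : Coinv B A M := (coinvKer B A M).mkQ x

end Coinvariants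

section Coset

variable {ι : Type*} [Fintype ι] (h : ℂ) (v w : ι → g)

/-- The coset Virasoro operator `L_n^{(κ-1)} + L_n^{(1)} - L_n^{(κ)}`. -/
def cosetL {V : Type*} [AddCommGroup V] [Module (Generic B) V] (n : ℤ) (x : V) : V :=
  sugawara (modeX B) (kap - 1) (algebraMap ℂ (RatFunc ℂ) h) v w n x +
    sugawara (modeY B) 1 (algebraMap ℂ (RatFunc ℂ) h) v w n x -
    sugawara (modeDiag B) kap (algebraMap ℂ (RatFunc ℂ) h) v w n x

/-- The deformed operator
`L_n - ∑_{n' + n'' = n} (A_{n''})_{n'} + 1/2 ∑_{n' + n'' = n} ⟨A_{n'}, A_{n''}⟩`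
on a module of level `1`, where `L_n` is the Sugawara operator of level `1`. -/
def deformedL (A : Connection g) {W : Type*} [AddCommGroup W] [Module (LevelOne B) W]
    (n : ℤ) (x : W) : W :=
  sugawara (modeOne B) 1 h v w n x - ∑ᶠ m : ℤ, modeOne B (A.1 (n - m)) m • x +
    algebraMap ℂ (LevelOne B) (1 / 2 * ∑ᶠ m : ℤ, B (A.1 m) (A.1 (n - m))) • x

end Coset

/-- The universal smooth module over `ℂ(κ)` generated by a vector that is killed by all modes of
degree at least `N`. -/
abbrev UnivSmooth (N : ℕ) : Type _ :=
  Generic B ⧸ highModes (RatFunc ℂ) B (![kap - 1, 1] : Fin 2 → RatFunc ℂ) N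

/-- Its cyclic vector. -/
def univVec (N : ℕ) : UnivSmooth B N := Submodule.Quotient.mk 1

/-- The integral form of the universal smooth module. -/
def univLattice (N : ℕ) : Submodule (intForm B) (UnivSmooth B N) :=
  Submodule.span _ {univVec B N}

/-- The cyclic vector of the integral form. -/
def univLatticeVec (N : ℕ) : univLattice B N :=
  ⟨univVec B N, Submodule.mem_span_singleton_self _⟩

end Family

end AffineCoset

end

open AffineCoset

/-!
Everything is read off from one family of representations. By the Poincaré–Birkhoff–Witt theorem
the modes `a_n / κ` of level `κ - 1` act on polynomials over the ring `R` in the loop algebra; this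
works over `R` because their commutators and central terms have coefficients in `R`, of order `κ⁻¹`.
At `κ = ∞` the modes become multiplication operators, so polynomials can be evaluated at a
connection `d + A`; tensoring with a module `Q` of level one, on which `a_n^{(1)}` acts, makes `Q`
a module of the integral form with `κ⁻¹ = 0` and `a_n^{(κ)} / κ = ⟨A_n, a⟩`. For `Q` the algebra of
level one or its quotient by the high modes, these modules show that the fibres are not smaller than
claimed. Since a tensor of functions and elements of level one is determined by its values at all
connections, the limit is not smaller than claimed either.

Substituting `a^{(κ-1)} = a^{(κ)} - a^{(1)}` in the coset operators gives quadratic expressions in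
`a^{(κ)} / κ` and `a^{(1)}` with coefficients in `R`, whose values at `κ = ∞` are those of
`L_n^{d+A}`.

On smooth modules of level one, `L_n^{d+A}` differs from the Sugawara operators by multiples of the
modes and of the identity, and the Virasoro relations follow from those of the Sugawara operators
and from `[L_m, a_n] = -n a_{m+n}`.
-/

noncomputable section

namespace AffineCoset

section PBW

open MvPolynomial

section Monomials

variable {S I : Type*} [CommRing S]

lemma mem_of_forall_monomial_mem {p : Submodule S (MvPolynomial I S)} {f : MvPolynomial I S}
    (h : ∀ M ∈ f.support, monomial M (1 : S) ∈ p) : f ∈ p := by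
  rw [f.as_sum]
  exact sum_mem fun M hM => by simpa [smul_monomial] using p.smul_mem (f.coeff M) (h M hM)

lemma X_mul_monomial_one (i : I) (M : I →₀ ℕ) :
    X i * monomial M (1 : S) = monomial (Finsupp.single i 1 + M) 1 := by
  rw [X, monomial_mul, one_mul]

lemma basisMonomials_constr_monomial {N : Type*} [AddCommGroup N] [Module S N]
    (f : (I →₀ ℕ) → N) (M : I →₀ ℕ) :
    (basisMonomials I S).constr S f (monomial M 1) = f M := by
  simpa only [coe_basisMonomials] using (basisMonomials I S).constr_basis S f M

lemma degree_le_totalDegree {f : MvPolynomial I S} {M : I →₀ ℕ} (hM : M ∈ f.support) :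
    M.degree ≤ f.totalDegree :=
  le_totalDegree hM

lemma totalDegree_monomial_le_degree (M : I →₀ ℕ) :
    (monomial M (1 : S)).totalDegree ≤ M.degree :=
  totalDegree_monomial_le M 1

lemma totalDegree_X_mul_le (i : I) (f : MvPolynomial I S) :
    (X i * f).totalDegree ≤ f.totalDegree + 1 :=
  calc (X i * f).totalDegree ≤ (X i : MvPolynomial I S).totalDegree + f.totalDegree :=
        totalDegree_mul _ _
    _ ≤ (Finsupp.single i 1).degree + f.totalDegree :=
        Nat.add_le_add_right (totalDegree_monomial_le_degree _) _
    _ = f.totalDegree + 1 := by rw [Finsupp.degree_single, add_comm]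

lemma mem_support_single_add {j k : I} {M : I →₀ ℕ} :
    k ∈ (Finsupp.single j 1 + M).support ↔ k = j ∨ k ∈ M.support := by
  classical
  rcases eq_or_ne k j with rfl | hkj <;> simp [*]

lemma X_mem_span_X_image {H : Set I} {i : I} (hi : i ∈ H) :
    (X i : MvPolynomial I S) ∈ Ideal.span (X '' H) :=
  Ideal.subset_span (Set.mem_image_of_mem X hi)

lemma exists_mem_of_monomial_mem_support {H : Set I} {f : MvPolynomial I S}
    (hf : f ∈ Ideal.span (X '' H)) {M : I →₀ ℕ} (hM : M ∈ f.support) : ∃ i ∈ H, i ∈ M.support := by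
  simpa only [Finsupp.mem_support_iff] using mem_ideal_span_X_image.mp hf M hM

lemma monomial_mem_span_X_image {H : Set I} {M : I →₀ ℕ} {i : I} (hi : i ∈ H)
    (hiM : i ∈ M.support) :
    (monomial M 1 : MvPolynomial I S) ∈ Ideal.span (X '' H) :=
  mem_ideal_span_X_image.mpr fun _ hM =>
    ⟨i, hi, Finset.mem_singleton.mp (support_monomial_subset hM) ▸
      Finsupp.mem_support_iff.mp hiM⟩

variable [LinearOrder I]

lemma forall_mem_support_single_add_le {i j : I} {M : I →₀ ℕ} (hji : j ≤ i)
    (hM : ∀ k ∈ M.support, j ≤ k) : ∀ k ∈ (Finsupp.single i 1 + M).support, j ≤ k :=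
  fun k hk => (mem_support_single_add.mp hk).elim (fun h => h ▸ hji) (hM k)

lemma min_support_single_add {j : I} {M : I →₀ ℕ} (hM : ∀ k ∈ M.support, j ≤ k) :
    (Finsupp.single j 1 + M).support.min = WithTop.some j :=
  le_antisymm (Finset.min_le (mem_support_single_add.mpr (Or.inl rfl)))
    (Finset.le_min fun k hk =>
      WithTop.coe_le_coe.mpr (forall_mem_support_single_add_le le_rfl hM k hk))

lemma eq_zero_or_exists_eq_single_add (M : I →₀ ℕ) :
    M = 0 ∨ ∃ (j : I) (N : I →₀ ℕ), M = Finsupp.single j 1 + N ∧ ∀ k ∈ N.support, j ≤ k := by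
  refine or_iff_not_imp_left.mpr fun hM => ?_
  have hne : M.support.Nonempty := Finsupp.support_nonempty_iff.mpr hM
  have hmin : Finsupp.single (M.support.min' hne) 1 ≤ M :=
    Finsupp.single_le_iff.mpr
      (Nat.one_le_iff_ne_zero.mpr (Finsupp.mem_support_iff.mp (M.support.min'_mem hne)))
  exact ⟨_, M - Finsupp.single (M.support.min' hne) 1, (add_tsub_cancel_of_le hmin).symm,
    fun k hk => M.support.min'_le k (Finsupp.support_tsub hk)⟩

lemma pbw_induction {P : I → (I →₀ ℕ) → Prop}
    (of_le : ∀ i M, (∀ k ∈ M.support, i ≤ k) → P i M)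
    (of_lt : ∀ i j N, j < i → (∀ k ∈ N.support, j ≤ k) →
      (∀ i' M, M.degree ≤ N.degree → P i' M) → P i (Finsupp.single j 1 + N))
    (i : I) (M : I →₀ ℕ) : P i M := by
  induction hn : M.degree using Nat.strong_induction_on generalizing i M with
  | _ n ih =>
    rcases eq_zero_or_exists_eq_single_add M with rfl | ⟨j, N, rfl, hN⟩
    · exact of_le i 0 (by simp)
    · rw [map_add, Finsupp.degree_single] at hn
      rcases lt_or_ge j i with hji | hij
      · exact of_lt i j N hji hN fun i' M hM => ih M.degree (by lia) i' M rfl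
      · exact of_le i _ (forall_mem_support_single_add_le hij fun k hk => hij.trans (hN k hk))

end Monomials

lemma apply_mem_of_basis {K S L P I : Type*} [CommSemiring K] [CommSemiring S] [Algebra K S]
    [AddCommMonoid L] [Module K L] [AddCommMonoid P] [Module K P] [Module S P]
    [IsScalarTower K S P] (b : Module.Basis I K L) (ρ : L →ₗ[K] Module.End S P)
    {p : Submodule S P} {f : P} (h : ∀ i, ρ (b i) f ∈ p) (x : L) : ρ x f ∈ p := by
  have hspan : Submodule.span K (Set.range b) ≤ (p.restrictScalars K).comap
      ((LinearMap.applyₗ (R := S) f).restrictScalars K ∘ₗ ρ) :=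
    Submodule.span_le.mpr (Set.range_subset_iff.mpr h)
  exact hspan (b.mem_span x)

section CommutatorDefect

variable {K S L P : Type*} [CommRing K] [CommRing S] [Algebra K S] [LieRing L] [LieAlgebra K L]
  [AddCommGroup P] [Module K P] [Module S P] [IsScalarTower K S P]

/-- The failure of `ρ` to satisfy `[ρ x, ρ y] = s • ρ [x, y] + τ x y`, i.e. to be a projective
representation with cocycle `τ` of the Lie algebra with bracket rescaled by `s`. -/
def commutatorDefect (s : S) (τ : L →ₗ[K] L →ₗ[K] S) (ρ : L →ₗ[K] Module.End S P) :
    L →ₗ[K] L →ₗ[K] Module.End S P :=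
  LinearMap.mk₂ K (fun x y => ρ x * ρ y - ρ y * ρ x - s • ρ ⁅x, y⁆ - τ x y • 1)
    (fun x x' y => by
      simp only [map_add, add_mul, mul_add, add_lie, smul_add, add_smul, LinearMap.add_apply]
      abel)
    (fun c x y => by
      simp only [map_smul, smul_mul_assoc, mul_smul_comm, smul_lie, smul_sub,
        LinearMap.smul_apply, smul_comm s c, smul_assoc])
    (fun x y y' => by
      simp only [map_add, add_mul, mul_add, lie_add, smul_add, add_smul]
      abel)
    (fun c x y => by
      simp only [map_smul, smul_mul_assoc, mul_smul_comm, lie_smul, smul_sub, smul_comm s c,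
        smul_assoc])

variable {s : S} {τ : L →ₗ[K] L →ₗ[K] S} {ρ : L →ₗ[K] Module.End S P}

lemma commutatorDefect_apply_eq_zero_iff {x y : L} {m : P} :
    commutatorDefect s τ ρ x y m = 0 ↔
      ρ x (ρ y m) = ρ y (ρ x m) + s • ρ ⁅x, y⁆ m + τ x y • m := by
  simp only [commutatorDefect, LinearMap.mk₂_apply, LinearMap.sub_apply, LinearMap.smul_apply,
    Module.End.mul_apply, Module.End.one_apply]
  rw [sub_sub, sub_sub, sub_eq_zero, add_assoc]

lemma commutatorDefect_isAlt (hτ : τ.IsAlt) : (commutatorDefect s τ ρ).IsAlt := fun x => by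
  simp [commutatorDefect, hτ x]

lemma commutatorDefect_apply_eq_zero_of_basis {I : Type*} [LinearOrder I]
    (b : Module.Basis I K L) (hτ : τ.IsAlt) {m : P}
    (h : ∀ i j, j < i → commutatorDefect s τ ρ (b i) (b j) m = 0) (x y : L) :
    commutatorDefect s τ ρ x y m = 0 := by
  have hD := commutatorDefect_isAlt (s := s) (ρ := ρ) hτ
  have hb : (commutatorDefect s τ ρ).compr₂ ((LinearMap.applyₗ (R := S) m).restrictScalars K) = 0 :=
    LinearMap.ext_basis b b fun i j => by
      change commutatorDefect s τ ρ (b i) (b j) m = 0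
      rcases lt_trichotomy i j with hij | rfl | hij
      · rw [← hD.neg, LinearMap.neg_apply, h j i hij, neg_zero]
      · rw [hD, LinearMap.zero_apply]
      · exact h i j hij
  exact LinearMap.congr_fun₂ hb x y

/-- The Jacobi identity and the cocycle identity propagate the commutation relations. -/
lemma commutatorDefect_apply_apply_eq_zero (hτ : τ.IsAlt)
    (hτ' : ∀ x y z, τ x ⁅y, z⁆ + τ y ⁅z, x⁆ + τ z ⁅x, y⁆ = 0) {x y z : L} {m : P}
    (hm : ∀ a c, commutatorDefect s τ ρ a c m = 0)
    (hx : commutatorDefect s τ ρ y z (ρ x m) = 0) (hy : commutatorDefect s τ ρ x z (ρ y m) = 0) :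
    commutatorDefect s τ ρ x y (ρ z m) = 0 := by
  simp only [commutatorDefect_apply_eq_zero_iff] at hm hx hy ⊢
  have hyz := congrArg (ρ x) (hm y z)
  have hxz := congrArg (ρ y) (hm x z)
  have hxy := congrArg (ρ z) (hm x y)
  simp only [map_add, map_smul] at hxy hxz hyz
  have jacobi : ρ ⁅x, ⁅y, z⁆⁆ = ρ ⁅⁅x, y⁆, z⁆ + ρ ⁅y, ⁅x, z⁆⁆ := by rw [leibniz_lie, map_add]
  have cocycle : τ x ⁅y, z⁆ = τ ⁅x, y⁆ z + τ y ⁅x, z⁆ := by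
    rw [← hτ.neg z, ← lie_skew x z, map_neg]
    linear_combination hτ' x y z
  rw [hyz, hy, hxz, hx, hxy, hm ⁅x, y⁆ z, hm x ⁅y, z⁆, hm y ⁅x, z⁆, jacobi, cocycle]
  simp only [smul_add, add_smul, LinearMap.add_apply, smul_smul]
  module

end CommutatorDefect

section Action

variable {K S L I : Type*} [CommRing K] [CommRing S] [Algebra K S] [LieRing L] [LieAlgebra K L]
  [LinearOrder I] (b : Module.Basis I K L) (s : S) (τ : L →ₗ[K] L →ₗ[K] S)

/-- Truncation of the Poincaré–Birkhoff–Witt action `pbwOp`, correct in degrees at most `n`: it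
makes the recursion that defines the action structural. The variable `j` is the smallest one of the
monomial `M`; for `M ≠ 0` the default value `i` is not attained. -/
def pbwTrunc : ℕ → L →ₗ[K] Module.End S (MvPolynomial I S)
  | 0 => b.constr K fun i => LinearMap.mulLeft S (X i)
  | n + 1 => b.constr K fun i => (basisMonomials I S).constr S fun M =>
      let j := M.support.min.untopD i
      let N := M - Finsupp.single j 1
      if M.degree ≤ n then pbwTrunc n (b i) (monomial M 1)
      else if j < i then
        X i * monomial M 1 + pbwTrunc n (b j) (pbwTrunc n (b i) (monomial N 1) - X i * monomial N 1)
          + s • pbwTrunc n ⁅b i, b j⁆ (monomial N 1) + τ (b i) (b j) • monomial N 1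
      else X i * monomial M 1

/-- The Poincaré–Birkhoff–Witt action of a Lie algebra with ordered basis `b`, bracket rescaled by
`s` and central term `τ`, on polynomials in the basis elements. -/
def pbwOp : L →ₗ[K] Module.End S (MvPolynomial I S) :=
  b.constr K fun i => (basisMonomials I S).constr S fun M =>
    pbwTrunc b s τ M.degree (b i) (monomial M 1)

lemma pbwOp_basis_monomial (i : I) (M : I →₀ ℕ) :
    pbwOp b s τ (b i) (monomial M 1) = pbwTrunc b s τ M.degree (b i) (monomial M 1) := by
  rw [pbwOp, Module.Basis.constr_basis, basisMonomials_constr_monomial]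

lemma pbwTrunc_basis_monomial {n : ℕ} (i : I) {M : I →₀ ℕ} (hM : M.degree ≤ n) :
    pbwTrunc b s τ n (b i) (monomial M 1) = pbwOp b s τ (b i) (monomial M 1) := by
  rw [pbwOp_basis_monomial]
  induction n with
  | zero => rw [Nat.le_zero.mp hM]
  | succ n ih =>
    rcases Nat.lt_or_ge n M.degree with hn | hn
    · rw [show M.degree = n + 1 by lia]
    · rw [← ih hn, pbwTrunc, Module.Basis.constr_basis, basisMonomials_constr_monomial, if_pos hn]

lemma pbwTrunc_eq_pbwOp {n : ℕ} (x : L) {f : MvPolynomial I S} (hf : f.totalDegree ≤ n) :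
    pbwTrunc b s τ n x f = pbwOp b s τ x f := by
  have hmem := apply_mem_of_basis b (pbwTrunc b s τ n - pbwOp b s τ) (p := ⊥) (f := f) (fun i =>
    mem_of_forall_monomial_mem
      (p := LinearMap.ker (pbwTrunc b s τ n (b i) - pbwOp b s τ (b i))) fun M hM => by
        rw [LinearMap.mem_ker, LinearMap.sub_apply, sub_eq_zero]
        exact pbwTrunc_basis_monomial b s τ i ((degree_le_totalDegree hM).trans hf)) x
  rwa [Submodule.mem_bot, LinearMap.sub_apply, LinearMap.sub_apply, sub_eq_zero] at hmem

lemma pbwOp_monomial_of_le {i : I} {M : I →₀ ℕ} (h : ∀ k ∈ M.support, i ≤ k) :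
    pbwOp b s τ (b i) (monomial M 1) = X i * monomial M 1 := by
  rw [pbwOp_basis_monomial]
  rcases hn : M.degree with _ | n
  · rw [pbwTrunc, Module.Basis.constr_basis, LinearMap.mulLeft_apply]
  · have hmin : ¬ M.support.min.untopD i < i := by
      rcases hj : M.support.min with _ | j
      · exact lt_irrefl i
      · exact not_lt.mpr (h j (Finset.mem_of_min hj))
    rw [pbwTrunc, Module.Basis.constr_basis, basisMonomials_constr_monomial, if_neg (by lia),
      if_neg hmin]

lemma pbwOp_mem_of_forall_monomial {p : Submodule S (MvPolynomial I S)} {f : MvPolynomial I S}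
    (h : ∀ i, ∀ M ∈ f.support, pbwOp b s τ (b i) (monomial M 1) ∈ p) (x : L) :
    pbwOp b s τ x f ∈ p :=
  apply_mem_of_basis b (pbwOp b s τ) (fun i => mem_of_forall_monomial_mem
    (p := p.comap (pbwOp b s τ (b i))) (h i)) x

/-- The recursion `pbwOp_monomial_of_lt`, before the degree bound that justifies it. -/
lemma pbwOp_monomial_of_lt_trunc {i j : I} (hji : j < i) {M : I →₀ ℕ}
    (hM : ∀ k ∈ M.support, j ≤ k) :
    pbwOp b s τ (b i) (X j * monomial M 1) =
      X i * (X j * monomial M 1) +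
      pbwTrunc b s τ M.degree (b j) (pbwOp b s τ (b i) (monomial M 1) - X i * monomial M 1) +
      s • pbwOp b s τ ⁅b i, b j⁆ (monomial M 1) + τ (b i) (b j) • monomial M 1 := by
  have hdeg : (Finsupp.single j 1 + M).degree = M.degree + 1 := by
    rw [map_add, Finsupp.degree_single, add_comm]
  have hmin : (Finsupp.single j 1 + M).support.min.untopD i = j := by
    rw [min_support_single_add hM, WithTop.untopD_coe]
  have htrunc (x : L) := pbwTrunc_eq_pbwOp b s τ x (totalDegree_monomial_le_degree (S := S) M)
  rw [X_mul_monomial_one, pbwOp_basis_monomial, hdeg, pbwTrunc, Module.Basis.constr_basis,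
    basisMonomials_constr_monomial]
  simp only [hmin, add_tsub_cancel_left, htrunc]
  rw [if_neg (by lia), if_pos hji]

lemma pbwOp_sub_X_mul_mem_restrictTotalDegree (i : I) (M : I →₀ ℕ) :
    pbwOp b s τ (b i) (monomial M 1) - X i * monomial M 1 ∈ restrictTotalDegree I S M.degree := by
  induction i, M using pbw_induction with
  | of_le i M h => rw [pbwOp_monomial_of_le b s τ h, sub_self]; exact zero_mem _
  | of_lt i j N hji hN ih =>
    have raise (x : L) {f : MvPolynomial I S} (hf : f.totalDegree ≤ N.degree) :
        pbwOp b s τ x f ∈ restrictTotalDegree I S (N.degree + 1) :=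
      pbwOp_mem_of_forall_monomial b s τ (fun l M hM => by
        have hMN : M.degree ≤ N.degree := (degree_le_totalDegree hM).trans hf
        have hlow := (mem_restrictTotalDegree ..).mp (ih l M hMN)
        have htop := totalDegree_X_mul_le l (monomial M (1 : S))
        have hmon := totalDegree_monomial_le_degree (S := S) M
        rw [← sub_add_cancel (pbwOp b s τ (b l) (monomial M 1)) (X l * monomial M 1)]
        exact add_mem ((mem_restrictTotalDegree ..).mpr (by lia))
          ((mem_restrictTotalDegree ..).mpr (by lia))) x
    have hlow := (mem_restrictTotalDegree ..).mp (ih i N le_rfl)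
    have hmon := totalDegree_monomial_le_degree (S := S) N
    rw [← X_mul_monomial_one, pbwOp_monomial_of_lt_trunc b s τ hji hN,
      pbwTrunc_eq_pbwOp b s τ _ hlow, map_add, Finsupp.degree_single, add_assoc, add_assoc,
      add_sub_cancel_left, add_comm 1]
    exact add_mem (raise _ hlow) (add_mem (Submodule.smul_mem _ _ (raise _ hmon))
      (Submodule.smul_mem _ _ ((mem_restrictTotalDegree ..).mpr (by lia))))

lemma totalDegree_pbwOp_sub_X_mul_le (i : I) (M : I →₀ ℕ) :
    (pbwOp b s τ (b i) (monomial M 1) - X i * monomial M 1).totalDegree ≤ M.degree :=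
  (mem_restrictTotalDegree ..).mp (pbwOp_sub_X_mul_mem_restrictTotalDegree b s τ i M)

lemma pbwOp_monomial_of_lt {i j : I} (hji : j < i) {M : I →₀ ℕ} (hM : ∀ k ∈ M.support, j ≤ k) :
    pbwOp b s τ (b i) (X j * monomial M 1) =
      X i * (X j * monomial M 1) +
      pbwOp b s τ (b j) (pbwOp b s τ (b i) (monomial M 1) - X i * monomial M 1) +
      s • pbwOp b s τ ⁅b i, b j⁆ (monomial M 1) + τ (b i) (b j) • monomial M 1 := by
  rw [pbwOp_monomial_of_lt_trunc b s τ hji hM,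
    pbwTrunc_eq_pbwOp b s τ _ (totalDegree_pbwOp_sub_X_mul_le b s τ i M)]

lemma commutatorDefect_pbwOp_monomial_of_lt {i j : I} (hji : j < i) {M : I →₀ ℕ}
    (hM : ∀ k ∈ M.support, j ≤ k) :
    commutatorDefect s τ (pbwOp b s τ) (b i) (b j) (monomial M 1) = 0 := by
  rw [commutatorDefect_apply_eq_zero_iff, pbwOp_monomial_of_le b s τ hM,
    pbwOp_monomial_of_lt b s τ hji hM, map_sub, X_mul_monomial_one i M,
    pbwOp_monomial_of_le b s τ (forall_mem_support_single_add_le hji.le hM),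
    ← X_mul_monomial_one i M, mul_left_comm (X j)]
  abel

lemma commutatorDefect_pbwOp_pbwOp_monomial {i k l : I} (hki : k < i) (hkl : k < l)
    {N : I →₀ ℕ} (hN : ∀ k' ∈ N.support, k ≤ k')
    (hlow : ∀ f : MvPolynomial I S, f.totalDegree ≤ N.degree →
      commutatorDefect s τ (pbwOp b s τ) (b i) (b k) f = 0) :
    commutatorDefect s τ (pbwOp b s τ) (b i) (b k) (pbwOp b s τ (b l) (monomial N 1)) = 0 := by
  rw [← sub_add_cancel (pbwOp b s τ (b l) (monomial N 1)) (X l * monomial N 1), map_add,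
    hlow _ (totalDegree_pbwOp_sub_X_mul_le b s τ l N), zero_add, X_mul_monomial_one]
  exact commutatorDefect_pbwOp_monomial_of_lt b s τ hki
    (forall_mem_support_single_add_le hkl.le hN)

variable {τ}

lemma commutatorDefect_pbwOp (hτ : τ.IsAlt)
    (hτ' : ∀ x y z, τ x ⁅y, z⁆ + τ y ⁅z, x⁆ + τ z ⁅x, y⁆ = 0) (x y : L) (f : MvPolynomial I S) :
    commutatorDefect s τ (pbwOp b s τ) x y f = 0 := by
  induction hn : f.totalDegree using Nat.strong_induction_on generalizing x y f with
  | _ n ih =>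
  refine commutatorDefect_apply_eq_zero_of_basis b hτ (fun i j hji => ?_) x y
  refine mem_of_forall_monomial_mem
    (p := LinearMap.ker (commutatorDefect s τ (pbwOp b s τ) (b i) (b j))) fun M hM => ?_
  rw [LinearMap.mem_ker]
  rcases eq_zero_or_exists_eq_single_add M with rfl | ⟨k, N, rfl, hN⟩
  · exact commutatorDefect_pbwOp_monomial_of_lt b s τ hji (by simp)
  rcases le_or_gt j k with hjk | hkj
  · exact commutatorDefect_pbwOp_monomial_of_lt b s τ hji
      (forall_mem_support_single_add_le hjk fun l hl => hjk.trans (hN l hl))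
  have hdeg := degree_le_totalDegree hM
  rw [map_add, Finsupp.degree_single] at hdeg
  have hlow (f : MvPolynomial I S) (hf : f.totalDegree ≤ N.degree) (x y : L) :
      commutatorDefect s τ (pbwOp b s τ) x y f = 0 := ih _ (by lia) x y f rfl
  have hki := hkj.trans hji
  rw [← X_mul_monomial_one, ← pbwOp_monomial_of_le b s τ hN]
  exact commutatorDefect_apply_apply_eq_zero hτ hτ'
    (hlow _ (totalDegree_monomial_le_degree N))
    (commutatorDefect_pbwOp_pbwOp_monomial b s τ hkj hki hN fun f hf => hlow f hf _ _)
    (commutatorDefect_pbwOp_pbwOp_monomial b s τ hki hkj hN fun f hf => hlow f hf _ _)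

theorem pbwOp_comm (hτ : τ.IsAlt)
    (hτ' : ∀ x y z, τ x ⁅y, z⁆ + τ y ⁅z, x⁆ + τ z ⁅x, y⁆ = 0) (x y : L) (f : MvPolynomial I S) :
    pbwOp b s τ x (pbwOp b s τ y f) =
      pbwOp b s τ y (pbwOp b s τ x f) + s • pbwOp b s τ ⁅x, y⁆ f + τ x y • f :=
  commutatorDefect_apply_eq_zero_iff.mp (commutatorDefect_pbwOp b s hτ hτ' x y f)

variable (τ)

section Naturality

variable {S' : Type*} [CommRing S'] [Algebra K S'] (φ : S →ₐ[K] S')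

lemma map_pbwOp_of_forall_monomial {f : MvPolynomial I S}
    (h : ∀ i, ∀ M ∈ f.support, map (φ : S →+* S') (pbwOp b s τ (b i) (monomial M 1)) =
      pbwOp b (φ s) (τ.compr₂ φ.toLinearMap) (b i) (monomial M 1)) (x : L) :
    map (φ : S →+* S') (pbwOp b s τ x f) =
      pbwOp b (φ s) (τ.compr₂ φ.toLinearMap) x (map (φ : S →+* S') f) := by
  have hmap (c : S) (p : MvPolynomial I S) :
      map (φ : S →+* S') (c • p) = φ c • map (φ : S →+* S') p := by
    rw [smul_eq_C_mul, map_mul, map_C, smul_eq_C_mul, RingHom.coe_coe]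
  have hb : (mapAlgHom φ).toLinearMap ∘ₗ
        (LinearMap.applyₗ (R := S) f).restrictScalars K ∘ₗ pbwOp b s τ =
      (LinearMap.applyₗ (R := S') (map (φ : S →+* S') f)).restrictScalars K ∘ₗ
        pbwOp b (φ s) (τ.compr₂ φ.toLinearMap) := b.ext fun i => by
    change map (φ : S →+* S') (pbwOp b s τ (b i) f) =
      pbwOp b (φ s) (τ.compr₂ φ.toLinearMap) (b i) (map (φ : S →+* S') f)
    have hf : f = ∑ M ∈ f.support, f.coeff M • monomial M (1 : S) := by
      conv_lhs => rw [f.as_sum]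
      simp only [smul_monomial, smul_eq_mul, mul_one]
    rw [hf]
    simp only [map_sum, map_smul, hmap, map_monomial, map_one]
    exact Finset.sum_congr rfl fun M hM => by rw [h i M hM]
  exact LinearMap.congr_fun hb x

lemma map_pbwOp_monomial (i : I) (M : I →₀ ℕ) :
    map (φ : S →+* S') (pbwOp b s τ (b i) (monomial M 1)) =
      pbwOp b (φ s) (τ.compr₂ φ.toLinearMap) (b i) (monomial M 1) := by
  have hmon (M : I →₀ ℕ) : map (φ : S →+* S') (monomial M 1) = monomial M 1 := by
    rw [map_monomial, map_one]
  have hmap (c : S) (p : MvPolynomial I S) :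
      map (φ : S →+* S') (c • p) = φ c • map (φ : S →+* S') p := by
    rw [smul_eq_C_mul, map_mul, map_C, smul_eq_C_mul, RingHom.coe_coe]
  induction i, M using pbw_induction with
  | of_le i M h =>
    rw [pbwOp_monomial_of_le b s τ h, pbwOp_monomial_of_le b _ _ h, map_mul, map_X, hmon]
  | of_lt i j N hji hN ih =>
    have hlow (x : L) {f : MvPolynomial I S} (hf : f.totalDegree ≤ N.degree) :=
      map_pbwOp_of_forall_monomial b s τ φ (f := f)
        (fun l M hM => ih l M ((degree_le_totalDegree hM).trans hf)) x
    rw [← X_mul_monomial_one, ← X_mul_monomial_one, pbwOp_monomial_of_lt b s τ hji hN,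
      pbwOp_monomial_of_lt b _ _ hji hN]
    rw [map_add, map_add, map_add]
    simp only [map_mul, map_X, hmon, hmap,
      hlow _ (totalDegree_pbwOp_sub_X_mul_le b s τ i N), hlow _ (totalDegree_monomial_le_degree N),
      map_sub (map (φ : S →+* S')), LinearMap.compr₂_apply, AlgHom.toLinearMap_apply]

lemma map_pbwOp (x : L) (f : MvPolynomial I S) :
    map (φ : S →+* S') (pbwOp b s τ x f) =
      pbwOp b (φ s) (τ.compr₂ φ.toLinearMap) x (map (φ : S →+* S') f) :=
  map_pbwOp_of_forall_monomial b s τ φ (fun i M _ => map_pbwOp_monomial b s τ φ i M) x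

end Naturality

lemma pbwOp_zero_zero (i : I) : pbwOp b (0 : S) (0 : L →ₗ[K] L →ₗ[K] S) (b i) =
    LinearMap.mulLeft S (X i) := by
  refine (basisMonomials I S).ext fun M => ?_
  simp only [coe_basisMonomials, LinearMap.mulLeft_apply]
  induction i, M using pbw_induction with
  | of_le i M h => exact pbwOp_monomial_of_le b _ _ h
  | of_lt i j N hji hN ih =>
    rw [← X_mul_monomial_one, pbwOp_monomial_of_lt b _ _ hji hN, ih i N le_rfl, sub_self, map_zero,
      add_zero, zero_smul, add_zero, LinearMap.zero_apply, LinearMap.zero_apply, zero_smul,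
      add_zero]

section Ideal

variable {H : Set I}

variable {b s τ}

lemma pbwOp_monomial_zero_mem_span_X_image {x : L} (hx : x ∈ Submodule.span K (b '' H)) :
    pbwOp b s τ x (monomial 0 1) ∈ Ideal.span (X '' H) := by
  have hspan : Submodule.span K (b '' H) ≤
      (((Ideal.span (X '' H)).restrictScalars S).restrictScalars K).comap
        ((LinearMap.applyₗ (R := S) (monomial (0 : I →₀ ℕ) (1 : S))).restrictScalars K ∘ₗ
          pbwOp b s τ) := by
    refine Submodule.span_le.mpr (Set.image_subset_iff.mpr fun i hi => ?_)
    change pbwOp b s τ (b i) (monomial 0 1) ∈ Ideal.span (X '' H)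
    rw [pbwOp_monomial_of_le b s τ (by simp)]
    exact Ideal.mul_mem_right _ _ (X_mem_span_X_image hi)
  exact hspan hx

lemma pbwOp_mem_span_X_image_of_forall_monomial {f : MvPolynomial I S}
    (hf : f ∈ Ideal.span (X '' H)) (h : ∀ i, ∀ M ∈ f.support, (∃ k ∈ H, k ∈ M.support) →
      pbwOp b s τ (b i) (monomial M 1) ∈ Ideal.span (X '' H)) (x : L) :
    pbwOp b s τ x f ∈ Ideal.span (X '' H) :=
  pbwOp_mem_of_forall_monomial b s τ (p := (Ideal.span (X '' H)).restrictScalars S)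
    (fun i M hM => h i M hM (exists_mem_of_monomial_mem_support hf hM)) x

lemma pbwOp_monomial_mem_span_X_image (hH : IsUpperSet H)
    (hbr : ∀ i ∈ H, ∀ j ∈ H, ⁅b i, b j⁆ ∈ Submodule.span K (b '' H))
    (hτ : ∀ i ∈ H, ∀ j ∈ H, τ (b i) (b j) = 0) (i : I) (M : I →₀ ℕ)
    (hM : ∃ k ∈ H, k ∈ M.support) :
    pbwOp b s τ (b i) (monomial M 1) ∈ Ideal.span (X '' H) := by
  induction i, M using pbw_induction with
  | of_le i M h =>
    obtain ⟨k, hk, hkM⟩ := hM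
    rw [pbwOp_monomial_of_le b s τ h]
    exact Ideal.mul_mem_left _ _ (monomial_mem_span_X_image hk hkM)
  | of_lt i j N hji hN ih =>
    obtain ⟨k, hk, hkM⟩ := hM
    have hXi : X i * (X j * monomial N (1 : S)) ∈ Ideal.span (X '' H) :=
      Ideal.mul_mem_left _ _ (X_mul_monomial_one (S := S) j N ▸ monomial_mem_span_X_image hk hkM)
    rw [← X_mul_monomial_one, pbwOp_monomial_of_lt b s τ hji hN]
    by_cases hNH : ∃ l ∈ H, l ∈ N.support
    · have hmon : monomial N (1 : S) ∈ Ideal.span (X '' H) :=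
        monomial_mem_span_X_image hNH.choose_spec.1 hNH.choose_spec.2
      have hlow (x : L) {f : MvPolynomial I S} (hf : f.totalDegree ≤ N.degree)
          (hfH : f ∈ Ideal.span (X '' H)) :=
        pbwOp_mem_span_X_image_of_forall_monomial hfH
          (fun l M hM => ih l M ((degree_le_totalDegree hM).trans hf)) x
      exact add_mem (add_mem (add_mem hXi (hlow _ (totalDegree_pbwOp_sub_X_mul_le b s τ i N)
          (sub_mem (ih i N le_rfl hNH) (Ideal.mul_mem_left _ _ hmon))))
        (Submodule.smul_of_tower_mem _ s (hlow _ (totalDegree_monomial_le_degree N) hmon)))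
        (Submodule.smul_of_tower_mem _ _ hmon)
    · have hjH : j ∈ H := by
        rcases mem_support_single_add.mp hkM with rfl | hkN
        exacts [hk, absurd ⟨k, hk, hkN⟩ hNH]
      have hiH : i ∈ H := hH hji.le hjH
      obtain rfl : N = 0 := Finsupp.support_eq_empty.mp
        (Finset.eq_empty_of_forall_notMem fun l hl => hNH ⟨l, hH (hN l hl) hjH, hl⟩)
      rw [pbwOp_monomial_of_le b s τ (by simp), sub_self, map_zero, add_zero, hτ i hiH j hjH,
        zero_smul, add_zero]
      exact add_mem hXi
        (Submodule.smul_of_tower_mem _ s (pbwOp_monomial_zero_mem_span_X_image (hbr i hiH j hjH)))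

lemma pbwOp_mem_span_X_image (hH : IsUpperSet H)
    (hbr : ∀ i ∈ H, ∀ j ∈ H, ⁅b i, b j⁆ ∈ Submodule.span K (b '' H))
    (hτ : ∀ i ∈ H, ∀ j ∈ H, τ (b i) (b j) = 0) (x : L) {f : MvPolynomial I S}
    (hf : f ∈ Ideal.span (X '' H)) : pbwOp b s τ x f ∈ Ideal.span (X '' H) :=
  pbwOp_mem_span_X_image_of_forall_monomial hf
    (fun i M _ => pbwOp_monomial_mem_span_X_image hH hbr hτ i M) x

end Ideal

end Action

end PBW

section RegularAtInfinity

lemma kap_ne_zero : kap ≠ 0 := RatFunc.X_ne_zero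

/-- The ring `R` of rational functions of `κ` that are regular at `κ = ∞`, i.e. whose numerator has
at most the degree of the denominator. -/
def regularAtInfinity : Subalgebra ℂ (RatFunc ℂ) where
  carrier := {f | f.intDegree ≤ 0}
  mul_mem' {f f'} hf hf' := by
    rcases eq_or_ne f 0 with rfl | h
    · simp
    rcases eq_or_ne f' 0 with rfl | h'
    · simp
    exact (RatFunc.intDegree_mul h h').trans_le (add_nonpos hf hf')
  add_mem' {f f'} hf hf' := by
    rcases eq_or_ne f' 0 with rfl | h
    · simpa using hf
    rcases eq_or_ne (f + f') 0 with h' | h'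
    · simp [h']
    exact (RatFunc.intDegree_add_le h h').trans (max_le hf hf')
  algebraMap_mem' c := by
    rw [RatFunc.algebraMap_eq_C, Set.mem_ofPred_eq, RatFunc.intDegree_C]

lemma mem_regularAtInfinity {f : RatFunc ℂ} : f ∈ regularAtInfinity ↔ f.intDegree ≤ 0 := Iff.rfl

lemma kap_inv_mem : kap⁻¹ ∈ regularAtInfinity := by
  simp [mem_regularAtInfinity, kap, RatFunc.intDegree_inv]

lemma kap_notMem : kap ∉ regularAtInfinity := by
  simp [mem_regularAtInfinity, kap]

/-- The parameter `κ⁻¹` as an element of the ring of functions regular at infinity. -/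
def hbar : regularAtInfinity := ⟨kap⁻¹, kap_inv_mem⟩

lemma kap_mul_div_mem {r d : Polynomial ℂ} (h : r.degree < d.degree) :
    kap * (algebraMap _ (RatFunc ℂ) r / algebraMap _ (RatFunc ℂ) d) ∈ regularAtInfinity := by
  rcases eq_or_ne r 0 with rfl | hr
  · simp
  have hd : d ≠ 0 := by rintro rfl; simp at h
  have hr' := RatFunc.algebraMap_ne_zero hr
  have hd' := RatFunc.algebraMap_ne_zero hd
  have hdeg := Polynomial.natDegree_lt_natDegree hr h
  rw [mem_regularAtInfinity, RatFunc.intDegree_mul kap_ne_zero (div_ne_zero hr' hd'),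
    RatFunc.intDegree_div hr' hd', kap, RatFunc.intDegree_X, RatFunc.intDegree_polynomial,
    RatFunc.intDegree_polynomial]
  lia

lemma exists_eq_algebraMap_add_hbar_mul (f : regularAtInfinity) :
    ∃ (c : ℂ) (f' : regularAtInfinity), f = algebraMap ℂ _ c + hbar * f' := by
  obtain ⟨f, hf⟩ := f
  have hmonic := RatFunc.monic_denom f
  have hdeg : f.num.natDegree ≤ f.denom.natDegree := by
    rw [mem_regularAtInfinity, RatFunc.intDegree] at hf
    lia
  have hquot : f.num /ₘ f.denom = Polynomial.C ((f.num /ₘ f.denom).coeff 0) :=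
    Polynomial.eq_C_of_natDegree_eq_zero <| by
      rw [Polynomial.natDegree_divByMonic _ hmonic, Nat.sub_eq_zero_of_le hdeg]
  refine ⟨(f.num /ₘ f.denom).coeff 0,
    ⟨_, kap_mul_div_mem (Polynomial.degree_modByMonic_lt f.num hmonic)⟩, Subtype.ext ?_⟩
  change f = algebraMap ℂ (RatFunc ℂ) _ + kap⁻¹ * (kap * _)
  have hdenom := RatFunc.algebraMap_ne_zero f.denom_ne_zero
  rw [inv_mul_cancel_left₀ kap_ne_zero, RatFunc.algebraMap_eq_C, ← RatFunc.algebraMap_C, ← hquot,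
    eq_comm, ← RatFunc.num_div_denom f]
  conv_rhs => rw [← Polynomial.modByMonic_add_div f.num f.denom]
  simp only [RatFunc.num_div_denom, map_add, map_mul]
  field_simp
  ring

lemma span_hbar_ne_top : Ideal.span {hbar} ≠ ⊤ := by
  rw [Ne, Ideal.span_singleton_eq_top, isUnit_iff_exists_inv]
  rintro ⟨f, hf⟩
  have hkap : kap⁻¹ * (f : RatFunc ℂ) = 1 := congrArg Subtype.val hf
  rw [inv_mul_eq_one₀ kap_ne_zero] at hkap
  exact kap_notMem (hkap ▸ f.2)

lemma bijective_ofId_quotient_hbar :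
    Function.Bijective (Algebra.ofId ℂ (regularAtInfinity ⧸ Ideal.span {hbar})) := by
  have := Ideal.Quotient.nontrivial_iff.mpr span_hbar_ne_top
  refine ⟨RingHom.injective _, fun f => ?_⟩
  obtain ⟨f, rfl⟩ := Ideal.Quotient.mk_surjective f
  obtain ⟨c, f', rfl⟩ := exists_eq_algebraMap_add_hbar_mul f
  refine ⟨c, (Ideal.Quotient.eq.mpr ?_).symm⟩
  rw [add_sub_cancel_left]
  exact Ideal.mul_mem_right _ _ (Ideal.mem_span_singleton_self _)

/-- The value at `κ = ∞` of a rational function regular there, i.e. its residue modulo `κ⁻¹`. -/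
def valueAtInfinity : regularAtInfinity →ₐ[ℂ] ℂ :=
  (AlgEquiv.ofBijective _ bijective_ofId_quotient_hbar).symm.toAlgHom.comp
    (Ideal.Quotient.mkₐ ℂ (Ideal.span {hbar}))

lemma valueAtInfinity_hbar : valueAtInfinity hbar = 0 := by
  rw [valueAtInfinity, AlgHom.comp_apply, Ideal.Quotient.mkₐ_eq_mk,
    Ideal.Quotient.eq_zero_iff_mem.mpr (Ideal.mem_span_singleton_self _), map_zero]

lemma exists_eq_valueAtInfinity_add_hbar_mul (f : regularAtInfinity) :
    ∃ f', f = algebraMap ℂ _ (valueAtInfinity f) + hbar * f' := by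
  obtain ⟨c, f', rfl⟩ := exists_eq_algebraMap_add_hbar_mul f
  refine ⟨f', ?_⟩
  rw [map_add, map_mul, valueAtInfinity_hbar, zero_mul, add_zero, AlgHom.commutes,
    Algebra.algebraMap_self_apply]

end RegularAtInfinity

section Loop

open LieAlgebra

variable {g : Type*} [LieRing g] [LieAlgebra ℂ g] (B : LinearMap.BilinForm ℂ g)

/-- The map `a ↦ a ⊗ z ^ m` into the loop algebra. -/
def loopElt (m : ℤ) : g →ₗ[ℂ] loopAlgebra ℂ ℤ g :=
  TensorProduct.mk ℂ _ _ (AddMonoidAlgebra.single m 1)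

lemma loopElt_lie (a b : g) (m n : ℤ) : ⁅loopElt m a, loopElt n b⁆ = loopElt (m + n) ⁅a, b⁆ := by
  simp only [loopElt, TensorProduct.mk_apply]
  rw [ExtendScalars.bracket_tmul, AddMonoidAlgebra.single_mul_single, mul_one]

/-- The residue cocycle of the loop algebra, `(a ⊗ z ^ m, b ⊗ z ^ n) ↦ m δ_{m, -n} ⟨a, b⟩`. -/
def loopCocycle : loopAlgebra ℂ ℤ g →ₗ[ℂ] loopAlgebra ℂ ℤ g →ₗ[ℂ] ℂ :=
  LinearMap.flip (LoopAlgebra.residuePairing ℂ ℤ g B)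

variable {B}

lemma loopCocycle_loopElt (hB : B.IsSymm) (a b : g) (m n : ℤ) :
    loopCocycle B (loopElt m a) (loopElt n b) = if m + n = 0 then m * B a b else 0 := by
  simp only [loopCocycle, LinearMap.flip_apply, loopElt, TensorProduct.mk_apply,
    LoopAlgebra.residuePairing_apply_apply, LoopAlgebra.toFinsupp_single_tmul]
  rw [Finsupp.sum_single_index (by simp), Finsupp.single_apply, hB.eq, zsmul_eq_mul]
  split_ifs <;> first | rfl | lia | simp

lemma loopCocycle_isAlt (hB : B.IsSymm) : (loopCocycle B).IsAlt :=
  (LoopAlgebra.twoCochainOfBilinear ℂ ℤ g B hB).2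

lemma loopCocycle_lie (hB : B.IsSymm) (hB' : B.lieInvariant g) (x y z : loopAlgebra ℂ ℤ g) :
    loopCocycle B x ⁅y, z⁆ + loopCocycle B y ⁅z, x⁆ + loopCocycle B z ⁅x, y⁆ = 0 := by
  have hcocycle : loopCocycle B ⁅y, z⁆ x = loopCocycle B z ⁅x, y⁆ + loopCocycle B ⁅x, z⁆ y :=
    (LieModule.Cohomology.mem_twoCocycle_iff_of_trivial _ _ _ _).mp
      (LoopAlgebra.twoCocycleOfBilinear ℂ ℤ g B hB' hB).2 x y z
  have halt := loopCocycle_isAlt hB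
  have hx := halt.neg x ⁅y, z⁆
  have hy := halt.neg y ⁅x, z⁆
  rw [← lie_skew z x, map_neg]
  linear_combination -hx - hcocycle + hy

/-- The basis `v i ⊗ z ^ m` of the loop algebra, indexed by `(m, i)` in lexicographic order: the
high modes form an upper set. -/
def loopBasis {ι : Type*} (v : Module.Basis ι ℂ g) :
    Module.Basis (ℤ ×ₗ ι) ℂ (loopAlgebra ℂ ℤ g) :=
  ((AddMonoidAlgebra.basis ℤ ℂ).tensorProduct v).reindex toLex

lemma loopBasis_apply {ι : Type*} (v : Module.Basis ι ℂ g) (m : ℤ) (i : ι) :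
    loopBasis v (toLex (m, i)) = loopElt m (v i) := by
  simp [loopBasis, loopElt]

end Loop

section ModeAlgebra

variable {S : Type*} [CommRing S] [Algebra ℂ S] {σ : Type*}
  {g : Type*} [LieRing g] [LieAlgebra ℂ g] {B : LinearMap.BilinForm ℂ g} {k : σ → S}

lemma ModeAlgebra.lift_mode {C : Type*} [Ring C] [Algebra S C]
    (f : FreeAlgebra S (σ × g × ℤ) →ₐ[S] C) (hf : ∀ x y, ModeRel S B k x y → f x = f y)
    (s : σ) (a : g) (n : ℤ) :
    ModeAlgebra.lift f hf (mode S B k s a n) = f (FreeAlgebra.ι S (s, a, n)) :=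
  RingQuot.liftAlgHom_mkAlgHom_apply (S := S) f hf _

/-- The representation of the mode algebra by operators `J s n a` that are linear in `a` and
satisfy the commutation relations of the modes. -/
def ModeAlgebra.ofModes {C : Type*} [Ring C] [Algebra S C] [Algebra ℂ C] [IsScalarTower ℂ S C]
    (J : σ → ℤ → g →ₗ[ℂ] C)
    (comm : ∀ s a b m n, J s m a * J s n b = J s n b * J s m a + J s (m + n) ⁅a, b⁆ +
      algebraMap S C (if m + n = 0 then algebraMap ℂ S (m * B a b) * k s else 0))
    (comm_of_ne : ∀ s t, s ≠ t → ∀ a b m n, J s m a * J t n b = J t n b * J s m a) :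
    ModeAlgebra S B k →ₐ[S] C :=
  ModeAlgebra.lift (FreeAlgebra.lift S fun p => J p.1 p.2.2 p.2.1) fun x y h => by
    induction h with
    | add s a b n => simp only [FreeAlgebra.lift_ι_apply, map_add]
    | smul s c a n =>
      rw [map_smul, FreeAlgebra.lift_ι_apply, FreeAlgebra.lift_ι_apply, map_smul, algebraMap_smul]
    | comm s a b m n =>
      rw [map_mul, map_add, map_add, map_mul, AlgHom.commutes]
      simp only [FreeAlgebra.lift_ι_apply]
      rw [comm]
    | comm_of_ne s t hst a b m n =>
      simp only [FreeAlgebra.lift_ι_apply, map_mul, comm_of_ne s t hst]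

lemma ModeAlgebra.ofModes_mode {C : Type*} [Ring C] [Algebra S C] [Algebra ℂ C]
    [IsScalarTower ℂ S C] (J : σ → ℤ → g →ₗ[ℂ] C) (comm) (comm_of_ne) (s : σ) (a : g) (n : ℤ) :
    ModeAlgebra.ofModes (B := B) (k := k) J comm comm_of_ne (mode S B k s a n) = J s n a := by
  rw [ofModes, lift_mode, FreeAlgebra.lift_ι_apply]

lemma ModeAlgebra.mem_of_forall_mode_mem (P : Subalgebra S (ModeAlgebra S B k))
    (h : ∀ s a n, mode S B k s a n ∈ P) (u : ModeAlgebra S B k) : u ∈ P := by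
  obtain ⟨x, rfl⟩ := RingQuot.mkAlgHom_surjective S (ModeRel S B k) u
  induction x using FreeAlgebra.induction with
  | grade0 r => rw [AlgHom.commutes]; exact P.algebraMap_mem r
  | grade1 x => exact h x.1 x.2.1 x.2.2
  | mul x y hx hy => rw [map_mul]; exact P.mul_mem hx hy
  | add x y hx hy => rw [map_add]; exact P.add_mem hx hy

lemma mode_mul_of_ne {s t : σ} (hst : s ≠ t) (a b : g) (m n : ℤ) :
    mode S B k s a m * mode S B k t b n = mode S B k t b n * mode S B k s a m := by
  have h := ModeAlgebra.proj_rel (ModeRel.comm_of_ne (B := B) (k := k) s t hst a b m n)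
  rwa [map_mul, map_mul] at h

variable (S B k) in
/-- The modes `a_n` of fixed factor and degree, as a linear map of `a`. -/
def modeLin (s : σ) (n : ℤ) : g →ₗ[ℂ] ModeAlgebra S B k where
  toFun a := mode S B k s a n
  map_add' a b := mode_add S B k s a b n
  map_smul' c a := by rw [mode_smul, algebraMap_smul, RingHom.id_apply]

@[simp] lemma modeLin_apply (s : σ) (n : ℤ) (a : g) : modeLin S B k s n a = mode S B k s a n := rfl

lemma inclOne_modeOne (a : g) (n : ℤ) :
    inclOne B (modeOne B a n) = ⟨modeY B a n, modeY_mem B a n⟩ := by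
  rw [inclOne, modeOne, ModeAlgebra.lift_mode, FreeAlgebra.lift_ι_apply]

end ModeAlgebra

section InducedOperator

variable {k K U X Y Q : Type*} [CommRing k] [CommRing K] [Algebra k K] [Ring U] [Algebra k U]
  [AddCommGroup X] [Module K X] [Module k X] [IsScalarTower k K X]
  [AddCommGroup Y] [Module k Y] [AddCommGroup Q] [Module k Q]
  (ρ : U →ₐ[k] Module.End K X) (i : Y →ₗ[k] X) (π : Y →ₗ[k] Q)

/-- For a representation of `U` on `X` and linear maps `X ← Y → Q`, the pairs of an element of `U`
that lifts to `Y` and an operator on `Q` that it induces. When `Y → X` is injective and `Y → Q` is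
surjective, this is the graph of the action of a subalgebra of `U` on the subquotient `Q`. -/
def inducedGraph : Subalgebra k (U × Module.End k Q) where
  carrier := {p | ∀ y, ∃ y', ρ p.1 (i y) = i y' ∧ π y' = p.2 (π y)}
  mul_mem' {p p'} hp hp' y := by
    obtain ⟨y₁, h₁, h₁'⟩ := hp' y
    obtain ⟨y₂, h₂, h₂'⟩ := hp y₁
    exact ⟨y₂, by rw [Prod.fst_mul, map_mul, Module.End.mul_apply, h₁, h₂],
      by rw [h₂', h₁', Prod.snd_mul, Module.End.mul_apply]⟩
  add_mem' {p p'} hp hp' y := by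
    obtain ⟨y₁, h₁, h₁'⟩ := hp y
    obtain ⟨y₂, h₂, h₂'⟩ := hp' y
    exact ⟨y₁ + y₂, by rw [Prod.fst_add, map_add, LinearMap.add_apply, h₁, h₂, map_add],
      by rw [map_add, h₁', h₂', Prod.snd_add, LinearMap.add_apply]⟩
  algebraMap_mem' c y := by
    refine ⟨c • y, ?_, ?_⟩
    · rw [Prod.algebraMap_apply, AlgHom.commutes, Module.algebraMap_end_apply, map_smul]
    · rw [Prod.algebraMap_apply, Module.algebraMap_end_apply, map_smul]

variable {ρ i π}

lemma mem_inducedGraph_of_comp_eq {u : U} {χ : Module.End k Q} (T : Module.End k Y)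
    (hi : (ρ u).restrictScalars k ∘ₗ i = i ∘ₗ T) (hπ : π ∘ₗ T = χ ∘ₗ π) :
    (u, χ) ∈ inducedGraph ρ i π :=
  fun y => ⟨T y, LinearMap.congr_fun hi y, LinearMap.congr_fun hπ y⟩

lemma inducedGraph_unique (hi : Function.Injective i) (hπ : Function.Surjective π) {u : U}
    {χ χ' : Module.End k Q} (h : (u, χ) ∈ inducedGraph ρ i π) (h' : (u, χ') ∈ inducedGraph ρ i π) :
    χ = χ' := by
  refine LinearMap.ext fun q => ?_
  obtain ⟨y, rfl⟩ := hπ q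
  obtain ⟨z, hz, hzy⟩ := h y
  obtain ⟨z', hz', hzy'⟩ := h' y
  rw [← hzy, ← hzy', hi (hz.symm.trans hz')]

lemma injective_fst_comp_inducedGraph_val (hi : Function.Injective i)
    (hπ : Function.Surjective π) :
    Function.Injective ((AlgHom.fst k U (Module.End k Q)).comp (inducedGraph ρ i π).val) := by
  rintro ⟨⟨u, χ⟩, h⟩ ⟨⟨u', χ'⟩, h'⟩ (rfl : u = u')
  obtain rfl := inducedGraph_unique hi hπ h h'
  rfl

/-- The action on the subquotient `Q` of a subalgebra whose elements all induce operators there. -/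
def inducedHom (hi : Function.Injective i) (hπ : Function.Surjective π) {U' : Subalgebra k U}
    (hU' : U' ≤ ((AlgHom.fst k U _).comp (inducedGraph ρ i π).val).range) :
    U' →ₐ[k] Module.End k Q :=
  ((AlgHom.snd k U _).comp (inducedGraph ρ i π).val).comp <|
    (AlgEquiv.ofInjective _ (injective_fst_comp_inducedGraph_val hi hπ)).symm.toAlgHom.comp <|
      Subalgebra.inclusion hU'

lemma inducedHom_mem_inducedGraph (hi : Function.Injective i) (hπ : Function.Surjective π)
    {U' : Subalgebra k U}
    (hU' : U' ≤ ((AlgHom.fst k U _).comp (inducedGraph ρ i π).val).range) (u : U') :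
    ((u : U), inducedHom hi hπ hU' u) ∈ inducedGraph ρ i π := by
  let e := AlgEquiv.ofInjective _ (injective_fst_comp_inducedGraph_val (ρ := ρ) hi hπ)
  have hu : (e.symm (Subalgebra.inclusion hU' u)).1.1 = u :=
    congrArg Subtype.val (e.apply_symm_apply (Subalgebra.inclusion hU' u))
  have hmem := (e.symm (Subalgebra.inclusion hU' u)).2
  rwa [← Prod.mk.eta (p := (e.symm (Subalgebra.inclusion hU' u)).1), hu] at hmem

lemma inducedHom_eq (hi : Function.Injective i) (hπ : Function.Surjective π)
    {U' : Subalgebra k U} (hU' : U' ≤ ((AlgHom.fst k U _).comp (inducedGraph ρ i π).val).range)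
    {u : U'} {χ : Module.End k Q}
    (h : ((u : U), χ) ∈ inducedGraph ρ i π) : inducedHom hi hπ hU' u = χ :=
  inducedGraph_unique hi hπ (inducedHom_mem_inducedGraph hi hπ hU' u) h

end InducedOperator

section TensorRepresentation

variable {g : Type*} [LieRing g] [LieAlgebra ℂ g] {B : LinearMap.BilinForm ℂ g}
  {C : Type*} [Ring C] [Algebra (RatFunc ℂ) C] [Algebra ℂ C]

/-- The homomorphism from the product of the affine Lie algebras of levels `κ - 1` and `1` given by
commuting operators `X n a` and `Y n a` that satisfy the relations of the two factors. -/
def genericHom [IsScalarTower ℂ (RatFunc ℂ) C] (X Y : ℤ → g →ₗ[ℂ] C)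
    (hX : ∀ a b m n, X m a * X n b = X n b * X m a + X (m + n) ⁅a, b⁆ +
      algebraMap (RatFunc ℂ) C
        (if m + n = 0 then algebraMap ℂ (RatFunc ℂ) (m * B a b) * (kap - 1) else 0))
    (hY : ∀ a b m n, Y m a * Y n b = Y n b * Y m a + Y (m + n) ⁅a, b⁆ +
      algebraMap ℂ C (if m + n = 0 then m * B a b else 0))
    (hXY : ∀ a b m n, X m a * Y n b = Y n b * X m a) : Generic B →ₐ[RatFunc ℂ] C :=
  ModeAlgebra.ofModes ![X, Y]
    (Fin.forall_fin_two.mpr ⟨hX, fun a b m n => by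
      have h := hY a b m n
      rw [IsScalarTower.algebraMap_apply ℂ (RatFunc ℂ) C, apply_ite (algebraMap ℂ (RatFunc ℂ)),
        map_zero, ← mul_one (algebraMap ℂ (RatFunc ℂ) _)] at h
      exact h⟩)
    (Fin.forall_fin_two.mpr ⟨Fin.forall_fin_two.mpr ⟨fun h => absurd rfl h, fun _ => hXY⟩,
      Fin.forall_fin_two.mpr
        ⟨fun _ a b m n => (hXY b a n m).symm, fun h => absurd rfl h⟩⟩)

lemma genericHom_modeX [IsScalarTower ℂ (RatFunc ℂ) C] (X Y : ℤ → g →ₗ[ℂ] C) (hX) (hY) (hXY)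
    (a : g) (n : ℤ) : genericHom (B := B) X Y hX hY hXY (modeX B a n) = X n a := by
  rw [genericHom, modeX, ModeAlgebra.ofModes_mode, Matrix.cons_val_zero]

lemma genericHom_modeY [IsScalarTower ℂ (RatFunc ℂ) C] (X Y : ℤ → g →ₗ[ℂ] C) (hX) (hY) (hXY)
    (a : g) (n : ℤ) : genericHom (B := B) X Y hX hY hXY (modeY B a n) = Y n a := by
  rw [genericHom, modeY, ModeAlgebra.ofModes_mode, Matrix.cons_val_one, Matrix.cons_val_fin_one]

/-- The commutation relations of the modes `a_n / κ` of level `κ - 1`. -/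
def IsScaledModes (B : LinearMap.BilinForm ℂ g) (T : ℤ → g →ₗ[ℂ] C) : Prop :=
  ∀ a b m n, T m a * T n b = T n b * T m a + kap⁻¹ • T (m + n) ⁅a, b⁆ +
    algebraMap (RatFunc ℂ) _
      (if m + n = 0 then algebraMap ℂ (RatFunc ℂ) (m * B a b) * (kap⁻¹ - kap⁻¹ ^ 2) else 0)

lemma IsScaledModes.kap_smul_mul {T : ℤ → g →ₗ[ℂ] C} (hT : IsScaledModes B T) (a b : g)
    (m n : ℤ) :
    kap • T m a * kap • T n b = kap • T n b * kap • T m a + kap • T (m + n) ⁅a, b⁆ +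
      algebraMap (RatFunc ℂ) C
        (if m + n = 0 then algebraMap ℂ (RatFunc ℂ) (m * B a b) * (kap - 1) else 0) := by
  have hk : (kap * kap) * (kap⁻¹ - kap⁻¹ ^ 2) = kap - 1 := by
    field_simp [kap_ne_zero]
  have hk' : kap * kap * kap⁻¹ = kap := by
    field_simp [kap_ne_zero]
  rw [smul_mul_smul_comm, smul_mul_smul_comm, hT, smul_add, smul_add, smul_smul, hk',
    Algebra.smul_def (kap * kap) (algebraMap _ C _), ← map_mul, mul_ite, mul_zero, mul_left_comm,
    hk]

variable [IsScalarTower ℂ (RatFunc ℂ) C]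

/-- The homomorphism given by `κ T` on the modes `a_n^{(κ-1)}` and by the inclusion of the second
tensor factor on the modes `a_n^{(1)}`. -/
def tensorHom (T : ℤ → g →ₗ[ℂ] C) (hT : IsScaledModes B T) :
    Generic B →ₐ[RatFunc ℂ] C ⊗[ℂ] LevelOne B :=
  genericHom
    (fun n => Algebra.TensorProduct.includeLeft.toLinearMap ∘ₗ
      (LinearMap.lsmul (RatFunc ℂ) C kap).restrictScalars ℂ ∘ₗ T n)
    (fun n => Algebra.TensorProduct.includeRight.toLinearMap ∘ₗ modeLin ℂ B _ () n)
    (fun a b m n => by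
      have h := congrArg (Algebra.TensorProduct.includeLeft (R := ℂ) (S := RatFunc ℂ)
        (B := LevelOne B)) (hT.kap_smul_mul a b m n)
      rw [map_mul, map_add, map_add, map_mul, AlgHom.commutes] at h
      exact h)
    (fun a b m n => by
      have h := congrArg (Algebra.TensorProduct.includeRight (R := ℂ) (A := C))
        (mode_mul ℂ B (fun _ => 1) () a b m n)
      rw [map_mul, map_add, map_add, map_mul, AlgHom.commutes, mul_one] at h
      exact h)
    (fun a b m n => by
      change (kap • T m a) ⊗ₜ[ℂ] 1 * 1 ⊗ₜ[ℂ] modeOne B b n =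
        1 ⊗ₜ[ℂ] modeOne B b n * (kap • T m a) ⊗ₜ[ℂ] 1
      rw [Algebra.TensorProduct.tmul_mul_tmul, Algebra.TensorProduct.tmul_mul_tmul, mul_one,
        one_mul, mul_one, one_mul])

lemma tensorHom_modeX (T : ℤ → g →ₗ[ℂ] C) (hT : IsScaledModes B T) (a : g) (n : ℤ) :
    tensorHom T hT (modeX B a n) = (kap • T n a) ⊗ₜ 1 := by
  rw [tensorHom]
  exact genericHom_modeX _ _ _ _ _ a n

lemma tensorHom_modeY (T : ℤ → g →ₗ[ℂ] C) (hT : IsScaledModes B T) (a : g) (n : ℤ) :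
    tensorHom T hT (modeY B a n) = 1 ⊗ₜ modeOne B a n := by
  rw [tensorHom]
  exact genericHom_modeY _ _ _ _ _ a n

end TensorRepresentation

section GenericRepresentation

open MvPolynomial LieAlgebra

variable {g : Type*} [LieRing g] [LieAlgebra ℂ g] (B : LinearMap.BilinForm ℂ g)
  {ι : Type*} [LinearOrder ι] (v : Module.Basis ι ℂ g)

/-- The central term `(κ⁻¹ - κ⁻²) m δ_{m, -n} ⟨a, b⟩` of the modes `a_n / κ` of level `κ - 1`. -/
def scaledCocycle : loopAlgebra ℂ ℤ g →ₗ[ℂ] loopAlgebra ℂ ℤ g →ₗ[ℂ] regularAtInfinity :=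
  (loopCocycle B).compr₂ (LinearMap.toSpanSingleton ℂ regularAtInfinity (hbar - hbar ^ 2))

/-- The action of the modes `a_n / κ` of level `κ - 1` on polynomials over the ring of functions
regular at infinity. -/
def latticeOp : loopAlgebra ℂ ℤ g →ₗ[ℂ]
    Module.End regularAtInfinity (MvPolynomial (ℤ ×ₗ ι) regularAtInfinity) :=
  pbwOp (loopBasis v) hbar (scaledCocycle B)

/-- The extension of `latticeOp` to polynomials over the field of rational functions. -/
def genericOp : loopAlgebra ℂ ℤ g →ₗ[ℂ]
    Module.End (RatFunc ℂ) (MvPolynomial (ℤ ×ₗ ι) (RatFunc ℂ)) :=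
  pbwOp (loopBasis v) (regularAtInfinity.val hbar)
    ((scaledCocycle B).compr₂ regularAtInfinity.val.toLinearMap)

lemma mapAlgHom_val_latticeOp (x : loopAlgebra ℂ ℤ g)
    (f : MvPolynomial (ℤ ×ₗ ι) regularAtInfinity) :
    mapAlgHom regularAtInfinity.val (latticeOp B v x f) =
      genericOp B v x (mapAlgHom regularAtInfinity.val f) :=
  map_pbwOp (loopBasis v) hbar (scaledCocycle B) regularAtInfinity.val x f

variable {B}

lemma scaledCocycle_loopElt (hB : B.IsSymm) (a b : g) (m n : ℤ) :
    (scaledCocycle B (loopElt m a) (loopElt n b) : RatFunc ℂ) =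
      if m + n = 0 then algebraMap ℂ (RatFunc ℂ) (m * B a b) * (kap⁻¹ - kap⁻¹ ^ 2) else 0 := by
  rw [scaledCocycle, LinearMap.compr₂_apply, loopCocycle_loopElt hB,
    LinearMap.toSpanSingleton_apply, ite_smul, zero_smul, Algebra.smul_def]
  split_ifs <;> rfl

lemma genericOp_comm (hB : B.IsSymm) (hB' : B.lieInvariant g) (a b : g) (m n : ℤ) :
    genericOp B v (loopElt m a) * genericOp B v (loopElt n b) =
      genericOp B v (loopElt n b) * genericOp B v (loopElt m a) +
      kap⁻¹ • genericOp B v (loopElt (m + n) ⁅a, b⁆) +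
      algebraMap (RatFunc ℂ) _
        (if m + n = 0 then algebraMap ℂ (RatFunc ℂ) (m * B a b) * (kap⁻¹ - kap⁻¹ ^ 2) else 0) := by
  rw [← scaledCocycle_loopElt hB, ← loopElt_lie]
  refine LinearMap.ext fun f => pbwOp_comm (loopBasis v) _ (fun x => ?_) (fun x y z => ?_) _ _ f
  · simp [scaledCocycle, (loopCocycle_isAlt hB).self_eq_zero]
  · simp only [scaledCocycle, LinearMap.compr₂_apply, ← map_add, loopCocycle_lie hB hB', map_zero]

end GenericRepresentation

section TensorAction

variable {g : Type*} [LieRing g] [LieAlgebra ℂ g] {B : LinearMap.BilinForm ℂ g}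
  {P : Type*} [AddCommGroup P] [Module (RatFunc ℂ) P] [Module ℂ P] [IsScalarTower ℂ (RatFunc ℂ) P]
  (T : ℤ → g →ₗ[ℂ] Module.End (RatFunc ℂ) P) (hT : IsScaledModes B T)
  (Q : Type*) [AddCommGroup Q] [Module ℂ Q] [Module (LevelOne B) Q] [IsScalarTower ℂ (LevelOne B) Q]

/-- The action of the product of the affine Lie algebras of levels `κ - 1` and `1` on a tensor
product, through operators `κ T` on the first factor and a module of level one as the second. -/
def tensorRep : Generic B →ₐ[RatFunc ℂ] Module.End (RatFunc ℂ) (P ⊗[ℂ] Q) :=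
  Module.endTensorEndAlgHom.comp <|
    (Algebra.TensorProduct.map (AlgHom.id _ _) (Algebra.lsmul ℂ ℂ Q)).comp (tensorHom T hT)

lemma tensorRep_modeX_tmul (a : g) (n : ℤ) (f : P) (q : Q) :
    tensorRep T hT Q (modeX B a n) (f ⊗ₜ q) = kap • (T n a f ⊗ₜ[ℂ] q) := by
  rw [tensorRep, AlgHom.comp_apply, AlgHom.comp_apply, tensorHom_modeX,
    Algebra.TensorProduct.map_tmul, map_one]
  rfl

lemma tensorRep_modeY_tmul (a : g) (n : ℤ) (f : P) (q : Q) :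
    tensorRep T hT Q (modeY B a n) (f ⊗ₜ q) = f ⊗ₜ[ℂ] (modeOne B a n • q) := by
  rw [tensorRep, AlgHom.comp_apply, AlgHom.comp_apply, tensorHom_modeY,
    Algebra.TensorProduct.map_tmul, map_one]
  rfl

end TensorAction

section FibreAction

open MvPolynomial LieAlgebra

variable {g : Type*} [LieRing g] [LieAlgebra ℂ g] (B : LinearMap.BilinForm ℂ g)
  {ι : Type*} (v : Module.Basis ι ℂ g) (A : Connection g)
  (Q : Type*) [AddCommGroup Q] [Module ℂ Q]

/-- The coordinates of a connection in the basis `v`. -/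
def connCoord (p : ℤ ×ₗ ι) : ℂ := B (A.1 (ofLex p).1) (v (ofLex p).2)

/-- Evaluation of polynomials at `κ = ∞` and at the connection `d + A`. -/
def fibreEval : MvPolynomial (ℤ ×ₗ ι) regularAtInfinity →ₐ[ℂ] ℂ :=
  (aeval (connCoord B v A)).comp (mapAlgHom valueAtInfinity)

lemma fibreEval_C (f : regularAtInfinity) : fibreEval B v A (C f) = valueAtInfinity f := by
  rw [fibreEval, AlgHom.comp_apply, mapAlgHom_apply, map_C, aeval_C]
  rfl

lemma fibreEval_X (p : ℤ ×ₗ ι) : fibreEval B v A (X p) = connCoord B v A p := by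
  rw [fibreEval, AlgHom.comp_apply, mapAlgHom_apply, map_X, aeval_X]

/-- Evaluation of polynomials with coefficients in `Q` at `κ = ∞` and at the connection `d + A`. -/
def fibreEvalQ : MvPolynomial (ℤ ×ₗ ι) regularAtInfinity ⊗[ℂ] Q →ₗ[ℂ] Q :=
  (TensorProduct.lid ℂ Q).toLinearMap ∘ₗ LinearMap.rTensor Q (fibreEval B v A).toLinearMap

lemma fibreEvalQ_tmul (f : MvPolynomial (ℤ ×ₗ ι) regularAtInfinity) (q : Q) :
    fibreEvalQ B v A Q (f ⊗ₜ q) = fibreEval B v A f • q :=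
  rfl

lemma fibreEvalQ_C_mul_tmul (c : regularAtInfinity)
    (f : MvPolynomial (ℤ ×ₗ ι) regularAtInfinity) (q : Q) :
    fibreEvalQ B v A Q ((C c * f) ⊗ₜ q) = valueAtInfinity c • fibreEvalQ B v A Q (f ⊗ₜ q) := by
  rw [fibreEvalQ_tmul, fibreEvalQ_tmul, map_mul, fibreEval_C, mul_smul]

lemma fibreEvalQ_one_tmul (q : Q) : fibreEvalQ B v A Q (1 ⊗ₜ q) = q := by
  rw [fibreEvalQ_tmul, map_one, one_smul]

lemma fibreEvalQ_surjective : Function.Surjective (fibreEvalQ B v A Q) :=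
  fun q => ⟨1 ⊗ₜ q, fibreEvalQ_one_tmul B v A Q q⟩

/-- The inclusion of the polynomials over the functions regular at infinity into those over all
rational functions, with coefficients in `Q`. -/
def latticeIncl (ι : Type*) : MvPolynomial (ℤ ×ₗ ι) regularAtInfinity ⊗[ℂ] Q →ₗ[ℂ]
    MvPolynomial (ℤ ×ₗ ι) (RatFunc ℂ) ⊗[ℂ] Q :=
  LinearMap.rTensor Q (mapAlgHom regularAtInfinity.val).toLinearMap

lemma latticeIncl_tmul (f : MvPolynomial (ℤ ×ₗ ι) regularAtInfinity) (q : Q) :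
    latticeIncl Q ι (f ⊗ₜ q) = mapAlgHom regularAtInfinity.val f ⊗ₜ q :=
  rfl

lemma latticeIncl_C_mul_tmul (c : regularAtInfinity)
    (f : MvPolynomial (ℤ ×ₗ ι) regularAtInfinity) (q : Q) :
    latticeIncl Q ι ((C c * f) ⊗ₜ q) = (c : RatFunc ℂ) • latticeIncl Q ι (f ⊗ₜ q) := by
  rw [latticeIncl_tmul, latticeIncl_tmul, TensorProduct.smul_tmul', smul_eq_C_mul, map_mul,
    mapAlgHom_apply, map_C]
  rfl

lemma latticeIncl_injective : Function.Injective (latticeIncl Q ι) :=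
  Module.Flat.rTensor_preserves_injective_linearMap _
    (MvPolynomial.map_injective _ Subtype.val_injective)

variable [LinearOrder ι]

lemma mapAlgHom_valueAtInfinity_latticeOp (p : ℤ ×ₗ ι)
    (f : MvPolynomial (ℤ ×ₗ ι) regularAtInfinity) :
    mapAlgHom valueAtInfinity (latticeOp B v (loopBasis v p) f) =
      X p * mapAlgHom valueAtInfinity f := by
  have hτ : (scaledCocycle B).compr₂ valueAtInfinity.toLinearMap = 0 := by
    ext x y
    simp [scaledCocycle, valueAtInfinity_hbar]
  have hmap := map_pbwOp (loopBasis v) hbar (scaledCocycle B) valueAtInfinity (loopBasis v p) f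
  rw [hτ, valueAtInfinity_hbar, pbwOp_zero_zero] at hmap
  exact hmap

lemma fibreEval_latticeOp (a : g) (n : ℤ) (f : MvPolynomial (ℤ ×ₗ ι) regularAtInfinity) :
    fibreEval B v A (latticeOp B v (loopElt n a) f) = B (A.1 n) a * fibreEval B v A f := by
  have hlin : (fibreEval B v A).toLinearMap ∘ₗ (LinearMap.applyₗ f).restrictScalars ℂ ∘ₗ
      latticeOp B v ∘ₗ loopElt n = fibreEval B v A f • B (A.1 n) := v.ext fun i => by
    change fibreEval B v A (latticeOp B v (loopElt n (v i)) f) = fibreEval B v A f * _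
    rw [← loopBasis_apply, fibreEval, AlgHom.comp_apply, mapAlgHom_valueAtInfinity_latticeOp,
      map_mul, aeval_X, mul_comm]
    rfl
  exact (LinearMap.congr_fun hlin a).trans (mul_comm _ _)

variable [Module (LevelOne B) Q] [IsScalarTower ℂ (LevelOne B) Q]
variable {B} (hB : B.IsSymm) (hB' : B.lieInvariant g)

/-- The action of the product of the affine Lie algebras of levels `κ - 1` and `1` on polynomials
in the modes of level `κ - 1` with coefficients in a module `Q` of level one. -/
def genericRep : Generic B →ₐ[RatFunc ℂ]
    Module.End (RatFunc ℂ) (MvPolynomial (ℤ ×ₗ ι) (RatFunc ℂ) ⊗[ℂ] Q) :=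
  tensorRep (fun n => genericOp B v ∘ₗ loopElt n) (genericOp_comm v hB hB') Q

lemma genericRep_modeX_tmul (a : g) (n : ℤ) (f : MvPolynomial (ℤ ×ₗ ι) (RatFunc ℂ)) (q : Q) :
    genericRep v Q hB hB' (modeX B a n) (f ⊗ₜ q) =
      kap • (genericOp B v (loopElt n a) f ⊗ₜ[ℂ] q) :=
  tensorRep_modeX_tmul _ _ Q a n f q

lemma genericRep_modeY_tmul (a : g) (n : ℤ) (f : MvPolynomial (ℤ ×ₗ ι) (RatFunc ℂ)) (q : Q) :
    genericRep v Q hB hB' (modeY B a n) (f ⊗ₜ q) = f ⊗ₜ[ℂ] (modeOne B a n • q) :=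
  tensorRep_modeY_tmul _ _ Q a n f q

/-- The pairs of an element of the generic algebra that preserves the polynomials over the functions
regular at infinity, and the operator that it induces on the fibre at `d + A`. -/
def fibreGraph : Subalgebra ℂ (Generic B × Module.End ℂ Q) :=
  inducedGraph (Y := MvPolynomial (ℤ ×ₗ ι) regularAtInfinity ⊗[ℂ] Q)
    ((genericRep v Q hB hB').restrictScalars ℂ) (latticeIncl Q ι) (fibreEvalQ B v A Q)

lemma smul_modeX_mem_fibreGraph (a : g) (n : ℤ) :
    (kap⁻¹ • modeX B a n, algebraMap ℂ _ (B (A.1 n) a)) ∈ fibreGraph v A Q hB hB' := by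
  refine mem_inducedGraph_of_comp_eq
    (LinearMap.rTensor Q ((latticeOp B v (loopElt n a)).restrictScalars ℂ))
    (TensorProduct.ext' fun f q => ?_) (TensorProduct.ext' fun f q => ?_)
  · change genericRep v Q hB hB' (kap⁻¹ • modeX B a n) (latticeIncl Q ι (f ⊗ₜ q)) =
      latticeIncl Q ι (latticeOp B v (loopElt n a) f ⊗ₜ q)
    rw [latticeIncl_tmul, latticeIncl_tmul, map_smul, LinearMap.smul_apply, genericRep_modeX_tmul,
      inv_smul_smul₀ kap_ne_zero, mapAlgHom_val_latticeOp]
  · change fibreEval B v A (latticeOp B v (loopElt n a) f) • q = B (A.1 n) a • fibreEval B v A f • q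
    rw [fibreEval_latticeOp, mul_smul]

lemma modeY_mem_fibreGraph (a : g) (n : ℤ) :
    (modeY B a n, Algebra.lsmul ℂ ℂ Q (modeOne B a n)) ∈ fibreGraph v A Q hB hB' := by
  refine mem_inducedGraph_of_comp_eq (LinearMap.lTensor _ (Algebra.lsmul ℂ ℂ Q (modeOne B a n)))
    (TensorProduct.ext' fun f q => ?_) (TensorProduct.ext' fun f q => ?_)
  · exact genericRep_modeY_tmul v Q hB hB' a n _ q
  · exact (map_smul (Algebra.lsmul ℂ ℂ Q (modeOne B a n)) (fibreEval B v A f) q).symm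

lemma genericRep_algebraMap (c : RatFunc ℂ) (z : MvPolynomial (ℤ ×ₗ ι) (RatFunc ℂ) ⊗[ℂ] Q) :
    genericRep v Q hB hB' (algebraMap _ _ c) z = c • z := by
  rw [AlgHom.commutes, Module.algebraMap_end_apply]

lemma algebraMap_mem_fibreGraph (c : regularAtInfinity) :
    (algebraMap (RatFunc ℂ) (Generic B) c, algebraMap ℂ _ (valueAtInfinity c)) ∈
      fibreGraph v A Q hB hB' := by
  refine mem_inducedGraph_of_comp_eq (LinearMap.rTensor Q (LinearMap.mulLeft ℂ (C c)))
    (TensorProduct.ext' fun f q => ?_) (TensorProduct.ext' fun f q => ?_)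
  · exact (genericRep_algebraMap v Q hB hB' c _).trans (latticeIncl_C_mul_tmul Q c f q).symm
  · exact fibreEvalQ_C_mul_tmul B v A Q c f q

lemma intForm_le_range_fibreGraph :
    intForm B ≤ ((AlgHom.fst ℂ _ _).comp (fibreGraph v A Q hB hB').val).range := by
  refine Algebra.adjoin_le ?_
  rintro _ ((⟨f, hf, rfl⟩ | ⟨a, n, rfl⟩) | ⟨a, n, rfl⟩)
  · exact ⟨⟨_, algebraMap_mem_fibreGraph v A Q hB hB' ⟨f, hf⟩⟩, rfl⟩
  · exact ⟨⟨_, smul_modeX_mem_fibreGraph v A Q hB hB' a n⟩, rfl⟩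
  · exact ⟨⟨_, modeY_mem_fibreGraph v A Q hB hB' a n⟩, rfl⟩

/-- The action of the integral form on a module `Q` of level one, as the fibre at `d + A` of
polynomials with coefficients in `Q`. -/
def fibreHom : intForm B →ₐ[ℂ] Module.End ℂ Q :=
  inducedHom (latticeIncl_injective Q) (fibreEvalQ_surjective B v A Q)
    (intForm_le_range_fibreGraph v A Q hB hB')

lemma fibreHom_mem_fibreGraph (u : intForm B) :
    ((u : Generic B), fibreHom v A Q hB hB' u) ∈ fibreGraph v A Q hB hB' :=
  inducedHom_mem_inducedGraph _ _ _ u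

lemma fibreHom_eq {u : intForm B} {χ : Module.End ℂ Q}
    (h : ((u : Generic B), χ) ∈ fibreGraph v A Q hB hB') : fibreHom v A Q hB hB' u = χ :=
  inducedHom_eq _ _ _ h

lemma fibreHom_kapInv : fibreHom v A Q hB hB' (kapInv B) = 0 := by
  have h := fibreHom_eq v A Q hB hB' (u := kapInv B) (algebraMap_mem_fibreGraph v A Q hB hB' hbar)
  rwa [valueAtInfinity_hbar, map_zero] at h

lemma fibreHom_inclOne_modeOne (a : g) (n : ℤ) :
    fibreHom v A Q hB hB' (inclOne B (modeOne B a n)) = Algebra.lsmul ℂ ℂ Q (modeOne B a n) := by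
  rw [inclOne_modeOne]
  exact fibreHom_eq v A Q hB hB' (modeY_mem_fibreGraph v A Q hB hB' a n)

lemma fibreHom_inclOne (u : LevelOne B) (q : Q) :
    fibreHom v A Q hB hB' (inclOne B u) q = u • q :=
  LinearMap.congr_fun (ModeAlgebra.mem_of_forall_mode_mem
    (AlgHom.equalizer ((fibreHom v A Q hB hB').comp (inclOne B)) (Algebra.lsmul ℂ ℂ Q))
    (fun _ => fibreHom_inclOne_modeOne v A Q hB hB') u) q

lemma scaledDiag_eq (a : g) (n : ℤ) :
    (scaledDiag B a n : Generic B) =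
      kap⁻¹ • modeX B a n + algebraMap (RatFunc ℂ) _ kap⁻¹ * modeY B a n := by
  rw [← Algebra.smul_def, ← smul_add]
  rfl

lemma fibreHom_scaledDiag (a : g) (n : ℤ) :
    fibreHom v A Q hB hB' (scaledDiag B a n) = algebraMap ℂ _ (B (A.1 n) a) := by
  refine fibreHom_eq v A Q hB hB' ?_
  have h := add_mem (smul_modeX_mem_fibreGraph v A Q hB hB' a n)
    (mul_mem (algebraMap_mem_fibreGraph v A Q hB hB' hbar) (modeY_mem_fibreGraph v A Q hB hB' a n))
  rw [valueAtInfinity_hbar, map_zero, Prod.mk_mul_mk, zero_mul, Prod.mk_add_mk, add_zero] at h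
  rwa [scaledDiag_eq]

end FibreAction

section HighModes

open MvPolynomial LieAlgebra TensorProduct

section KillVars

variable (S : Type*) [CommRing S] {I : Type*} (H : Set I)

open Classical in
/-- Setting the variables with indices in `H` to zero. -/
def killVars : MvPolynomial I S →ₐ[S] MvPolynomial I S :=
  aeval fun i => if i ∈ H then 0 else X i

variable {S H}

lemma killVars_X_of_mem {i : I} (hi : i ∈ H) : killVars S H (X i) = 0 := by
  rw [killVars, aeval_X, if_pos hi]

lemma killVars_X_of_notMem {i : I} (hi : i ∉ H) : killVars S H (X i) = X i := by
  rw [killVars, aeval_X, if_neg hi]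

lemma killVars_eq_zero_of_mem {f : MvPolynomial I S} (hf : f ∈ Ideal.span (X '' H)) :
    killVars S H f = 0 := by
  have hle : Ideal.span (X '' H) ≤ RingHom.ker (killVars S H) := by
    rw [Ideal.span_le]
    rintro _ ⟨i, hi, rfl⟩
    exact killVars_X_of_mem hi
  exact hle hf

lemma sub_killVars_mem (f : MvPolynomial I S) : f - killVars S H f ∈ Ideal.span (X '' H) := by
  have hext : (Ideal.Quotient.mkₐ S (Ideal.span (X '' H))).comp (killVars S H) =
      Ideal.Quotient.mkₐ S (Ideal.span (X '' H)) := by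
    ext i
    by_cases hi : i ∈ H
    · rw [AlgHom.comp_apply, killVars_X_of_mem hi, map_zero]
      exact (Ideal.Quotient.eq_zero_iff_mem.mpr (X_mem_span_X_image hi)).symm
    · rw [AlgHom.comp_apply, killVars_X_of_notMem hi]
  exact Ideal.Quotient.eq.mp (AlgHom.congr_fun hext f).symm

lemma killVars_apply_eq {T : Module.End S (MvPolynomial I S)}
    (hT : ∀ f ∈ Ideal.span (X '' H), T f ∈ Ideal.span (X '' H)) (f : MvPolynomial I S) :
    killVars S H (T f) = killVars S H (T (killVars S H f)) := by
  rw [← sub_eq_zero, ← map_sub, ← map_sub]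
  exact killVars_eq_zero_of_mem (hT _ (sub_killVars_mem f))

lemma map_killVars {S' : Type*} [CommRing S'] (φ : S →+* S') (f : MvPolynomial I S) :
    map φ (killVars S H f) = killVars S' H (map φ f) := by
  induction f using MvPolynomial.induction_on with
  | C c => rw [map_C, ← algebraMap_eq, ← algebraMap_eq, AlgHom.commutes, AlgHom.commutes,
      algebraMap_eq, algebraMap_eq, map_C]
  | add f f' hf hf' => rw [map_add, map_add, hf, hf', map_add, map_add]
  | mul_X f i hf =>
    rw [map_mul, map_mul, hf, map_mul, map_mul, map_X]
    by_cases hi : i ∈ H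
    · rw [killVars_X_of_mem hi, killVars_X_of_mem hi, map_zero]
    · rw [killVars_X_of_notMem hi, killVars_X_of_notMem hi, map_X]

variable (S H) [Algebra ℂ S] (Q : Type*) [AddCommGroup Q] [Module ℂ Q]

/-- Setting the variables with indices in `H` to zero in polynomials with coefficients in `Q`. -/
def killVarsQ : MvPolynomial I S ⊗[ℂ] Q →ₗ[S] MvPolynomial I S ⊗[ℂ] Q :=
  AlgebraTensorModule.map (killVars S H).toLinearMap LinearMap.id

lemma killVarsQ_tmul (f : MvPolynomial I S) (q : Q) :
    killVarsQ S H Q (f ⊗ₜ q) = killVars S H f ⊗ₜ q :=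
  rfl

end KillVars

variable {g : Type*} [LieRing g] [LieAlgebra ℂ g] {B : LinearMap.BilinForm ℂ g}
  {ι : Type*} (v : Module.Basis ι ℂ g) (A : Connection g) (Q : Type*) [AddCommGroup Q] [Module ℂ Q]

lemma killVarsQ_latticeIncl (H : Set (ℤ ×ₗ ι))
    (y : MvPolynomial (ℤ ×ₗ ι) regularAtInfinity ⊗[ℂ] Q) :
    killVarsQ (RatFunc ℂ) H Q (latticeIncl Q ι y) =
      latticeIncl Q ι (killVarsQ regularAtInfinity H Q y) := by
  induction y with
  | zero => rw [map_zero, map_zero, map_zero, map_zero]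
  | add y y' hy hy' => rw [map_add, map_add, map_add, map_add, hy, hy']
  | tmul f q =>
    rw [latticeIncl_tmul, killVarsQ_tmul, killVarsQ_tmul, latticeIncl_tmul]
    exact congrArg (· ⊗ₜ q) (map_killVars _ f).symm

variable {A} in
lemma fibreEval_killVars {H : Set (ℤ ×ₗ ι)} (hH : ∀ p ∈ H, connCoord B v A p = 0)
    (f : MvPolynomial (ℤ ×ₗ ι) regularAtInfinity) :
    fibreEval B v A (killVars regularAtInfinity H f) = fibreEval B v A f := by
  have hle : Ideal.span (X '' H) ≤ RingHom.ker (fibreEval B v A) := by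
    rw [Ideal.span_le]
    rintro _ ⟨p, hp, rfl⟩
    exact (fibreEval_X B v A p).trans (hH p hp)
  exact ((RingHom.sub_mem_ker_iff _).mp (hle (sub_killVars_mem f))).symm

variable {A} in
lemma fibreEvalQ_killVarsQ {H : Set (ℤ ×ₗ ι)} (hH : ∀ p ∈ H, connCoord B v A p = 0)
    (y : MvPolynomial (ℤ ×ₗ ι) regularAtInfinity ⊗[ℂ] Q) :
    fibreEvalQ B v A Q (killVarsQ regularAtInfinity H Q y) = fibreEvalQ B v A Q y := by
  induction y with
  | zero => rw [map_zero]
  | add y y' hy hy' => rw [map_add, map_add, map_add, hy, hy']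
  | tmul f q => rw [killVarsQ_tmul, fibreEvalQ_tmul, fibreEvalQ_tmul, fibreEval_killVars v hH]

/-- The indices of the modes of degree at least `N`. -/
def highIndices (ι : Type*) (N : ℤ) : Set (ℤ ×ₗ ι) := {p | N ≤ (ofLex p).1}

lemma isUpperSet_highIndices [LinearOrder ι] (N : ℤ) : IsUpperSet (highIndices ι N) :=
  fun _ _ hpq hp => le_trans hp (Prod.Lex.monotone_fst _ _ hpq)

lemma loopElt_mem_span_highIndices {N n : ℤ} (hn : N ≤ n) (a : g) :
    loopElt n a ∈ Submodule.span ℂ (loopBasis v '' highIndices ι N) := by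
  have hle : Submodule.span ℂ (Set.range v) ≤
      (Submodule.span ℂ (loopBasis v '' highIndices ι N)).comap (loopElt n) := by
    refine Submodule.span_le.mpr (Set.range_subset_iff.mpr fun i => ?_)
    rw [SetLike.mem_coe, Submodule.mem_comap, ← loopBasis_apply]
    exact Submodule.subset_span (Set.mem_image_of_mem _ hn)
  exact hle (v.mem_span a)

variable [LinearOrder ι] (hB : B.IsSymm) (hB' : B.lieInvariant g)

include hB in
lemma genericOp_mem_span_X_image {N : ℤ} (hN : 0 ≤ N) (x : loopAlgebra ℂ ℤ g)
    {f : MvPolynomial (ℤ ×ₗ ι) (RatFunc ℂ)} (hf : f ∈ Ideal.span (X '' highIndices ι N)) :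
    genericOp B v x f ∈ Ideal.span (X '' highIndices ι N) := by
  have hbasis (p : ℤ ×ₗ ι) : loopBasis v p = loopElt (ofLex p).1 (v (ofLex p).2) :=
    loopBasis_apply v _ _
  refine pbwOp_mem_span_X_image (isUpperSet_highIndices N) ?_ ?_ x hf
  · intro p (hp : N ≤ (ofLex p).1) q (hq : N ≤ (ofLex q).1)
    rw [hbasis, hbasis, loopElt_lie]
    exact loopElt_mem_span_highIndices v (by lia) _
  · intro p (hp : N ≤ (ofLex p).1) q (hq : N ≤ (ofLex q).1)
    rw [hbasis, hbasis]
    refine (scaledCocycle_loopElt hB _ _ _ _).trans ?_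
    split_ifs with hpq
    · rw [show (ofLex p).1 = 0 by lia]
      simp
    · rfl

variable [Module (LevelOne B) Q] [IsScalarTower ℂ (LevelOne B) Q]

lemma exists_killVarsQ_genericRep_eq {N : ℤ} (hN : 0 ≤ N) (u : Generic B) :
    ∃ χ : Module.End (RatFunc ℂ) (MvPolynomial (ℤ ×ₗ ι) (RatFunc ℂ) ⊗[ℂ] Q),
      ∀ z, killVarsQ (RatFunc ℂ) (highIndices ι N) Q (genericRep v Q hB hB' u z) =
        χ (killVarsQ (RatFunc ℂ) (highIndices ι N) Q z) := by
  let killQ := killVarsQ (RatFunc ℂ) (highIndices ι N) Q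
  have hmap : u ∈ (inducedGraph (genericRep v Q hB hB') LinearMap.id killQ).map
      (AlgHom.fst _ _ _) := by
    refine ModeAlgebra.mem_of_forall_mode_mem _ (fun s a n => ?_) u
    fin_cases s
    · refine ⟨(modeX B a n, killQ ∘ₗ genericRep v Q hB hB' (modeX B a n)),
        fun z => ⟨_, rfl, ?_⟩, rfl⟩
      change killQ (genericRep v Q hB hB' (modeX B a n) z) =
        killQ (genericRep v Q hB hB' (modeX B a n) (killQ z))
      induction z with
      | zero => simp only [map_zero]
      | add z z' hz hz' => simp only [map_add, hz, hz']
      | tmul f q =>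
        rw [killVarsQ_tmul, genericRep_modeX_tmul, genericRep_modeX_tmul, map_smul, map_smul,
          killVarsQ_tmul, killVarsQ_tmul,
          killVars_apply_eq fun _ => genericOp_mem_span_X_image v hB hN _]
    · refine ⟨(modeY B a n, genericRep v Q hB hB' (modeY B a n)), fun z => ⟨_, rfl, ?_⟩, rfl⟩
      change killQ (genericRep v Q hB hB' (modeY B a n) z) =
        genericRep v Q hB hB' (modeY B a n) (killQ z)
      induction z with
      | zero => simp only [map_zero]
      | add z z' hz hz' => simp only [map_add, hz, hz']
      | tmul f q =>
        rw [killVarsQ_tmul, genericRep_modeY_tmul, genericRep_modeY_tmul, killVarsQ_tmul]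
  obtain ⟨⟨_, χ⟩, hχ, rfl⟩ := hmap
  refine ⟨χ, fun z => ?_⟩
  obtain ⟨_, rfl, hz⟩ := hχ z
  exact hz

lemma killVarsQ_genericRep_of_mem_highModes {N : ℕ} {q : Q}
    (hq : ∀ (a : g) (n : ℤ), (N : ℤ) ≤ n → modeOne B a n • q = 0) {u : Generic B}
    (hu : u ∈ highModes (RatFunc ℂ) B (![kap - 1, 1] : Fin 2 → RatFunc ℂ) N) :
    killVarsQ (RatFunc ℂ) (highIndices ι N) Q (genericRep v Q hB hB' u (1 ⊗ₜ q)) = 0 := by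
  induction hu using Submodule.span_induction with
  | mem u hu =>
    obtain ⟨s, a, n, hn, rfl⟩ := hu
    fin_cases s
    · change killVarsQ _ _ Q (genericRep v Q hB hB' (modeX B a n) (1 ⊗ₜ q)) = 0
      have hmem : genericOp B v (loopElt n a) 1 ∈ Ideal.span (X '' highIndices ι N) :=
        pbwOp_monomial_zero_mem_span_X_image (loopElt_mem_span_highIndices v hn a)
      rw [genericRep_modeX_tmul, map_smul, killVarsQ_tmul, killVars_eq_zero_of_mem hmem,
        zero_tmul, smul_zero]
    · change killVarsQ _ _ Q (genericRep v Q hB hB' (modeY B a n) (1 ⊗ₜ q)) = 0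
      rw [genericRep_modeY_tmul, hq a n hn, tmul_zero, map_zero]
  | zero => rw [map_zero, LinearMap.zero_apply, map_zero]
  | add x y _ _ hx hy => rw [map_add, LinearMap.add_apply, map_add, hx, hy, add_zero]
  | smul c x _ hx =>
    obtain ⟨χ, hχ⟩ := exists_killVarsQ_genericRep_eq v Q hB hB' (Int.natCast_nonneg N) c
    rw [smul_eq_mul, map_mul, Module.End.mul_apply, hχ, hx, map_zero]

lemma fibreHom_of_mem_highModes {N : ℕ} (hA : ∀ n : ℤ, N ≤ n → A.1 n = 0) {q : Q}
    (hq : ∀ (a : g) (n : ℤ), (N : ℤ) ≤ n → modeOne B a n • q = 0) {u : intForm B}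
    (hu : (u : Generic B) ∈ highModes (RatFunc ℂ) B (![kap - 1, 1] : Fin 2 → RatFunc ℂ) N) :
    fibreHom v A Q hB hB' u q = 0 := by
  obtain ⟨y, hy, hy'⟩ := fibreHom_mem_fibreGraph v A Q hB hB' u (1 ⊗ₜ q)
  have hkill : killVarsQ regularAtInfinity (highIndices ι N) Q y = 0 := by
    refine latticeIncl_injective Q ?_
    rw [map_zero, ← killVarsQ_latticeIncl, ← hy, latticeIncl_tmul, map_one]
    exact killVarsQ_genericRep_of_mem_highModes v Q hB hB' hq hu
  have hcoord : ∀ p ∈ highIndices ι N, connCoord B v A p = 0 := fun p hp => by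
    rw [connCoord, hA _ hp, map_zero, LinearMap.zero_apply]
  rw [fibreEvalQ_one_tmul] at hy'
  exact hy'.symm.trans
    ((fibreEvalQ_killVarsQ v Q hcoord y).symm.trans (by rw [hkill, map_zero]))

end HighModes

section IntegralForm

variable {g : Type*} [LieRing g] [LieAlgebra ℂ g] (B : LinearMap.BilinForm ℂ g)

lemma modeX_mul_modeX (a b : g) (m n : ℤ) :
    modeX B a m * modeX B b n = modeX B b n * modeX B a m + modeX B ⁅a, b⁆ (m + n) +
      algebraMap (RatFunc ℂ) _
        (if m + n = 0 then algebraMap ℂ (RatFunc ℂ) (m * B a b) * (kap - 1) else 0) :=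
  mode_mul (RatFunc ℂ) B (![kap - 1, 1] : Fin 2 → RatFunc ℂ) 0 a b m n

lemma modeX_mul_modeY (a b : g) (m n : ℤ) :
    modeX B a m * modeY B b n = modeY B b n * modeX B a m :=
  mode_mul_of_ne (by decide) a b m n

lemma modeY_mul_modeY (a b : g) (m n : ℤ) :
    modeY B a m * modeY B b n = modeY B b n * modeY B a m + modeY B ⁅a, b⁆ (m + n) +
      algebraMap (RatFunc ℂ) _
        (if m + n = 0 then algebraMap ℂ (RatFunc ℂ) (m * B a b) else 0) := by
  have h := mode_mul (RatFunc ℂ) B (![kap - 1, 1] : Fin 2 → RatFunc ℂ) 1 a b m n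
  simp only [Matrix.cons_val_one, Matrix.cons_val_fin_one, mul_one] at h
  exact h

lemma modeDiag_mul_modeY (a b : g) (m n : ℤ) :
    modeDiag B a m * modeY B b n = modeY B b n * modeDiag B a m + modeY B ⁅a, b⁆ (m + n) +
      algebraMap (RatFunc ℂ) _
        (if m + n = 0 then algebraMap ℂ (RatFunc ℂ) (m * B a b) else 0) := by
  rw [modeDiag, add_mul, modeX_mul_modeY, modeY_mul_modeY, mul_add]
  abel

lemma modeDiag_mul_modeDiag (a b : g) (m n : ℤ) :
    modeDiag B a m * modeDiag B b n = modeDiag B b n * modeDiag B a m +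
      modeDiag B ⁅a, b⁆ (m + n) + algebraMap (RatFunc ℂ) _
        (if m + n = 0 then algebraMap ℂ (RatFunc ℂ) (m * B a b) * kap else 0) := by
  have hlevel : (if m + n = 0 then algebraMap ℂ (RatFunc ℂ) (m * B a b) * kap else 0) =
      (if m + n = 0 then algebraMap ℂ (RatFunc ℂ) (m * B a b) * (kap - 1) else 0) +
      (if m + n = 0 then algebraMap ℂ (RatFunc ℂ) (m * B a b) else 0) := by
    split_ifs <;> ring
  rw [hlevel, map_add]
  simp only [modeDiag, add_mul, mul_add, modeX_mul_modeX B a b, modeY_mul_modeY B a b,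
    modeX_mul_modeY]
  abel

/-- The rational functions that are regular at infinity, as elements of the integral form. -/
def regularHom : regularAtInfinity →ₐ[ℂ] intForm B :=
  AlgHom.codRestrict (((Algebra.ofId (RatFunc ℂ) (Generic B)).restrictScalars ℂ).comp
    regularAtInfinity.val) _ fun f => Algebra.subset_adjoin (Or.inl (Or.inl ⟨f, f.2, rfl⟩))

lemma exists_regularHom_eq (f : regularAtInfinity) : ∃ u : intForm B,
    regularHom B f = algebraMap ℂ _ (valueAtInfinity f) + kapInv B * u := by
  obtain ⟨f', hf'⟩ := exists_eq_valueAtInfinity_add_hbar_mul f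
  refine ⟨regularHom B f', ?_⟩
  conv_lhs => rw [hf', map_add, map_mul, AlgHom.commutes]
  rfl

lemma coe_inclOne_modeOne (a : g) (n : ℤ) :
    (inclOne B (modeOne B a n) : Generic B) = modeY B a n := by
  rw [inclOne_modeOne]

lemma coe_algebraMap_intForm (c : ℂ) : ((algebraMap ℂ (intForm B) c : intForm B) : Generic B) =
    algebraMap (RatFunc ℂ) _ (algebraMap ℂ (RatFunc ℂ) c) :=
  IsScalarTower.algebraMap_apply ℂ (RatFunc ℂ) (Generic B) c

lemma smul_modeX_eq (a : g) (n : ℤ) : kap⁻¹ • modeX B a n =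
    ((scaledDiag B a n - kapInv B * inclOne B (modeOne B a n) : intForm B) : Generic B) := by
  change kap⁻¹ • modeX B a n = scaledDiag B a n - algebraMap (RatFunc ℂ) _ kap⁻¹ *
    (inclOne B (modeOne B a n) : Generic B)
  rw [scaledDiag_eq, coe_inclOne_modeOne, add_sub_cancel_right]

variable {B}

lemma mem_of_forall_generator_mem (P : Subalgebra ℂ (intForm B))
    (hreg : ∀ f, regularHom B f ∈ P) (hdiag : ∀ a n, scaledDiag B a n ∈ P)
    (hone : ∀ a n, inclOne B (modeOne B a n) ∈ P) (u : intForm B) : u ∈ P := by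
  have hle : intForm B ≤ P.map (intForm B).val := by
    refine Algebra.adjoin_le ?_
    rintro _ ((⟨f, hf, rfl⟩ | ⟨a, n, rfl⟩) | ⟨a, n, rfl⟩)
    · exact ⟨_, hreg ⟨f, hf⟩, rfl⟩
    · exact ⟨_, P.sub_mem (hdiag a n) (P.mul_mem (hreg hbar) (hone a n)),
        (smul_modeX_eq B a n).symm⟩
    · exact ⟨_, hone a n, coe_inclOne_modeOne B a n⟩
  obtain ⟨x, hx, hxu⟩ := hle u.2
  rwa [← Subtype.ext (a1 := x) (a2 := u) hxu]

variable (B)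

lemma scaledDiag_mul_scaledDiag (a b : g) (m n : ℤ) :
    scaledDiag B a m * scaledDiag B b n = scaledDiag B b n * scaledDiag B a m +
      kapInv B * (scaledDiag B ⁅a, b⁆ (m + n) +
        algebraMap ℂ _ (if m + n = 0 then m * B a b else 0)) := by
  refine Subtype.ext ?_
  change (kap⁻¹ • modeDiag B a m) * (kap⁻¹ • modeDiag B b n) =
    (kap⁻¹ • modeDiag B b n) * (kap⁻¹ • modeDiag B a m) + algebraMap (RatFunc ℂ) _ kap⁻¹ *
      (kap⁻¹ • modeDiag B ⁅a, b⁆ (m + n) + ((algebraMap ℂ (intForm B) _ : intForm B) : Generic B))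
  rw [coe_algebraMap_intForm, ← Algebra.smul_def, smul_mul_smul_comm, modeDiag_mul_modeDiag,
    smul_mul_smul_comm, smul_add, smul_add, smul_add, smul_smul kap⁻¹ kap⁻¹, add_assoc]
  congr 2
  rw [Algebra.smul_def, Algebra.smul_def, ← map_mul, ← map_mul]
  congr 1
  split_ifs
  · field_simp [kap_ne_zero]
  · rw [map_zero, mul_zero, mul_zero]

lemma scaledDiag_mul_inclOne (a b : g) (m n : ℤ) :
    scaledDiag B a m * inclOne B (modeOne B b n) = inclOne B (modeOne B b n) * scaledDiag B a m +
      kapInv B * (inclOne B (modeOne B ⁅a, b⁆ (m + n)) +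
        algebraMap ℂ _ (if m + n = 0 then m * B a b else 0)) := by
  refine Subtype.ext ?_
  change (kap⁻¹ • modeDiag B a m) * (inclOne B (modeOne B b n) : Generic B) =
    (inclOne B (modeOne B b n) : Generic B) * (kap⁻¹ • modeDiag B a m) +
    algebraMap (RatFunc ℂ) _ kap⁻¹ * ((inclOne B (modeOne B ⁅a, b⁆ (m + n)) : Generic B) +
      ((algebraMap ℂ (intForm B) _ : intForm B) : Generic B))
  rw [coe_algebraMap_intForm, coe_inclOne_modeOne, coe_inclOne_modeOne, ← Algebra.smul_def,
    smul_mul_assoc, modeDiag_mul_modeY, mul_smul_comm, smul_add, smul_add, smul_add, add_assoc]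
  congr 4
  split_ifs
  · rfl
  · rw [map_zero]

lemma toLimit_kapInv : toLimit B (kapInv B) = 0 := by
  rw [toLimit, RingQuot.mkAlgHom_rel ℂ (s := fun x y : intForm B => x = kapInv B ∧ y = 0)
    ⟨rfl, rfl⟩, map_zero]

lemma toLimit_scaledDiag_comm (a b : g) (m n : ℤ) :
    Commute (toLimit B (scaledDiag B a m)) (toLimit B (scaledDiag B b n)) := by
  rw [commute_iff_eq, ← map_mul, scaledDiag_mul_scaledDiag, map_add, map_mul, map_mul,
    toLimit_kapInv, zero_mul, add_zero]

lemma toLimit_scaledDiag_comm_inclOne (a : g) (m : ℤ) (u : LevelOne B) :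
    Commute (toLimit B (scaledDiag B a m)) (toLimit B (inclOne B u)) := by
  refine (Subalgebra.mem_centralizer_iff ℂ).mp (ModeAlgebra.mem_of_forall_mode_mem
    ((Subalgebra.centralizer ℂ {toLimit B (scaledDiag B a m)}).comap ((toLimit B).comp (inclOne B)))
    (fun s b n => (Subalgebra.mem_centralizer_iff ℂ).mpr ?_) u) _ rfl
  rintro _ rfl
  change toLimit B (scaledDiag B a m) * toLimit B (inclOne B (modeOne B b n)) = _
  rw [← map_mul, scaledDiag_mul_inclOne, map_add, map_mul, map_mul, toLimit_kapInv, zero_mul,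
    add_zero]
  rfl

end IntegralForm

section Functions

open MvPolynomial

variable {g : Type*} [LieRing g] [LieAlgebra ℂ g] (B : LinearMap.BilinForm ℂ g)
  {ι : Type*} (v : Module.Basis ι ℂ g)

/-- The function `d + A ↦ ⟨A_n, a⟩`, as a linear function of `a`. -/
def coordLin (n : ℤ) : g →ₗ[ℂ] functionRing B where
  toFun a := coord B a n
  map_add' a b := Subtype.ext (funext fun A => map_add (B (A.1 n)) a b)
  map_smul' c a := Subtype.ext (funext fun A => map_smul (B (A.1 n)) c a)

/-- The element `a_n^{(κ)} / κ` of the integral form, as a linear function of `a`. -/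
def scaledDiagLin (n : ℤ) : g →ₗ[ℂ] intForm B :=
  LinearMap.codRestrict (intForm B).toSubmodule
    (kap⁻¹ • (modeLin (RatFunc ℂ) B _ 0 n + modeLin (RatFunc ℂ) B _ 1 n))
    fun a => modeDiag_mem B a n

variable {B} in
lemma mem_of_forall_coord_mem (P : Subalgebra ℂ (functionRing B)) (h : ∀ a n, coord B a n ∈ P)
    (f : functionRing B) : f ∈ P := by
  refine (Algebra.adjoin_adjoin_coe_preimage.ge.trans (Algebra.adjoin_le ?_) :
    (⊤ : Subalgebra ℂ (functionRing B)) ≤ P) Algebra.mem_top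
  rintro f ⟨a, n, hf⟩
  obtain rfl : f = coord B a n := Subtype.ext hf
  exact h a n

/-- Polynomials in the coordinates of a connection, as functions on the space of connections. -/
def polyToFun : MvPolynomial (ℤ × ι) ℂ →ₐ[ℂ] functionRing B :=
  aeval fun p => coord B (v p.2) p.1

lemma polyToFun_X (n : ℤ) (i : ι) : polyToFun B v (X (n, i)) = coord B (v i) n :=
  aeval_X _ _

lemma polyToFun_apply (p : MvPolynomial (ℤ × ι) ℂ) (A : Connection g) :
    (polyToFun B v p).1 A = aeval (fun q => B (A.1 q.1) (v q.2)) p := by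
  have hext : ((Pi.evalAlgHom ℂ (fun _ => ℂ) A).comp (functionRing B).val).comp (polyToFun B v) =
      aeval fun q => B (A.1 q.1) (v q.2) := by
    ext q
    rw [AlgHom.comp_apply, polyToFun_X, aeval_X]
    rfl
  exact AlgHom.congr_fun hext p

lemma polyToFun_surjective : Function.Surjective (polyToFun B v) := by
  refine mem_of_forall_coord_mem (polyToFun B v).range fun a n => ?_
  have hle : Submodule.span ℂ (Set.range v) ≤
      (polyToFun B v).range.toSubmodule.comap (coordLin B n) :=
    Submodule.span_le.mpr (Set.range_subset_iff.mpr fun i => ⟨X (n, i), polyToFun_X B v n i⟩)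
  exact hle (v.mem_span a)

variable [Finite ι] [DecidableEq ι] {B} {v} {w : ι → g}
  (hvw : ∀ i j, B (w i) (v j) = if i = j then 1 else 0)

include hvw

/-- Only finitely many coordinates enter a polynomial, so arbitrary values for these are realized
by a connection. -/
lemma polyToFun_injective : Function.Injective (polyToFun B v) := by
  cases nonempty_fintype ι
  rw [injective_iff_map_eq_zero]
  intro p hp
  refine MvPolynomial.funext fun c => ?_
  obtain ⟨N, hN⟩ := (p.vars.image Prod.fst).exists_le
  let A : Connection g := ⟨fun n => if n ≤ N then ∑ i, c (n, i) • w i else 0,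
    N + 1, fun n hn => if_neg (by lia)⟩
  have hcoord : ∀ q ∈ p.vars, c q = B (A.1 q.1) (v q.2) := fun q hq => by
    rw [show A.1 q.1 = ∑ i, c (q.1, i) • w i from if_pos (hN _ (Finset.mem_image_of_mem _ hq))]
    simp [hvw, LinearMap.sum_apply]
  calc eval c p = aeval (fun q => B (A.1 q.1) (v q.2)) p :=
        eval₂Hom_congr' rfl (fun q hq _ => hcoord q hq) rfl
    _ = eval c 0 := by
      rw [← polyToFun_apply, hp, map_zero]
      rfl

/-- The ring of functions on the space of connections is a polynomial ring. -/
def polyEquivFun : MvPolynomial (ℤ × ι) ℂ ≃ₐ[ℂ] functionRing B :=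
  AlgEquiv.ofBijective (polyToFun B v) ⟨polyToFun_injective hvw, polyToFun_surjective B v⟩

lemma exists_functionRing_hom {C : Type*} [Ring C] [Algebra ℂ C] (T : ℤ → g →ₗ[ℂ] C)
    (hT : ∀ m n a b, Commute (T m a) (T n b)) :
    ∃ F : functionRing B →ₐ[ℂ] C, ∀ a n, F (coord B a n) = T n a := by
  let s : Set C := Set.range fun p : ℤ × g => T p.1 p.2
  have hs : IsMulCommutative (Algebra.adjoin ℂ s) := Algebra.isMulCommutative_adjoin ℂ (by
    rintro _ ⟨p, rfl⟩ _ ⟨q, rfl⟩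
    exact hT _ _ _ _)
  let _ : CommRing (Algebra.adjoin ℂ s) :=
    { (inferInstance : Ring (Algebra.adjoin ℂ s)) with mul_comm := hs.is_comm.comm }
  let F₀ : MvPolynomial (ℤ × ι) ℂ →ₐ[ℂ] Algebra.adjoin ℂ s :=
    aeval fun p => ⟨T p.1 (v p.2), Algebra.subset_adjoin ⟨(p.1, v p.2), rfl⟩⟩
  let F := (Algebra.adjoin ℂ s).val.comp (F₀.comp (polyEquivFun hvw).symm.toAlgHom)
  have hF (n : ℤ) (i : ι) : F (coord B (v i) n) = T n (v i) := by
    change ((F₀ ((polyEquivFun hvw).symm (coord B (v i) n)) : Algebra.adjoin ℂ s) : C) = _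
    rw [← polyToFun_X]
    change ((F₀ ((polyEquivFun hvw).symm (polyEquivFun hvw (X (n, i)))) :
      Algebra.adjoin ℂ s) : C) = _
    rw [AlgEquiv.symm_apply_apply, aeval_X]
  exact ⟨F, fun a n => LinearMap.congr_fun
    (v.ext (hF n) : F.toLinearMap ∘ₗ coordLin B n = T n) a⟩

end Functions

section FunctionTensor

variable {K : Type*} [Field K]

lemma eq_zero_of_forall_rTensor_proj_eq_zero {X : Type*} {F : Submodule K (X → K)} {Q : Type*}
    [AddCommGroup Q] [Module K Q] {t : F ⊗[K] Q}
    (ht : ∀ x, LinearMap.rTensor Q (LinearMap.proj x ∘ₗ F.subtype) t = 0) : t = 0 := by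
  classical
  let b := Module.Basis.ofVectorSpace K Q
  let e := TensorProduct.equivFinsuppOfBasisRight (M := F) b
  refine e.injective (Finsupp.ext fun i => Subtype.ext (funext fun x => ?_))
  have hlin : LinearMap.proj x ∘ₗ F.subtype ∘ₗ Finsupp.lapply i ∘ₗ e.toLinearMap =
      b.coord i ∘ₗ (TensorProduct.lid K Q).toLinearMap ∘ₗ
        LinearMap.rTensor Q (LinearMap.proj x ∘ₗ F.subtype) :=
    TensorProduct.ext' fun f q => by
      simp [e, mul_comm]
  refine (LinearMap.congr_fun hlin t).trans ?_
  rw [LinearMap.comp_apply, LinearMap.comp_apply, ht, map_zero, map_zero, map_zero]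
  rfl

end FunctionTensor

section Bundle

variable {g : Type*} [LieRing g] [LieAlgebra ℂ g] {B : LinearMap.BilinForm ℂ g}

section LimitHom

variable {κ : Type*} [LinearOrder κ] (b : Module.Basis κ ℂ g) (A : Connection g)
  (hB : B.IsSymm) (hB' : B.lieInvariant g)

/-- The action of the limit on its fibre at `d + A`. -/
def limitHom : Limit B →ₐ[ℂ] Module.End ℂ (LevelOne B) :=
  RingQuot.liftAlgHom ℂ ⟨fibreHom b A (LevelOne B) hB hB', by
    rintro _ _ ⟨rfl, rfl⟩
    rw [fibreHom_kapInv, map_zero]⟩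

lemma limitHom_toLimit (u : intForm B) :
    limitHom b A hB hB' (toLimit B u) = fibreHom b A (LevelOne B) hB hB' u :=
  RingQuot.liftAlgHom_mkAlgHom_apply (S := ℂ) _ _ u

lemma limitHom_eq_algebraMap {F : functionRing B →ₐ[ℂ] Limit B}
    (hF : ∀ a n, F (coord B a n) = toLimit B (scaledDiag B a n)) (f : functionRing B) :
    limitHom b A hB hB' (F f) = algebraMap ℂ _ (f.1 A) := by
  refine mem_of_forall_coord_mem (AlgHom.equalizer ((limitHom b A hB hB').comp F)
    ((Algebra.ofId ℂ _).comp ((Pi.evalAlgHom ℂ (fun _ => ℂ) A).comp (functionRing B).val)))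
    (fun a n => ?_) f
  change limitHom b A hB hB' (F (coord B a n)) = algebraMap ℂ _ (B (A.1 n) a)
  rw [hF, limitHom_toLimit, fibreHom_scaledDiag]

end LimitHom

lemma toLimit_surjective : Function.Surjective (toLimit B) :=
  RingQuot.mkAlgHom_surjective ℂ _

variable {F : functionRing B →ₐ[ℂ] Limit B}
  (hF : ∀ a n, F (coord B a n) = toLimit B (scaledDiag B a n))

include hF in
lemma commute_toLimit_inclOne (f : functionRing B) (u : LevelOne B) :
    Commute (F f) ((toLimit B).comp (inclOne B) u) := by
  refine ((Subalgebra.mem_centralizer_iff ℂ).mp (mem_of_forall_coord_mem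
    ((Subalgebra.centralizer ℂ {toLimit B (inclOne B u)}).comap F)
    (fun a n => (Subalgebra.mem_centralizer_iff ℂ).mpr ?_) f) _ rfl).symm
  rintro _ rfl
  change _ * F (coord B a n) = F (coord B a n) * _
  rw [hF]
  exact (toLimit_scaledDiag_comm_inclOne B a n u).symm

/-- The homomorphism from the functions on the space of connections, tensored with the algebra of
level one, to the limit. -/
def bundleHom : functionRing B ⊗[ℂ] LevelOne B →ₐ[ℂ] Limit B :=
  Algebra.TensorProduct.lift F ((toLimit B).comp (inclOne B)) (commute_toLimit_inclOne hF)

lemma bundleHom_tmul (f : functionRing B) (u : LevelOne B) :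
    bundleHom hF (f ⊗ₜ u) = F f * toLimit B (inclOne B u) :=
  Algebra.TensorProduct.lift_tmul _ _ _ f u

lemma bundleHom_coord_tmul_one (a : g) (n : ℤ) :
    bundleHom hF (coord B a n ⊗ₜ 1) = toLimit B (scaledDiag B a n) := by
  rw [bundleHom_tmul, hF, map_one, map_one, mul_one]

lemma bundleHom_one_tmul (u : LevelOne B) :
    bundleHom hF (1 ⊗ₜ u) = toLimit B (inclOne B u) := by
  rw [bundleHom_tmul, map_one, one_mul]

lemma bundleHom_surjective : Function.Surjective (bundleHom hF) := by
  intro x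
  obtain ⟨u, rfl⟩ := toLimit_surjective x
  refine mem_of_forall_generator_mem ((bundleHom hF).range.comap (toLimit B)) (fun f => ?_)
    (fun a n => ⟨_, bundleHom_coord_tmul_one hF a n⟩) (fun a n => ⟨_, bundleHom_one_tmul hF _⟩) u
  obtain ⟨u, hu⟩ := exists_regularHom_eq B f
  refine ⟨algebraMap ℂ _ (valueAtInfinity f), ?_⟩
  change bundleHom hF (algebraMap ℂ _ (valueAtInfinity f)) = toLimit B (regularHom B f)
  rw [hu, AlgHom.commutes, map_add, map_mul, toLimit_kapInv, zero_mul, add_zero, AlgHom.commutes]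

variable {κ : Type*} [LinearOrder κ] (b : Module.Basis κ ℂ g)
  (hB : B.IsSymm) (hB' : B.lieInvariant g)

lemma limitHom_bundleHom_apply_one (A : Connection g) (t : functionRing B ⊗[ℂ] LevelOne B) :
    limitHom b A hB hB' (bundleHom hF t) 1 = TensorProduct.lid ℂ _ (LinearMap.rTensor (LevelOne B)
      (LinearMap.proj A ∘ₗ (functionRing B).toSubmodule.subtype) t) := by
  induction t with
  | zero => simp only [map_zero, LinearMap.zero_apply]
  | add t t' ht ht' => simp only [map_add, LinearMap.add_apply, ht, ht']
  | tmul f u =>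
    rw [bundleHom_tmul, map_mul, limitHom_eq_algebraMap b A hB hB' hF, limitHom_toLimit,
      Module.End.mul_apply, fibreHom_inclOne, smul_eq_mul, mul_one]
    rfl

include b hB hB' in
lemma bundleHom_injective : Function.Injective (bundleHom hF) := by
  rw [injective_iff_map_eq_zero]
  intro t ht
  refine eq_zero_of_forall_rTensor_proj_eq_zero (F := (functionRing B).toSubmodule) fun A =>
    (TensorProduct.lid ℂ (LevelOne B)).injective ?_
  rw [← limitHom_bundleHom_apply_one hF b hB hB', ht, map_zero, LinearMap.zero_apply, map_zero]

include b hB hB' in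
theorem exists_bundle_equiv {ι : Type*} [Finite ι] [DecidableEq ι] {v : Module.Basis ι ℂ g}
    {w : ι → g} (hvw : ∀ i j, B (w i) (v j) = if i = j then 1 else 0) :
    ∃ e : functionRing B ⊗[ℂ] LevelOne B ≃ₐ[ℂ] Limit B,
      (∀ a n, e (coord B a n ⊗ₜ 1) = toLimit B (scaledDiag B a n)) ∧
      ∀ u, e (1 ⊗ₜ u) = toLimit B (inclOne B u) := by
  obtain ⟨F, hF⟩ := exists_functionRing_hom hvw
    (fun n => (toLimit B).toLinearMap ∘ₗ scaledDiagLin B n)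
    (fun m n a b => toLimit_scaledDiag_comm B a b m n)
  exact ⟨AlgEquiv.ofBijective (bundleHom hF)
    ⟨bundleHom_injective hF b hB hB', bundleHom_surjective hF⟩,
    bundleHom_coord_tmul_one hF, bundleHom_one_tmul hF⟩

end Bundle

section Fibres

variable {g : Type*} [LieRing g] [LieAlgebra ℂ g] {B : LinearMap.BilinForm ℂ g} {A : Connection g}
  {M : Type*} [AddCommGroup M] [Module (intForm B) M]

variable (B A) in
lemma Coinv.mk_surjective : Function.Surjective (Coinv.mk B A : M → Coinv B A M) :=
  Submodule.mkQ_surjective _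

variable (B A) in
lemma Coinv.mk_eq_zero {x : M} : Coinv.mk B A x = 0 ↔ x ∈ coinvKer B A M :=
  Submodule.Quotient.mk_eq_zero _

variable (B A) in
lemma Coinv.mk_smul (u : intForm B) (x : M) : Coinv.mk B A (u • x) = u • Coinv.mk B A x :=
  rfl

lemma Coinv.kapInv_smul (y : Coinv B A M) : kapInv B • y = 0 := by
  obtain ⟨x, rfl⟩ := mk_surjective B A y
  exact (mk_eq_zero B A).mpr (Submodule.subset_span (.inl ⟨x, rfl⟩))

lemma Coinv.scaledDiag_smul (a : g) (n : ℤ) (y : Coinv B A M) :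
    scaledDiag B a n • y = algebraMap ℂ (intForm B) (B (A.1 n) a) • y := by
  obtain ⟨x, rfl⟩ := mk_surjective B A y
  rw [← sub_eq_zero, ← sub_smul]
  exact (mk_eq_zero B A).mpr (Submodule.subset_span (.inr ⟨a, n, x, rfl⟩))

lemma Coinv.levelOne_smul (u : LevelOne B) (y : Coinv B A M) : u • y = inclOne B u • y :=
  rfl

lemma Coinv.algebraMap_smul (c : ℂ) (y : Coinv B A M) :
    algebraMap ℂ (intForm B) c • y = algebraMap ℂ (LevelOne B) c • y := by
  rw [levelOne_smul, AlgHom.commutes]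

lemma Coinv.regularHom_smul (f : regularAtInfinity) (y : Coinv B A M) :
    regularHom B f • y = algebraMap ℂ (LevelOne B) (valueAtInfinity f) • y := by
  obtain ⟨u, hu⟩ := exists_regularHom_eq B f
  rw [hu, add_smul, mul_smul, kapInv_smul, add_zero, algebraMap_smul]

lemma Coinv.smul_mem (P : Submodule (LevelOne B) (Coinv B A M)) (u : intForm B)
    {y : Coinv B A M} (hy : y ∈ P) : u • y ∈ P := by
  let stabilizer : Subalgebra ℂ (intForm B) :=
    { carrier := {u | ∀ y ∈ P, u • y ∈ P}
      mul_mem' := fun {u u'} hu hu' y hy => (mul_smul u u' y).symm ▸ hu _ (hu' y hy)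
      add_mem' := fun {u u'} hu hu' y hy => (add_smul u u' y).symm ▸ add_mem (hu y hy) (hu' y hy)
      algebraMap_mem' := fun c y hy => (algebraMap_smul c y).symm ▸ P.smul_mem _ hy }
  refine mem_of_forall_generator_mem stabilizer (fun f y hy => ?_) (fun a n y hy => ?_)
    (fun a n y hy => ?_) u y hy
  · rw [regularHom_smul]
    exact P.smul_mem _ hy
  · rw [scaledDiag_smul, algebraMap_smul]
    exact P.smul_mem _ hy
  · exact P.smul_mem (modeOne B a n) hy

lemma coinvKer_le_map_of_surjective {M' : Type*} [AddCommGroup M'] [Module (intForm B) M']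
    {f : M →ₗ[intForm B] M'} (hf : Function.Surjective f) :
    coinvKer B A M' ≤ (coinvKer B A M).map f := by
  refine Submodule.span_le.mpr ?_
  rintro _ (⟨y, rfl⟩ | ⟨a, n, y, rfl⟩)
  all_goals
    obtain ⟨x, rfl⟩ := hf y
    rw [← map_smul]
  · exact Submodule.mem_map_of_mem (Submodule.subset_span (.inl ⟨x, rfl⟩))
  · exact Submodule.mem_map_of_mem (Submodule.subset_span (.inr ⟨a, n, x, rfl⟩))

variable {κ : Type*} [LinearOrder κ] (b : Module.Basis κ ℂ g)
  (hB : B.IsSymm) (hB' : B.lieInvariant g)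

lemma fibreHom_of_mem_coinvKer (Q : Type*) [AddCommGroup Q] [Module ℂ Q] [Module (LevelOne B) Q]
    [IsScalarTower ℂ (LevelOne B) Q] {u : intForm B} (hu : u ∈ coinvKer B A (intForm B)) :
    fibreHom b A Q hB hB' u = 0 := by
  refine (Submodule.span_le.mpr ?_ : _ ≤ RingHom.ker (fibreHom b A Q hB hB').toRingHom) hu
  rintro _ (⟨x, rfl⟩ | ⟨a, n, x, rfl⟩)
  · change fibreHom b A Q hB hB' (kapInv B * x) = 0
    rw [map_mul, fibreHom_kapInv, zero_mul]
  · change fibreHom b A Q hB hB' ((scaledDiag B a n - algebraMap ℂ _ (B (A.1 n) a)) * x) = 0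
    rw [map_mul, map_sub, fibreHom_scaledDiag, AlgHom.commutes, sub_self, zero_mul]

include b hB hB'

lemma exists_cyclic_fibre_equiv {x₀ : M}
    (hx₀ : Function.Surjective (LinearMap.toSpanSingleton (intForm B) M x₀))
    (I : Submodule (LevelOne B) (LevelOne B)) (hI : ∀ u ∈ I, inclOne B u • x₀ = 0)
    (hann : ∀ u : intForm B, u • x₀ = 0 →
      fibreHom b A (LevelOne B ⧸ I) hB hB' u (Submodule.Quotient.mk 1) = 0) :
    ∃ e : (LevelOne B ⧸ I) ≃ₗ[LevelOne B] Coinv B A M,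
      e (Submodule.Quotient.mk 1) = Coinv.mk B A x₀ := by
  let f : LevelOne B →ₗ[LevelOne B] Coinv B A M :=
    LinearMap.toSpanSingleton _ _ (Coinv.mk B A x₀)
  have hf (u : LevelOne B) : f u = Coinv.mk B A (inclOne B u • x₀) := rfl
  have hone : f 1 = Coinv.mk B A x₀ := one_smul _ _
  have hker : I = LinearMap.ker f := by
    refine le_antisymm (fun u hu => ?_) fun u hu => ?_
    · rw [LinearMap.mem_ker, hf, hI u hu]
      exact map_zero (coinvKer B A M).mkQ
    · rw [LinearMap.mem_ker, hf, Coinv.mk_eq_zero] at hu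
      obtain ⟨u', hu', heq⟩ := coinvKer_le_map_of_surjective hx₀ hu
      have hfib := hann (inclOne B u - u') (by
        rw [sub_smul, sub_eq_zero]
        exact heq.symm)
      rwa [map_sub, fibreHom_of_mem_coinvKer b hB hB' _ hu', sub_zero, fibreHom_inclOne,
        ← Submodule.Quotient.mk_smul, smul_eq_mul, mul_one, Submodule.Quotient.mk_eq_zero] at hfib
  have hsurj : Function.Surjective f := by
    intro y
    obtain ⟨x, rfl⟩ := Coinv.mk_surjective B A y
    obtain ⟨u, rfl⟩ := hx₀ x
    exact Coinv.smul_mem (LinearMap.range f) u ⟨1, hone⟩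
  exact ⟨(Submodule.quotEquivOfEq _ _ hker).trans (f.quotKerEquivOfSurjective hsurj), hone⟩

theorem exists_fibre_equiv (A : Connection g) :
    ∃ e : LevelOne B ≃ₗ[LevelOne B] Coinv B A (intForm B), e 1 = Coinv.mk B A 1 := by
  obtain ⟨e, he⟩ := exists_cyclic_fibre_equiv (A := A) b hB hB' (x₀ := (1 : intForm B))
    (fun x => ⟨x, mul_one x⟩) ⊥
    (fun u hu => by rw [(Submodule.mem_bot _).mp hu, map_zero, zero_smul])
    (fun u hu => by
      rw [smul_eq_mul, mul_one] at hu
      rw [hu, map_zero, LinearMap.zero_apply])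
  exact ⟨(Submodule.quotEquivOfEqBot ⊥ rfl).symm.trans e, he⟩

omit b hB hB'

variable (B) in
lemma smul_univVec_eq_zero_iff (N : ℕ) (u : Generic B) : u • univVec B N = 0 ↔
    u ∈ highModes (RatFunc ℂ) B ![kap - 1, 1] N := by
  rw [univVec, ← Submodule.Quotient.mk_smul, smul_eq_mul, mul_one, Submodule.Quotient.mk_eq_zero]

variable (B) in
lemma smul_univLatticeVec_eq_zero_iff (N : ℕ) (u : intForm B) : u • univLatticeVec B N = 0 ↔
    (u : Generic B) ∈ highModes (RatFunc ℂ) B ![kap - 1, 1] N :=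
  Subtype.ext_iff.trans (smul_univVec_eq_zero_iff B N u)

lemma coe_inclOne_mem_highModes {N : ℕ} {u : LevelOne B} (hu : u ∈ highModes ℂ B _ N) :
    (inclOne B u : Generic B) ∈ highModes (RatFunc ℂ) B ![kap - 1, 1] N := by
  induction hu using Submodule.span_induction with
  | mem u hu =>
    obtain ⟨s, a, n, hn, rfl⟩ := hu
    exact Submodule.subset_span ⟨1, a, n, hn, coe_inclOne_modeOne B a n⟩
  | zero =>
    rw [map_zero]
    exact zero_mem _
  | add x y _ _ hx hy =>
    rw [map_add]
    exact add_mem hx hy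
  | smul c x _ hx =>
    rw [smul_eq_mul, map_mul]
    exact Submodule.smul_mem _ _ hx

include b hB hB'

theorem exists_univ_fibre_equiv (A : Connection g) (N : ℕ) (hA : ∀ n : ℤ, N ≤ n → A.1 n = 0) :
    ∃ e : (LevelOne B ⧸ highModes ℂ B (fun _ : Unit => (1 : ℂ)) N) ≃ₗ[LevelOne B]
        Coinv B A (univLattice B N),
      e (Submodule.Quotient.mk 1) = Coinv.mk B A (univLatticeVec B N) := by
  refine exists_cyclic_fibre_equiv b hB hB' (fun x => ?_) _ (fun u hu => ?_) (fun u hu => ?_)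
  · obtain ⟨u, hu⟩ := Submodule.mem_span_singleton.mp x.2
    exact ⟨u, Subtype.ext hu⟩
  · exact (smul_univLatticeVec_eq_zero_iff B N _).mpr (coe_inclOne_mem_highModes hu)
  · refine fibreHom_of_mem_highModes b A _ hB hB' hA (fun a n hn => ?_)
      ((smul_univLatticeVec_eq_zero_iff B N u).mp hu)
    rw [← Submodule.Quotient.mk_smul, smul_eq_mul, mul_one, Submodule.Quotient.mk_eq_zero]
    exact Submodule.subset_span ⟨(), a, n, hn, rfl⟩

end Fibres

section Smooth

variable {S : Type*} [CommRing S] [Algebra ℂ S] {σ : Type*}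
  {g : Type*} [LieRing g] [LieAlgebra ℂ g] {B : LinearMap.BilinForm ℂ g} {k : σ → S}
  {V : Type*} [AddCommGroup V] [Module (ModeAlgebra S B k) V]

variable (S B k) in
/-- Vectors that are killed by all modes of sufficiently large degree. -/
def IsSmoothVector (x : V) : Prop :=
  ∃ N : ℤ, ∀ n ≥ N, ∀ (s : σ) (a : g), mode S B k s a n • x = 0

lemma IsSmoothVector.add {x y : V} (hx : IsSmoothVector S B k x) (hy : IsSmoothVector S B k y) :
    IsSmoothVector S B k (x + y) := by
  obtain ⟨N, hN⟩ := hx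
  obtain ⟨N', hN'⟩ := hy
  refine ⟨max N N', fun n hn s a => ?_⟩
  rw [smul_add, hN n (by lia), hN' n (by lia), add_zero]

lemma IsSmoothVector.mode_smul {x : V} (hx : IsSmoothVector S B k x) (t : σ) (b : g) (m : ℤ) :
    IsSmoothVector S B k (mode S B k t b m • x) := by
  obtain ⟨N, hN⟩ := hx
  refine ⟨max N (max (N - m) (1 - m)), fun n hn s a => ?_⟩
  rw [← mul_smul]
  rcases eq_or_ne s t with rfl | hst
  · rw [mode_mul, if_neg (by lia), map_zero, add_zero, add_smul, mul_smul, hN n (by lia),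
      smul_zero, hN (n + m) (by lia), add_zero]
  · rw [mode_mul_of_ne hst, mul_smul, hN n (by lia), smul_zero]

lemma IsSmoothVector.algebraMap_smul {x : V} (hx : IsSmoothVector S B k x) (c : S) :
    IsSmoothVector S B k (algebraMap S (ModeAlgebra S B k) c • x) := by
  obtain ⟨N, hN⟩ := hx
  refine ⟨N, fun n hn s a => ?_⟩
  rw [← mul_smul, ← Algebra.commutes, mul_smul, hN n hn, smul_zero]

lemma IsSmoothVector.smul {x : V} (hx : IsSmoothVector S B k x) (u : ModeAlgebra S B k) :
    IsSmoothVector S B k (u • x) := by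
  let P : Subalgebra S (ModeAlgebra S B k) :=
    { carrier := {u | ∀ x : V, IsSmoothVector S B k x → IsSmoothVector S B k (u • x)}
      mul_mem' := fun {u u'} hu hu' x hx => (mul_smul u u' x).symm ▸ hu _ (hu' x hx)
      add_mem' := fun {u u'} hu hu' x hx => (add_smul u u' x).symm ▸ (hu x hx).add (hu' x hx)
      algebraMap_mem' := fun c x hx => hx.algebraMap_smul c }
  exact ModeAlgebra.mem_of_forall_mode_mem P (fun s a n x hx => hx.mode_smul s a n) u x hx

end Smooth

section SmoothModules

variable {g : Type*} [LieRing g] [LieAlgebra ℂ g] (B : LinearMap.BilinForm ℂ g)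

theorem isSmooth_univSmooth (N : ℕ) : IsSmooth (RatFunc ℂ) B ![kap - 1, 1] (UnivSmooth B N) := by
  have hvec : IsSmoothVector (RatFunc ℂ) B ![kap - 1, 1] (univVec B N) :=
    ⟨N, fun n hn s a => (smul_univVec_eq_zero_iff B N _).mpr
      (Submodule.subset_span ⟨s, a, n, hn, rfl⟩)⟩
  intro x
  obtain ⟨u, rfl⟩ := Submodule.Quotient.mk_surjective _ x
  rw [← mul_one u, ← smul_eq_mul, Submodule.Quotient.mk_smul]
  exact hvec.smul u

lemma Coinv.modeOne_smul_mk_eq_zero (A : Connection g) {V : Type*} [AddCommGroup V]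
    [Module (Generic B) V] {M : Submodule (intForm B) V} {z : M} {a : g} {n : ℤ}
    (hz : modeY B a n • (z : V) = 0) : modeOne B a n • Coinv.mk B A z = 0 := by
  have hz' : inclOne B (modeOne B a n) • z = 0 := Subtype.ext (by
    change (inclOne B (modeOne B a n) : Generic B) • (z : V) = 0
    rw [coe_inclOne_modeOne, hz])
  rw [levelOne_smul, ← mk_smul, hz']
  exact map_zero (coinvKer B A M).mkQ

theorem isSmooth_coinv (A : Connection g) {V : Type*} [AddCommGroup V] [Module (Generic B) V]
    (hV : IsSmooth (RatFunc ℂ) B ![kap - 1, 1] V) (M : Submodule (intForm B) V) :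
    IsSmooth ℂ B (fun _ : Unit => (1 : ℂ)) (Coinv B A M) := by
  intro y
  obtain ⟨z, rfl⟩ := Coinv.mk_surjective B A y
  obtain ⟨N, hN⟩ := hV z
  exact ⟨N, fun n hn _ a => Coinv.modeOne_smul_mk_eq_zero B A (hN n hn 1 a)⟩

end SmoothModules

section HasFinSum

variable {κ κ' W W' : Type*} [AddCommGroup W] [AddCommGroup W']

/-- The family `f` has finite support and sum `y`: the purely algebraic counterpart of `HasSum`,
which keeps track of the finiteness that the value `∑ᶠ i, f i` alone does not see. -/
def HasFinSum (f : κ → W) (y : W) : Prop := f.support.Finite ∧ ∑ᶠ i, f i = y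

lemma hasFinSum_finsum {f : κ → W} (hf : f.support.Finite) : HasFinSum f (∑ᶠ i, f i) := ⟨hf, rfl⟩

lemma hasFinSum_zero : HasFinSum (fun _ : κ => (0 : W)) 0 :=
  ⟨by simp only [Function.support_fun_zero, Set.finite_empty], finsum_zero⟩

lemma hasFinSum_single (i₀ : κ) {f : κ → W} (hf : ∀ i, i ≠ i₀ → f i = 0) :
    HasFinSum f (f i₀) :=
  ⟨(Set.finite_singleton i₀).subset (Function.support_subset_iff'.mpr hf), finsum_eq_single f i₀ hf⟩

namespace HasFinSum

variable {f f' : κ → W} {y y' : W}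

lemma unique (hf : HasFinSum f y) (hf' : HasFinSum f y') : y = y' := hf.2.symm.trans hf'.2

lemma congr (hf : HasFinSum f y) (h : ∀ i, f' i = f i) (hy : y = y') : HasFinSum f' y' :=
  hy ▸ funext h ▸ hf

lemma add (hf : HasFinSum f y) (hf' : HasFinSum f' y') :
    HasFinSum (fun i => f i + f' i) (y + y') :=
  ⟨(hf.1.union hf'.1).subset (Function.support_add f f'), by
    rw [finsum_add_distrib hf.1 hf'.1, hf.2, hf'.2]⟩

lemma map (hf : HasFinSum f y) (T : W →+ W') : HasFinSum (fun i => T (f i)) (T y) :=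
  ⟨hf.1.subset (Function.support_comp_subset (map_zero T) f), by rw [← hf.2, T.map_finsum hf.1]⟩

lemma neg (hf : HasFinSum f y) : HasFinSum (fun i => -f i) (-y) :=
  hf.map (negAddMonoidHom : W →+ W)

lemma sub (hf : HasFinSum f y) (hf' : HasFinSum f' y') :
    HasFinSum (fun i => f i - f' i) (y - y') := by
  simpa only [sub_eq_add_neg] using hf.add hf'.neg

lemma const_smul {R : Type*} [Semiring R] [Module R W] (hf : HasFinSum f y) (c : R) :
    HasFinSum (fun i => c • f i) (c • y) :=
  hf.map (DistribSMul.toAddMonoidHom W c)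

lemma smul_const {R : Type*} [Ring R] [Module R W] {c : κ → R} {s : R} (hc : HasFinSum c s)
    (x : W) : HasFinSum (fun i => c i • x) (s • x) :=
  hc.map (LinearMap.toSpanSingleton R W x).toAddMonoidHom

lemma comp_equiv (hf : HasFinSum f y) (e : κ' ≃ κ) : HasFinSum (fun i => f (e i)) y :=
  ⟨hf.1.preimage e.injective.injOn, by rw [← hf.2, ← finsum_comp_equiv e]⟩

lemma comp_add_right {f : ℤ → W} (hf : HasFinSum f y) (n : ℤ) : HasFinSum (fun i => f (i + n)) y :=
  hf.comp_equiv (Equiv.addRight n)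

lemma subtype {S : Type*} [SetLike S W] [AddSubgroupClass S W] {P : S} {f : κ → P}
    (hf : HasFinSum (fun i => (f i : W)) y) : ∃ hy : y ∈ P, HasFinSum f ⟨y, hy⟩ := by
  have hfin : f.support.Finite :=
    hf.1.subset fun i hi h => hi (Subtype.ext h)
  have hsum : ((∑ᶠ i, f i : P) : W) = y :=
    ((AddSubgroupClass.subtype P).map_finsum hfin).trans hf.2
  exact ⟨hsum ▸ SetLike.coe_mem _, hfin, Subtype.ext hsum⟩

lemma eq_zero_of_antisymm [IsAddTorsionFree W] {f : κ × κ → W} (hf : HasFinSum f y)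
    (h : ∀ i j, f (i, j) = -f (j, i)) : y = 0 :=
  self_eq_neg.mp <| hf.unique <|
    (hf.comp_equiv (Equiv.prodComm κ κ)).neg.congr (fun i => h i.1 i.2) rfl

lemma ite_add_eq {c : ℤ → W} (hc : HasFinSum c y) (n : ℤ) :
    HasFinSum (fun i : ℤ × ℤ => if i.1 + i.2 = n then c i.1 else 0) y := by
  have hfin : (fun i : ℤ × ℤ => if i.1 + i.2 = n then c i.1 else 0).support.Finite := by
    refine (hc.1.image fun r => (r, n - r)).subset fun i hi => ?_
    have h : i.1 + i.2 = n := by_contra fun h => hi (if_neg h)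
    exact ⟨i.1, by simpa only [Function.mem_support, if_pos h] using hi,
      Prod.ext rfl (sub_eq_of_eq_add' h.symm)⟩
  refine ⟨hfin, ?_⟩
  rw [finsum_curry _ hfin, ← hc.2]
  refine finsum_congr fun r => ?_
  rw [finsum_eq_single _ (n - r) fun s hs => if_neg fun h => hs (by lia), if_pos (by lia)]

end HasFinSum

lemma finite_support_of_window {f : ℤ → W} {a b : ℤ} (ha : ∀ m, m < a → f m = 0)
    (hb : ∀ m, b < m → f m = 0) : f.support.Finite :=
  (Set.finite_Icc a b).subset fun m hm =>
    ⟨not_lt.mp fun h => hm (ha m h), not_lt.mp fun h => hm (hb m h)⟩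

lemma hasFinSum_sub_comp_add_one {f : ℤ → W} {a b : ℤ} {c : W} (ha : ∀ p, p < a → f p = 0)
    (hb : ∀ p, b < p → f p = c) : HasFinSum (fun p => f p - f (p + 1)) (-c) := by
  -- compare with the step function with the same values near `-∞` and `∞`
  let s : ℤ → W := fun p => if 0 ≤ p then c else 0
  have hs : HasFinSum (fun p => s p - s (p + 1)) (-c) :=
    (hasFinSum_single (-1) fun p hp => by
      rcases lt_or_gt_of_ne hp with h | h
      · simp only [s, if_neg (show ¬ 0 ≤ p by lia), if_neg (show ¬ 0 ≤ p + 1 by lia), sub_zero]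
      · simp only [s, if_pos (show 0 ≤ p by lia), if_pos (show 0 ≤ p + 1 by lia), sub_self]).congr
      (fun _ => rfl) (by simp [s])
  have hfs : HasFinSum (fun p => f p - s p) (∑ᶠ p, (f p - s p)) := by
    refine hasFinSum_finsum (finite_support_of_window (a := min a 0) (b := max b 0)
      (fun p hp => ?_) fun p hp => ?_)
    · simp only [s, ha p (by lia), if_neg (show ¬ 0 ≤ p by lia), sub_zero]
    · simp only [s, hb p (by lia), if_pos (show 0 ≤ p by lia), sub_self]
  exact (hs.add (hfs.sub (hfs.comp_add_right 1))).congr (fun p => by abel) (by abel)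

lemma hasFinSum_sub_comp_add {f : ℤ → W} {a b : ℤ} {c : W} (ha : ∀ p, p < a → f p = 0)
    (hb : ∀ p, b < p → f p = c) (n : ℤ) : HasFinSum (fun p => f p - f (p + n)) (-(n • c)) := by
  have hone := hasFinSum_sub_comp_add_one ha hb
  induction n using Int.induction_on with
  | zero => simpa using hasFinSum_zero (κ := ℤ) (W := W)
  | succ n ih =>
    refine (ih.add (hone.comp_add_right n)).congr (fun p => ?_) ?_
    · rw [sub_add_sub_cancel, add_assoc]
    · rw [add_smul, one_smul]
      abel
  | pred n ih =>
    refine (ih.sub (hone.comp_add_right (-n - 1))).congr (fun p => ?_) ?_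
    · rw [show p + (-n - 1) + 1 = p + -(n : ℤ) by ring]
      abel
    · rw [sub_smul, one_smul]
      abel

lemma hasFinSum_ite_sub_ite (H : ℤ → W) (a b : ℤ) :
    HasFinSum (fun p => (if a ≤ p then H (p + 1) - H p else 0) -
      (if b ≤ p then H (p + 1) - H p else 0)) (H b - H a) := by
  let f (c p : ℤ) : W := if c ≤ p then H p - H c else 0
  have hstep (c p : ℤ) : f c (p + 1) - f c p = if c ≤ p then H (p + 1) - H p else 0 := by
    rcases lt_trichotomy (p + 1) c with hp | rfl | hp
    · simp only [f, if_neg (show ¬ c ≤ p + 1 by lia), if_neg (show ¬ c ≤ p by lia), sub_self]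
    · simp only [f, le_refl, if_true, sub_self, if_neg (show ¬ p + 1 ≤ p by lia)]
    · simp only [f, if_pos (show c ≤ p + 1 by lia), if_pos (show c ≤ p by lia),
        sub_sub_sub_cancel_right]
  refine (hasFinSum_sub_comp_add_one (f := fun p => f a p - f b p) (a := min a b)
    (b := max a b) (c := H b - H a) (fun p hp => ?_) fun p hp => ?_).neg.congr (fun p => ?_)
    (neg_neg _)
  · simp only [f, if_neg (show ¬ a ≤ p by lia), if_neg (show ¬ b ≤ p by lia), sub_self]
  · simp only [f, if_pos (show a ≤ p by lia), if_pos (show b ≤ p by lia), sub_sub_sub_cancel_left]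
  · rw [← hstep, ← hstep]
    abel

end HasFinSum

section LocallyFinite

variable {R κ κ' W : Type*} [Semiring R] [AddCommGroup W] [Module R W]

/-- The operator `x ↦ ∑ F i x` attached to a locally finite family of operators. -/
def locSum (F : κ → Module.End R W) (hF : ∀ x, (fun i => F i x).support.Finite) :
    Module.End R W where
  toFun x := ∑ᶠ i, F i x
  map_add' x y := by
    simp only [map_add]
    exact finsum_add_distrib (hF x) (hF y)
  map_smul' c x := by
    simp only [map_smul, RingHom.id_apply]
    exact (smul_finsum' c (hF x)).symm

lemma hasFinSum_locSum {F : κ → Module.End R W} (hF : ∀ x, (fun i => F i x).support.Finite)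
    (x : W) : HasFinSum (fun i => F i x) (locSum F hF x) := ⟨hF x, rfl⟩

variable {F : κ → Module.End R W} {T : Module.End R W} {F' : κ' → Module.End R W}
  {T' : Module.End R W}

lemma hasFinSum_commutator (hF : ∀ x, HasFinSum (fun i => F i x) (T x)) (X : Module.End R W)
    (x : W) : HasFinSum (fun i => (F i * X - X * F i) x) ((T * X - X * T) x) :=
  (hF (X x)).sub ((hF x).map X.toAddMonoidHom)

lemma hasFinSum_mul (hF : ∀ x, HasFinSum (fun i => F i x) (T x))
    (hF' : ∀ x, HasFinSum (fun i => F' i x) (T' x)) (x : W) :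
    HasFinSum (fun i : κ' × κ => (F i.2 * F' i.1) x) ((T * T') x) := by
  have hfin : (fun i : κ' × κ => (F i.2 * F' i.1) x).support.Finite := by
    refine ((hF' x).1.biUnion fun j _ => (hF (F' j x)).1.image (Prod.mk j)).subset ?_
    rintro ⟨j, i⟩ hij
    refine Set.mem_biUnion (x := j) (fun h : F' j x = 0 => hij ?_) ⟨i, hij, rfl⟩
    simp only [Module.End.mul_apply, h, map_zero]
  refine ⟨hfin, ?_⟩
  rw [finsum_curry _ hfin]
  exact (finsum_congr fun j => (hF (F' j x)).2).trans ((hF' x).map T.toAddMonoidHom).2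

lemma hasFinSum_commutator_prod (hF : ∀ x, HasFinSum (fun i => F i x) (T x))
    (hF' : ∀ x, HasFinSum (fun i => F' i x) (T' x)) (x : W) :
    HasFinSum (fun i : κ × κ' => (F i.1 * F' i.2 - F' i.2 * F i.1) x) ((T * T' - T' * T) x) :=
  ((hasFinSum_mul hF hF' x).comp_equiv (Equiv.prodComm κ κ')).sub (hasFinSum_mul hF' hF x)

end LocallyFinite

section DualBases

variable {R M E ι : Type*} [CommRing R] [AddCommGroup M] [Module R M] [AddCommGroup E] [Module R E]
  [DecidableEq ι] {B : LinearMap.BilinForm R M}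

lemma dual_pairing_symm (hB : B.IsSymm) {v w : ι → M}
    (hvw : ∀ i j, B (v i) (w j) = if i = j then 1 else 0) (i j : ι) :
    B (w i) (v j) = if i = j then 1 else 0 := by
  rw [hB.eq, hvw]
  simp only [eq_comm]

variable [Fintype ι]

lemma sum_dual_smul {v : ι → M} {w : Module.Basis ι R M}
    (hwv : ∀ i j, B (w i) (v j) = if i = j then 1 else 0) (x : M) :
    ∑ i, B x (v i) • w i = x := by
  have hcoord (i : ι) : w.coord i = B.flip (v i) := w.ext fun j => by
    simp only [Module.Basis.coord_apply, Module.Basis.repr_self, Finsupp.single_apply,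
      LinearMap.BilinForm.flip_apply, hwv]
  have hrepr (i : ι) : B x (v i) = w.repr x i := (LinearMap.congr_fun (hcoord i) x).symm
  simp only [hrepr, w.sum_repr]

lemma sum_dual_mul {v : ι → M} {w : Module.Basis ι R M}
    (hwv : ∀ i j, B (w i) (v j) = if i = j then 1 else 0) (x y : M) :
    ∑ i, B x (w i) * B y (v i) = B x y := by
  conv_rhs => rw [← sum_dual_smul hwv y, map_sum]
  exact Finset.sum_congr rfl fun i _ => by rw [map_smul, smul_eq_mul, mul_comm]

lemma sum_dual_adjoint {v w : Module.Basis ι R M}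
    (hvw : ∀ i j, B (v i) (w j) = if i = j then 1 else 0) (β : M →ₗ[R] M →ₗ[R] E)
    {T T' : M → M} (hT : ∀ x y, B (T x) y = B x (T' y)) :
    ∑ i, β (T (v i)) (w i) = ∑ i, β (v i) (T' (w i)) := by
  have expand_left (i : ι) : β (T (v i)) (w i) = ∑ j, B (T (v i)) (w j) • β (v j) (w i) := by
    conv_lhs => rw [← sum_dual_smul hvw (T (v i))]
    simp only [map_sum, map_smul, LinearMap.sum_apply, LinearMap.smul_apply]
  have expand_right (j : ι) : β (v j) (T' (w j)) = ∑ i, B (T (v i)) (w j) • β (v j) (w i) := by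
    conv_lhs => rw [← sum_dual_smul (B := B.flip) (v := v)
      (fun i j => (hvw j i).trans (by simp only [eq_comm])) (T' (w j))]
    simp only [map_sum, map_smul, LinearMap.BilinForm.flip_apply, hT]
  simp only [expand_left, expand_right]
  exact Finset.sum_comm

lemma sum_dual_symm (hB : B.IsSymm) {v : ι → M} {w : Module.Basis ι R M}
    (hwv : ∀ i j, B (w i) (v j) = if i = j then 1 else 0) (β : M →ₗ[R] M →ₗ[R] E) :
    ∑ i, β (v i) (w i) = ∑ i, β (w i) (v i) := by
  have expand_left (i : ι) : β (v i) (w i) = ∑ j, B (v i) (v j) • β (w j) (w i) := by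
    conv_lhs => rw [← sum_dual_smul hwv (v i)]
    simp only [map_sum, map_smul, LinearMap.sum_apply, LinearMap.smul_apply]
  have expand_right (j : ι) : β (w j) (v j) = ∑ i, B (v i) (v j) • β (w j) (w i) := by
    conv_lhs => rw [← sum_dual_smul hwv (v j)]
    simp only [map_sum, map_smul, hB.eq (v j)]
  simp only [expand_left, expand_right]
  exact Finset.sum_comm

lemma sum_lie_dual {L : Type*} [LieRing L] [LieAlgebra R L] [IsAddTorsionFree L]
    {B : LinearMap.BilinForm R L} (hB : B.IsSymm) {v : ι → L} {w : Module.Basis ι R L}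
    (hwv : ∀ i j, B (w i) (v j) = if i = j then 1 else 0) : ∑ i, ⁅v i, w i⁆ = 0 := by
  have hswap : ∑ i, ⁅v i, w i⁆ = ∑ i, ⁅w i, v i⁆ :=
    sum_dual_symm hB hwv (LieModule.toEnd R L L : L →ₗ[R] L →ₗ[R] L)
  refine self_eq_neg.mp (hswap.trans ?_)
  rw [← Finset.sum_neg_distrib]
  exact Finset.sum_congr rfl fun i _ => (lie_skew _ _).symm

end DualBases

section Sugawara

variable {F : Type*} [Field F] {U : Type*} [Ring U] [Algebra F U] {W : Type*} [AddCommGroup W]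
  [Module U W] {g ι : Type*}

lemma normalOrdered_smul_eq_zero {J : g → ℤ → U} {x : W} {N m l : ℤ}
    (hx : ∀ a, ∀ k ≥ N, J a k • x = 0) (a b : g) (hm : m < 0 ∧ N ≤ l ∨ 0 ≤ m ∧ N ≤ m) :
    normalOrdered J a b m l • x = 0 := by
  rcases hm with ⟨hm, hl⟩ | ⟨hm, hN⟩
  · rw [normalOrdered, if_pos hm, mul_smul, hx b l hl, smul_zero]
  · rw [normalOrdered, if_neg hm.not_gt, mul_smul, hx a m hN, smul_zero]

lemma hasFinSum_sugawara [Fintype ι] {J : g → ℤ → U} {x : W} {N : ℤ}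
    (hx : ∀ a, ∀ k ≥ N, J a k • x = 0) (k h : F) (v w : ι → g) (n : ℤ) :
    HasFinSum (fun m => algebraMap F U (2 * (k + h))⁻¹ •
      ∑ i, normalOrdered J (v i) (w i) m (n - m) • x) (sugawara J k h v w n x) := by
  refine (hasFinSum_finsum (finite_support_of_window (a := min 0 (n - N)) (b := max 0 N)
    (fun m hm => ?_) fun m hm => ?_)).const_smul _
  all_goals exact Finset.sum_eq_zero fun i _ => normalOrdered_smul_eq_zero hx _ _ (by lia)

end Sugawara

section ShiftRatio

lemma kap_add_eq (c : ℂ) : kap + algebraMap ℂ (RatFunc ℂ) c =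
    algebraMap (Polynomial ℂ) (RatFunc ℂ) (Polynomial.X + Polynomial.C c) := by
  rw [map_add, RatFunc.algebraMap_X, RatFunc.algebraMap_C, RatFunc.algebraMap_eq_C, kap]

lemma kap_add_ne_zero (c : ℂ) : kap + algebraMap ℂ (RatFunc ℂ) c ≠ 0 := by
  rw [kap_add_eq]
  exact RatFunc.algebraMap_ne_zero (Polynomial.X_add_C_ne_zero c)

/-- The function `κ / (κ + c)`, which takes the value `1` at infinity: the Sugawara operators of
levels `κ - 1` and `κ` have the prefactors `1 / (2 (κ + c))` with `c = h - 1` and `c = h`. -/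
def shiftRatio (c : ℂ) : regularAtInfinity :=
  ⟨kap * (kap + algebraMap ℂ (RatFunc ℂ) c)⁻¹, by
    rw [mem_regularAtInfinity, RatFunc.intDegree_mul kap_ne_zero (inv_ne_zero (kap_add_ne_zero c)),
      RatFunc.intDegree_inv, kap_add_eq, RatFunc.intDegree_polynomial,
      Polynomial.natDegree_X_add_C, kap, RatFunc.intDegree_X]
    simp⟩

lemma shiftRatio_eq (c : ℂ) :
    shiftRatio c = 1 - hbar * (algebraMap ℂ regularAtInfinity c * shiftRatio c) := by
  refine Subtype.ext ?_
  have := kap_add_ne_zero c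
  change kap * (kap + algebraMap ℂ (RatFunc ℂ) c)⁻¹ = 1 - kap⁻¹ *
    (algebraMap ℂ (RatFunc ℂ) c * (kap * (kap + algebraMap ℂ (RatFunc ℂ) c)⁻¹))
  field_simp [kap_ne_zero]
  ring

lemma valueAtInfinity_shiftRatio (c : ℂ) : valueAtInfinity (shiftRatio c) = 1 := by
  rw [shiftRatio_eq, map_sub, map_mul, valueAtInfinity_hbar, zero_mul, sub_zero, map_one]

lemma two_mul_kap_add_inv (c : ℂ) : (2 * (kap + algebraMap ℂ (RatFunc ℂ) c))⁻¹ =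
    (1 / 2 : ℂ) • (kap⁻¹ * (shiftRatio c : RatFunc ℂ)) := by
  change _ = (1 / 2 : ℂ) • (kap⁻¹ * (kap * (kap + algebraMap ℂ (RatFunc ℂ) c)⁻¹))
  rw [inv_mul_cancel_left₀ kap_ne_zero, mul_inv, Algebra.smul_def, one_div, map_inv₀, map_ofNat]

lemma two_mul_kap_add_sub_one_inv_sub (h : ℂ) :
    (2 * (kap + algebraMap ℂ (RatFunc ℂ) (h - 1)))⁻¹ -
      (2 * (kap + algebraMap ℂ (RatFunc ℂ) h))⁻¹ =
    (1 / 2 : ℂ) • ((shiftRatio (h - 1) : RatFunc ℂ) * shiftRatio h * (kap⁻¹ * kap⁻¹)) := by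
  have h₁ := kap_add_ne_zero (h - 1)
  have h₂ := kap_add_ne_zero h
  change _ = (1 / 2 : ℂ) • (kap * (kap + algebraMap ℂ (RatFunc ℂ) (h - 1))⁻¹ *
    (kap * (kap + algebraMap ℂ (RatFunc ℂ) h)⁻¹) * (kap⁻¹ * kap⁻¹))
  rw [Algebra.smul_def, one_div, map_inv₀, map_ofNat]
  field_simp [kap_ne_zero]
  rw [map_sub, map_one]
  ring

end ShiftRatio

section CosetTerm

variable {g : Type*} [LieRing g] [LieAlgebra ℂ g] (B : LinearMap.BilinForm ℂ g)

/-- The contribution of a pair of modes `a_p b_q` to the coset Virasoro operators, as an element of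
the integral form. Substituting `a^{(κ-1)} = a^{(κ)} - a^{(1)}` makes the prefactor of
`a^{(κ)} b^{(κ)}` equal to `1 / (2 (κ - 1 + h)) - 1 / (2 (κ + h))`, which is of order `κ⁻²`. -/
def cosetTerm (h : ℂ) (a b : g) (p q : ℤ) : intForm B :=
  regularHom B ((1 / 2 : ℂ) • (shiftRatio (h - 1) * shiftRatio h)) *
    (scaledDiag B a p * scaledDiag B b q) -
  regularHom B ((1 / 2 : ℂ) • shiftRatio (h - 1)) *
    (scaledDiag B a p * inclOne B (modeOne B b q) + inclOne B (modeOne B a p) * scaledDiag B b q) +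
  regularHom B ((1 / 2 : ℂ) • (hbar * shiftRatio (h - 1))) *
    (inclOne B (modeOne B a p) * inclOne B (modeOne B b q)) +
  algebraMap ℂ _ (2 * (1 + h))⁻¹ * (inclOne B (modeOne B a p) * inclOne B (modeOne B b q))

lemma coe_cosetTerm (h : ℂ) (a b : g) (p q : ℤ) : (cosetTerm B h a b p q : Generic B) =
    (2 * (kap - 1 + algebraMap ℂ (RatFunc ℂ) h))⁻¹ • (modeX B a p * modeX B b q) +
    (2 * (1 + algebraMap ℂ (RatFunc ℂ) h))⁻¹ • (modeY B a p * modeY B b q) -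
    (2 * (kap + algebraMap ℂ (RatFunc ℂ) h))⁻¹ • (modeDiag B a p * modeDiag B b q) := by
  have modeX_eq (a : g) (n : ℤ) : modeX B a n = modeDiag B a n - modeY B a n := by
    rw [modeDiag, add_sub_cancel_right]
  have hlevel : kap - 1 + algebraMap ℂ (RatFunc ℂ) h = kap + algebraMap ℂ (RatFunc ℂ) (h - 1) := by
    rw [map_sub, map_one]
    ring
  have hone : (2 * (1 + algebraMap ℂ (RatFunc ℂ) h))⁻¹ =
      algebraMap ℂ (RatFunc ℂ) (2 * (1 + h))⁻¹ := by
    rw [map_inv₀, map_mul, map_add, map_one, map_ofNat]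
  have hcoe : (cosetTerm B h a b p q : Generic B) =
      ((1 / 2 : ℂ) • ((shiftRatio (h - 1) : RatFunc ℂ) * shiftRatio h)) •
        ((kap⁻¹ • modeDiag B a p) * (kap⁻¹ • modeDiag B b q)) -
      ((1 / 2 : ℂ) • (shiftRatio (h - 1) : RatFunc ℂ)) •
        ((kap⁻¹ • modeDiag B a p) * modeY B b q + modeY B a p * (kap⁻¹ • modeDiag B b q)) +
      ((1 / 2 : ℂ) • (kap⁻¹ * (shiftRatio (h - 1) : RatFunc ℂ))) • (modeY B a p * modeY B b q) +
      (algebraMap ℂ (RatFunc ℂ) (2 * (1 + h))⁻¹) • (modeY B a p * modeY B b q) := by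
    simp only [Algebra.smul_def (A := Generic B)]
    rw [← coe_inclOne_modeOne, ← coe_inclOne_modeOne, ← coe_algebraMap_intForm]
    rfl
  have hdiag : (1 / 2 : ℂ) • ((shiftRatio (h - 1) : RatFunc ℂ) * shiftRatio h) * (kap⁻¹ * kap⁻¹) =
      (2 * (kap + algebraMap ℂ (RatFunc ℂ) (h - 1)))⁻¹ -
        (2 * (kap + algebraMap ℂ (RatFunc ℂ) h))⁻¹ := by
    rw [two_mul_kap_add_sub_one_inv_sub, smul_mul_assoc]
  have hmixed : (1 / 2 : ℂ) • (shiftRatio (h - 1) : RatFunc ℂ) * kap⁻¹ =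
      (2 * (kap + algebraMap ℂ (RatFunc ℂ) (h - 1)))⁻¹ := by
    rw [two_mul_kap_add_inv, smul_mul_assoc, mul_comm]
  rw [hcoe, modeX_eq, modeX_eq, hone, hlevel, smul_mul_smul_comm, smul_smul, hdiag, smul_mul_assoc,
    mul_smul_comm, ← smul_add, smul_smul, hmixed, ← two_mul_kap_add_inv, sub_mul, mul_sub, mul_sub]
  simp only [smul_sub, sub_smul, smul_add]
  abel

/-- The normally ordered version of `cosetTerm`. -/
def normalCosetTerm (h : ℂ) (a b : g) (p q : ℤ) : intForm B :=
  if p < 0 then cosetTerm B h a b p q else cosetTerm B h b a q p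

lemma coe_normalCosetTerm (h : ℂ) (a b : g) (p q : ℤ) :
    (normalCosetTerm B h a b p q : Generic B) =
    (2 * (kap - 1 + algebraMap ℂ (RatFunc ℂ) h))⁻¹ • normalOrdered (modeX B) a b p q +
    (2 * (1 + algebraMap ℂ (RatFunc ℂ) h))⁻¹ • normalOrdered (modeY B) a b p q -
    (2 * (kap + algebraMap ℂ (RatFunc ℂ) h))⁻¹ • normalOrdered (modeDiag B) a b p q := by
  simp only [normalCosetTerm, normalOrdered]
  split_ifs <;> exact coe_cosetTerm ..

variable {A : Connection g} {M : Type*} [AddCommGroup M] [Module (intForm B) M]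

lemma Coinv.cosetTerm_smul (h : ℂ) (a b : g) (p q : ℤ) (y : Coinv B A M) :
    cosetTerm B h a b p q • y =
      algebraMap ℂ (LevelOne B) (2 * (1 + h))⁻¹ • (modeOne B a p * modeOne B b q) • y -
      algebraMap ℂ (LevelOne B) (1 / 2) •
        ((B (A.1 p) a • modeOne B b q) • y + (B (A.1 q) b • modeOne B a p) • y) +
      algebraMap ℂ (LevelOne B) (1 / 2 * (B (A.1 p) a * B (A.1 q) b)) • y := by
  simp only [cosetTerm, add_smul, sub_smul, mul_smul, regularHom_smul, scaledDiag_smul,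
    algebraMap_smul, map_mul, valueAtInfinity_shiftRatio, valueAtInfinity_hbar, AlgHom.commutes,
    map_one, one_smul, map_zero, zero_smul, smul_zero, ← levelOne_smul, Algebra.smul_def]
  rw [← mul_smul (modeOne B a p) (algebraMap ℂ (LevelOne B) _), ← Algebra.commutes, mul_smul]
  abel

lemma Coinv.normalCosetTerm_smul (h : ℂ) (a b : g) (p q : ℤ) (y : Coinv B A M) :
    normalCosetTerm B h a b p q • y =
      algebraMap ℂ (LevelOne B) (2 * (1 + h))⁻¹ • normalOrdered (modeOne B) a b p q • y -
      algebraMap ℂ (LevelOne B) (1 / 2) •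
        ((B (A.1 p) a • modeOne B b q) • y + (B (A.1 q) b • modeOne B a p) • y) +
      algebraMap ℂ (LevelOne B) (1 / 2 * (B (A.1 p) a * B (A.1 q) b)) • y := by
  simp only [normalCosetTerm, normalOrdered]
  split_ifs
  · exact cosetTerm_smul ..
  · rw [cosetTerm_smul, mul_comm (B (A.1 q) b),
      add_comm ((B (A.1 q) b • modeOne B a p) • y)]

end CosetTerm

lemma finite_support_pairing {K g : Type*} [CommRing K] [LieRing g] [Module K g]
    (B : LinearMap.BilinForm K g) (A : Connection g) (n : ℤ) :
    (fun m => B (A.1 m) (A.1 (n - m))).support.Finite := by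
  obtain ⟨N, hN⟩ := A.2
  exact finite_support_of_window (a := n - N + 1) (b := N)
    (fun m hm => by rw [hN (n - m) (by lia), map_zero])
    fun m hm => by rw [hN m (by lia), map_zero, LinearMap.zero_apply]

section Descent

variable {g : Type*} [LieRing g] [LieAlgebra ℂ g] {B : LinearMap.BilinForm ℂ g}
  {A : Connection g} {N : ℤ}

lemma modeOne_zero (n : ℤ) : modeOne B 0 n = 0 :=
  map_zero (modeLin ℂ B _ () n)

variable {W : Type*} [AddCommGroup W] [Module (LevelOne B) W] {y : W}

lemma hasFinSum_connection (hA : ∀ k ≥ N, A.1 k = 0)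
    (hy : ∀ a, ∀ k ≥ N, modeOne B a k • y = 0) (n : ℤ) :
    HasFinSum (fun m => modeOne B (A.1 (n - m)) m • y)
      (∑ᶠ m, modeOne B (A.1 (n - m)) m • y) :=
  hasFinSum_finsum (finite_support_of_window (a := n - N + 1) (b := N)
    (fun m hm => by rw [hA (n - m) (by lia), modeOne_zero, zero_smul])
    fun m hm => hy _ m hm.le)

lemma hasFinSum_deformedL {ι : Type*} [Fintype ι] (hA : ∀ k ≥ N, A.1 k = 0)
    (hy : ∀ a, ∀ k ≥ N, modeOne B a k • y = 0) (h : ℂ) (v w : ι → g) (n : ℤ) :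
    HasFinSum (fun m =>
      algebraMap ℂ (LevelOne B) (2 * (1 + h))⁻¹ •
        ∑ i, normalOrdered (modeOne B) (v i) (w i) m (n - m) • y -
      algebraMap ℂ (LevelOne B) (1 / 2) •
        (modeOne B (A.1 m) (n - m) • y + modeOne B (A.1 (n - m)) m • y) +
      algebraMap ℂ (LevelOne B) (1 / 2 * B (A.1 m) (A.1 (n - m))) • y)
      (deformedL B h v w A n y) := by
  have hconn := hasFinSum_connection hA hy n
  have hflip : HasFinSum (fun m => modeOne B (A.1 m) (n - m) • y)
      (∑ᶠ m, modeOne B (A.1 (n - m)) m • y) :=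
    (hconn.comp_equiv (Equiv.subLeft n)).congr (fun m => by simp) rfl
  have hhalf (x : W) : algebraMap ℂ (LevelOne B) (1 / 2) • (x + x) = x := by
    rw [smul_add, ← add_smul, ← map_add, add_halves, map_one, one_smul]
  have hpair := ((hasFinSum_finsum (finite_support_pairing B A n)).const_smul (1 / 2 : ℂ)).map
    ((algebraMap ℂ (LevelOne B)).toAddMonoidHom)
  have := ((hasFinSum_sugawara hy 1 h v w n).sub
    ((hflip.add hconn).const_smul (algebraMap ℂ (LevelOne B) (1 / 2)))).add (hpair.smul_const y)
  rwa [hhalf] at this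

variable {V : Type*} [AddCommGroup V] [Module (Generic B) V] {M : Submodule (intForm B) V} {z : M}

lemma hasFinSum_cosetL {ι : Type*} [Fintype ι] (hX : ∀ a, ∀ k ≥ N, modeX B a k • (z : V) = 0)
    (hY : ∀ a, ∀ k ≥ N, modeY B a k • (z : V) = 0) (h : ℂ) (v w : ι → g) (n : ℤ) :
    HasFinSum (fun m => ((∑ i, normalCosetTerm B h (v i) (w i) m (n - m) • z : M) : V))
      (cosetL B h v w n (z : V)) := by
  have hdiag (a : g) (k : ℤ) (hk : k ≥ N) : modeDiag B a k • (z : V) = 0 := by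
    rw [modeDiag, add_smul, hX a k hk, hY a k hk, add_zero]
  have hterm (a b : g) (p q : ℤ) : ((normalCosetTerm B h a b p q • z : M) : V) =
      (normalCosetTerm B h a b p q : Generic B) • (z : V) := rfl
  refine (((hasFinSum_sugawara hX _ _ v w n).add (hasFinSum_sugawara hY _ _ v w n)).sub
    (hasFinSum_sugawara hdiag _ _ v w n)).congr (fun m => ?_) rfl
  rw [AddSubmonoidClass.coe_finsetSum, Finset.smul_sum, Finset.smul_sum, Finset.smul_sum,
    ← Finset.sum_add_distrib, ← Finset.sum_sub_distrib]
  refine Finset.sum_congr rfl fun i _ => ?_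
  rw [hterm, coe_normalCosetTerm, sub_smul, add_smul]
  simp only [Algebra.smul_def, mul_smul]

variable {ι : Type*} [Fintype ι] [DecidableEq ι] (v w : Module.Basis ι ℂ g)

lemma Coinv.sum_normalCosetTerm_smul (hwv : ∀ i j, B (w i) (v j) = if i = j then 1 else 0)
    (hvw : ∀ i j, B (v i) (w j) = if i = j then 1 else 0) (h : ℂ) (p q : ℤ) (y : Coinv B A M) :
    ∑ i, normalCosetTerm B h (v i) (w i) p q • y =
      algebraMap ℂ (LevelOne B) (2 * (1 + h))⁻¹ •
        ∑ i, normalOrdered (modeOne B) (v i) (w i) p q • y -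
      algebraMap ℂ (LevelOne B) (1 / 2) •
        (modeOne B (A.1 p) q • y + modeOne B (A.1 q) p • y) +
      algebraMap ℂ (LevelOne B) (1 / 2 * B (A.1 p) (A.1 q)) • y := by
  have hmode (u u' : ι → g) (x : g) (n : ℤ) (hu : ∑ i, B x (u i) • u' i = x) :
      ∑ i, (B x (u i) • modeOne B (u' i) n) • y = modeOne B x n • y := by
    have := congrArg (modeLin ℂ B (fun _ => 1) () n) hu
    simp only [map_sum, map_smul, modeLin_apply] at this
    rw [← Finset.sum_smul]
    exact congrArg (· • y) this
  have hpairing : ∑ i, algebraMap ℂ (LevelOne B) (1 / 2 * (B (A.1 p) (v i) * B (A.1 q) (w i))) • y =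
      algebraMap ℂ (LevelOne B) (1 / 2 * B (A.1 p) (A.1 q)) • y := by
    rw [← Finset.sum_smul, ← map_sum, ← Finset.mul_sum, sum_dual_mul hvw]
  simp only [normalCosetTerm_smul, Finset.sum_add_distrib, Finset.sum_sub_distrib,
    ← Finset.smul_sum]
  rw [hmode v w _ q (sum_dual_smul hwv _), hmode w v _ p (sum_dual_smul hvw _), hpairing]

theorem cosetL_descends (hwv : ∀ i j, B (w i) (v j) = if i = j then 1 else 0)
    (hvw : ∀ i j, B (v i) (w j) = if i = j then 1 else 0) (h : ℂ) (A : Connection g)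
    (hV : IsSmooth (RatFunc ℂ) B ![kap - 1, 1] V) (M : Submodule (intForm B) V) (n : ℤ) (z : M) :
    ∃ hz : cosetL B h v w n (z : V) ∈ M,
      Coinv.mk B A (⟨cosetL B h v w n (z : V), hz⟩ : M) =
        deformedL B h v w A n (Coinv.mk B A z) := by
  obtain ⟨N₁, hN₁⟩ := hV (z : V)
  obtain ⟨N₂, hN₂⟩ := A.2
  have hX (a : g) (k : ℤ) (hk : k ≥ max N₁ N₂) : modeX B a k • (z : V) = 0 :=
    hN₁ k (by lia) 0 a
  have hY (a : g) (k : ℤ) (hk : k ≥ max N₁ N₂) : modeY B a k • (z : V) = 0 :=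
    hN₁ k (by lia) 1 a
  have hA (k : ℤ) (hk : k ≥ max N₁ N₂) : A.1 k = 0 := hN₂ k (by lia)
  obtain ⟨hz, hsum⟩ := (hasFinSum_cosetL hX hY h v w n).subtype
  refine ⟨hz, (hsum.map (coinvKer B A M).mkQ.toAddMonoidHom).unique ?_⟩
  refine (hasFinSum_deformedL hA
    (fun a k hk => Coinv.modeOne_smul_mk_eq_zero B A (hY a k hk)) h v w n).congr (fun m => ?_) rfl
  rw [← Coinv.sum_normalCosetTerm_smul v w hwv hvw]
  exact map_sum ((coinvKer B A M).mkQ) _ _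

end Descent

section Virasoro

variable {K : Type*} [Field K] {g : Type*} [LieRing g] [LieAlgebra K g]
  {ι : Type*} [Fintype ι] {W : Type*} [AddCommGroup W] [Module K W]

/-- The operators `a_n = J n a` form a smooth representation of level `k` of the affine Lie algebra
of `g`. -/
structure IsSmoothRep (B : LinearMap.BilinForm K g) (k : K) (J : ℤ → g →ₗ[K] Module.End K W) :
    Prop where
  comm : ∀ a b m n, J m a * J n b =
    J n b * J m a + J (m + n) ⁅a, b⁆ + (if m + n = 0 then (m : K) * B a b * k else 0) • 1
  smooth : ∀ x, ∃ N : ℤ, ∀ n ≥ N, ∀ a, J n a x = 0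

/-- `v` and `w` are dual bases for the symmetric invariant form `B`, and the Casimir element
`∑ i, v i * w i` acts by `2 h` on the adjoint representation. -/
structure IsCasimirPair [DecidableEq ι] (B : LinearMap.BilinForm K g) (h : K)
    (v w : Module.Basis ι K g) : Prop where
  symm : B.IsSymm
  invariant : B.lieInvariant g
  dual : ∀ i j, B (v i) (w j) = if i = j then 1 else 0
  casimir : ∀ a : g, ∑ i, ⁅v i, ⁅w i, a⁆⁆ = (2 * h) • a

/-- The operator `∑ i, (v i)_p (w i)_q`. -/
def casimirTerm (J : ℤ → g →ₗ[K] Module.End K W) (v w : ι → g) (p q : ℤ) : Module.End K W :=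
  ∑ i, J p (v i) * J q (w i)

/-- The operator `∑ i, (v i)_p ⁅w i, a⁆_q`, the error term in the commutator of `casimirTerm` with
the modes of `a`. -/
def casimirLieTerm (J : ℤ → g →ₗ[K] Module.End K W) (v w : ι → g) (a : g) (p q : ℤ) :
    Module.End K W :=
  ∑ i, J p (v i) * J q ⁅w i, a⁆

/-- The operator `∑ i, :(v i)_p (w i)_(n - p):`. -/
def normalTerm (J : ℤ → g →ₗ[K] Module.End K W) (v w : ι → g) (n p : ℤ) : Module.End K W :=
  ∑ i, normalOrdered (fun a k => J k a) (v i) (w i) p (n - p)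

/-- The product of two modes as a bilinear map. -/
def modeProd (J : ℤ → g →ₗ[K] Module.End K W) (p q : ℤ) : g →ₗ[K] g →ₗ[K] Module.End K W :=
  (LinearMap.mul K (Module.End K W)).compl₁₂ (J p) (J q)

@[simp] lemma modeProd_apply (J : ℤ → g →ₗ[K] Module.End K W) (p q : ℤ) (a b : g) :
    modeProd J p q a b = J p a * J q b := rfl

variable {B : LinearMap.BilinForm K g} {k : K} {J : ℤ → g →ₗ[K] Module.End K W}

lemma finite_support_normalTerm (hJ : ∀ x, ∃ N : ℤ, ∀ n ≥ N, ∀ a, J n a x = 0) (v w : ι → g)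
    (n : ℤ) (x : W) : (fun p => normalTerm J v w n p x).support.Finite := by
  obtain ⟨N, hN⟩ := hJ x
  refine finite_support_of_window (a := min 0 (n - N)) (b := max 0 N) (fun p hp => ?_)
    fun p hp => ?_
  all_goals
    rw [normalTerm, LinearMap.sum_apply]
    exact Finset.sum_eq_zero fun i _ =>
      normalOrdered_smul_eq_zero (J := fun a k => J k a) (m := p) (l := n - p)
        (fun a k hk => hN k hk a) _ _ (by lia)

variable [DecidableEq ι] {h : K} {v w : Module.Basis ι K g}

namespace IsCasimirPair

lemma dual_symm (hC : IsCasimirPair B h v w) (i j : ι) :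
    B (w i) (v j) = if i = j then 1 else 0 :=
  dual_pairing_symm hC.symm hC.dual i j

lemma apply_lie_left (hC : IsCasimirPair B h v w) (x a y : g) : B ⁅x, a⁆ y = B x ⁅a, y⁆ := by
  rw [← lie_skew, map_neg, LinearMap.neg_apply, hC.invariant, neg_neg]

lemma sum_smul_left (hC : IsCasimirPair B h v w) (p : ℤ) (a : g) :
    ∑ i, B (w i) a • J p (v i) = J p a := by
  conv_rhs => rw [← sum_dual_smul hC.dual a]
  simp only [map_sum, map_smul, hC.symm.eq a]

lemma sum_smul_right (hC : IsCasimirPair B h v w) (p : ℤ) (a : g) :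
    ∑ i, B (v i) a • J p (w i) = J p a := by
  conv_rhs => rw [← sum_dual_smul hC.dual_symm a]
  simp only [map_sum, map_smul, hC.symm.eq a]

lemma casimirTerm_comm (hC : IsCasimirPair B h v w) (p q : ℤ) :
    casimirTerm J w v p q = casimirTerm J v w p q :=
  (sum_dual_symm hC.symm hC.dual_symm (modeProd J p q)).symm

lemma sum_lie_mul (hC : IsCasimirPair B h v w) (a : g) (p q : ℤ) :
    ∑ i, J p ⁅v i, a⁆ * J q (w i) = -casimirLieTerm J v w a p q := by
  refine (sum_dual_adjoint hC.dual (modeProd J p q) (T := fun x => ⁅x, a⁆)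
    (T' := fun y => ⁅a, y⁆) fun x y => hC.apply_lie_left x a y).trans ?_
  rw [casimirLieTerm, ← Finset.sum_neg_distrib]
  exact Finset.sum_congr rfl fun i _ => by rw [modeProd_apply, ← lie_skew, map_neg, mul_neg]

lemma sum_lie_mul_symm (hC : IsCasimirPair B h v w) (a : g) (p q : ℤ) :
    ∑ i, J p ⁅w i, a⁆ * J q (v i) = -casimirLieTerm J v w a p q := by
  have := sum_dual_symm hC.symm hC.dual_symm
    ((modeProd J p q).comp (LieModule.toEnd K g g a : g →ₗ[K] g))
  simp only [LinearMap.comp_apply, LieModule.toEnd_apply_apply, modeProd_apply] at this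
  rw [← hC.sum_lie_mul]
  simp only [← lie_skew _ a, map_neg, neg_mul, Finset.sum_neg_distrib, this]

end IsCasimirPair

lemma casimirTerm_commutator_mode (hJ : IsSmoothRep B k J) (hC : IsCasimirPair B h v w) (a : g)
    (p q n : ℤ) : casimirTerm J v w p q * J n a - J n a * casimirTerm J v w p q =
      (if q + n = 0 then (q : K) * k else 0) • J p a +
      (if p + n = 0 then (p : K) * k else 0) • J q a +
      (casimirLieTerm J v w a p (q + n) - casimirLieTerm J v w a (p + n) q) := by
  have hterm (i : ι) : J p (v i) * J q (w i) * J n a - J n a * (J p (v i) * J q (w i)) =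
      (if q + n = 0 then (q : K) * k else 0) • B (w i) a • J p (v i) +
      (if p + n = 0 then (p : K) * k else 0) • B (v i) a • J q (w i) +
      (J p (v i) * J (q + n) ⁅w i, a⁆ + J (p + n) ⁅v i, a⁆ * J q (w i)) := by
    rw [mul_assoc, hJ.comm (w i) a q n, ← mul_assoc (J n a), mul_add, mul_add, ← mul_assoc,
      hJ.comm (v i) a p n, add_mul, add_mul, mul_smul_comm, smul_mul_assoc, mul_one, one_mul,
      smul_smul, smul_smul, ite_mul, ite_mul, zero_mul, zero_mul, mul_right_comm (q : K),
      mul_right_comm (p : K)]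
    abel
  rw [casimirTerm, Finset.sum_mul, Finset.mul_sum, ← Finset.sum_sub_distrib]
  simp only [hterm, Finset.sum_add_distrib]
  rw [← Finset.smul_sum, ← Finset.smul_sum, hC.sum_smul_left, hC.sum_smul_right, hC.sum_lie_mul,
    ← sub_eq_add_neg]
  rfl

variable [CharZero K]

lemma casimirTerm_swap (hJ : IsSmoothRep B k J) (hC : IsCasimirPair B h v w) (p q : ℤ) :
    casimirTerm J v w p q = casimirTerm J v w q p +
      (if p + q = 0 then (p : K) * Fintype.card ι * k else 0) • 1 := by
  have : IsAddTorsionFree g := .of_isTorsionFree K g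
  rw [← hC.casimirTerm_comm q p, casimirTerm]
  simp only [hJ.comm _ _ p q, hC.dual, Finset.sum_add_distrib, if_true, mul_one]
  rw [← map_sum, sum_lie_dual hC.symm hC.dual_symm, map_zero, add_zero, Finset.sum_const,
    Finset.card_univ, ← Nat.cast_smul_eq_nsmul K, smul_smul, mul_ite, mul_zero, ← mul_assoc,
    mul_comm (p : K)]
  rfl

lemma normalTerm_eq (hJ : IsSmoothRep B k J) (hC : IsCasimirPair B h v w) (n p : ℤ) :
    normalTerm J v w n p = casimirTerm J v w p (n - p) -
      (if n = 0 ∧ 0 ≤ p then (p : K) * Fintype.card ι * k else 0) • 1 := by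
  rw [normalTerm]
  simp only [normalOrdered]
  by_cases hp : p < 0
  · simp only [if_pos hp, hp.not_ge, and_false, if_false, zero_smul, sub_zero]
    rfl
  · simp only [if_neg hp, not_lt.mp hp, and_true]
    rw [casimirTerm_swap hJ hC p, add_sub_cancel, add_sub_cancel_right, ← hC.casimirTerm_comm]
    rfl

lemma normalTerm_commutator (hJ : IsSmoothRep B k J) (hC : IsCasimirPair B h v w) (n p : ℤ)
    (X : Module.End K W) : normalTerm J v w n p * X - X * normalTerm J v w n p =
      casimirTerm J v w p (n - p) * X - X * casimirTerm J v w p (n - p) := by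
  rw [normalTerm_eq hJ hC, sub_mul, mul_sub, smul_mul_assoc, mul_smul_comm, mul_one, one_mul]
  abel

lemma casimirLieTerm_swap (hJ : IsSmoothRep B k J) (hC : IsCasimirPair B h v w) (a : g)
    (p q : ℤ) : casimirLieTerm J v w a p q =
      (2 * h) • J (p + q) a - casimirLieTerm J v w a q p := by
  have : IsAddTorsionFree g := .of_isTorsionFree K g
  have hpairing : ∑ i, B (v i) ⁅w i, a⁆ = 0 := by
    simp only [← hC.apply_lie_left]
    rw [← LinearMap.sum_apply, ← map_sum, sum_lie_dual hC.symm hC.dual_symm, map_zero,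
      LinearMap.zero_apply]
  have hcentral : ∑ i, (if p + q = 0 then (p : K) * B (v i) ⁅w i, a⁆ * k else 0) = 0 := by
    split_ifs
    · rw [← Finset.sum_mul, ← Finset.mul_sum, hpairing, mul_zero, zero_mul]
    · exact Finset.sum_const_zero
  rw [← neg_neg (casimirLieTerm J v w a q p), ← hC.sum_lie_mul_symm, sub_neg_eq_add, casimirLieTerm]
  simp only [hJ.comm (v _) _ p q, Finset.sum_add_distrib]
  rw [← map_sum, hC.casimir, map_smul, ← Finset.sum_smul, hcentral, zero_smul, add_zero, add_comm]

end Virasoro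

section Sugawara

variable {K : Type*} [Field K] {g : Type*} [LieRing g] [LieAlgebra K g]
  {ι : Type*} [Fintype ι] {W : Type*} [AddCommGroup W] [Module K W]
  {B : LinearMap.BilinForm K g} {k : K} {J : ℤ → g →ₗ[K] Module.End K W}

/-- The Sugawara operators of a smooth representation, without the normalizing factor. -/
def sugawaraSum (hJ : IsSmoothRep B k J) (v w : ι → g) (n : ℤ) : Module.End K W :=
  locSum (normalTerm J v w n) (finite_support_normalTerm hJ.smooth v w n)

lemma hasFinSum_sugawaraSum (hJ : IsSmoothRep B k J) (v w : ι → g) (n : ℤ) (x : W) :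
    HasFinSum (fun p => normalTerm J v w n p x) (sugawaraSum hJ v w n x) :=
  hasFinSum_locSum _ x

/-- The Sugawara operators of a smooth representation of level `k`. -/
def sugawaraOp (hJ : IsSmoothRep B k J) (h : K) (v w : ι → g) (n : ℤ) : Module.End K W :=
  (2 * (k + h))⁻¹ • sugawaraSum hJ v w n

variable [CharZero K]

lemma hasFinSum_central (m : ℤ) : HasFinSum (fun p : ℤ => (if 0 ≤ p then (p : K) * (p + m) else 0) -
    (if -m ≤ p then (p : K) * (p + m) else 0)) (((m : K) ^ 3 - m) / 6) := by
  let H (p : ℤ) : K := ((p : K) - 1) * p * (2 * p - 1) / 6 + m * p * (p - 1) / 2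
  have hstep (p : ℤ) : (p : K) * (p + m) = H (p + 1) - H p := by
    simp only [H]
    push_cast
    ring
  simp only [hstep]
  refine (hasFinSum_ite_sub_ite H 0 (-m)).congr (fun _ => rfl) ?_
  simp only [H]
  push_cast
  ring

variable [DecidableEq ι] {h : K} {v w : Module.Basis ι K g}

lemma hasFinSum_casimirLieTerm_sub (hJ : IsSmoothRep B k J) (hC : IsCasimirPair B h v w) (a : g)
    (m n : ℤ) (x : W) :
    HasFinSum (fun p => casimirLieTerm J v w a p (m - p) x -
      casimirLieTerm J v w a (p + n) (m - (p + n)) x) (-(n • (2 * h) • J m a x)) := by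
  obtain ⟨N, hN⟩ := hJ.smooth x
  have hzero (p q : ℤ) (hq : N ≤ q) : casimirLieTerm J v w a p q x = 0 := by
    rw [casimirLieTerm, LinearMap.sum_apply]
    exact Finset.sum_eq_zero fun i _ => by rw [Module.End.mul_apply, hN q hq, map_zero]
  refine hasFinSum_sub_comp_add (a := m - N) (b := N)
    (f := fun p => casimirLieTerm J v w a p (m - p) x) (fun p hp => hzero _ _ (by lia))
    (fun p hp => ?_) n
  rw [casimirLieTerm_swap hJ hC, LinearMap.sub_apply, hzero _ _ hp.le, sub_zero, add_sub_cancel,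
    LinearMap.smul_apply]

lemma sugawaraSum_commutator_mode (hJ : IsSmoothRep B k J) (hC : IsCasimirPair B h v w) (a : g)
    (m n : ℤ) : sugawaraSum hJ v w m * J n a - J n a * sugawaraSum hJ v w m =
      (-(2 * (k + h) * n) : K) • J (m + n) a := by
  ext x
  have hright : HasFinSum
      (fun p : ℤ => ((if m - p + n = 0 then ((m - p : ℤ) : K) * k else 0) • J p a) x)
      ((-(n * k) : K) • J (m + n) a x) :=
    (hasFinSum_single (m + n) fun p hp => by
      rw [if_neg (by lia), zero_smul, LinearMap.zero_apply]).congr (fun _ => rfl) <| by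
      rw [if_pos (by lia), LinearMap.smul_apply, sub_add_cancel_left, Int.cast_neg, neg_mul]
  have hleft : HasFinSum
      (fun p : ℤ => ((if p + n = 0 then (p : K) * k else 0) • J (m - p) a) x)
      ((-(n * k) : K) • J (m + n) a x) :=
    (hasFinSum_single (-n) fun p hp => by
      rw [if_neg (by lia), zero_smul, LinearMap.zero_apply]).congr (fun _ => rfl) <| by
      rw [if_pos (by lia), LinearMap.smul_apply, sub_neg_eq_add, Int.cast_neg, neg_mul]
  refine (hasFinSum_commutator (hasFinSum_sugawaraSum hJ v w m) (J n a) x).unique <|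
    ((hright.add hleft).add (hasFinSum_casimirLieTerm_sub hJ hC a (m + n) n x)).congr
      (fun p => ?_) ?_
  · rw [normalTerm_commutator hJ hC, casimirTerm_commutator_mode hJ hC, sub_add_eq_add_sub m p n,
      show m - p = m + n - (p + n) by ring]
    rfl
  · rw [LinearMap.smul_apply, ← Int.cast_smul_eq_zsmul K]
    module

lemma sugawaraOp_mul_mode (hJ : IsSmoothRep B k J) (hC : IsCasimirPair B h v w) (hkh : k + h ≠ 0)
    (a : g) (m n : ℤ) : sugawaraOp hJ h v w m * J n a =
      J n a * sugawaraOp hJ h v w m + (-n : K) • J (m + n) a := by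
  rw [← sub_eq_iff_eq_add', sugawaraOp, smul_mul_assoc, mul_smul_comm, ← smul_sub,
    sugawaraSum_commutator_mode hJ hC, smul_smul]
  congr 1
  field_simp

lemma sugawaraOp_commutator_casimirTerm (hJ : IsSmoothRep B k J) (hC : IsCasimirPair B h v w)
    (hkh : k + h ≠ 0) (m p q : ℤ) : sugawaraOp hJ h v w m * casimirTerm J v w p q -
      casimirTerm J v w p q * sugawaraOp hJ h v w m =
      (-p : K) • casimirTerm J v w (p + m) q + (-q : K) • casimirTerm J v w p (q + m) := by
  simp only [casimirTerm]
  rw [Finset.mul_sum, Finset.sum_mul, ← Finset.sum_sub_distrib, Finset.smul_sum, Finset.smul_sum,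
    ← Finset.sum_add_distrib]
  refine Finset.sum_congr rfl fun i _ => ?_
  rw [← mul_assoc, sugawaraOp_mul_mode hJ hC hkh, add_mul, mul_assoc,
    sugawaraOp_mul_mode hJ hC hkh, mul_add, mul_smul_comm, smul_mul_assoc, add_comm m p,
    add_comm m q, mul_assoc]
  abel

lemma sugawaraOp_commutator_normalTerm (hJ : IsSmoothRep B k J) (hC : IsCasimirPair B h v w)
    (hkh : k + h ≠ 0) (m n p : ℤ) : sugawaraOp hJ h v w m * normalTerm J v w n p -
      normalTerm J v w n p * sugawaraOp hJ h v w m =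
      (-p : K) • normalTerm J v w (m + n) (p + m) + (p - n : K) • normalTerm J v w (m + n) p +
      (if m + n = 0 then (Fintype.card ι : K) * k * ((if 0 ≤ p then (p : K) * (p + m) else 0) -
        (if -m ≤ p then (p : K) * (p + m) else 0)) else 0) • 1 := by
  have hcomm := normalTerm_commutator hJ hC n p (sugawaraOp hJ h v w m)
  rw [← neg_inj, neg_sub, neg_sub, sugawaraOp_commutator_casimirTerm hJ hC hkh] at hcomm
  rw [hcomm, normalTerm_eq hJ hC, normalTerm_eq hJ hC, show m + n - (p + m) = n - p by ring,
    show n - p + m = m + n - p by ring]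
  simp only [show 0 ≤ p + m ↔ -m ≤ p by lia]
  by_cases hmn : m + n = 0
  · obtain rfl : n = -m := by lia
    simp only [hmn, true_and, if_true]
    push_cast
    split_ifs <;> module
  · simp only [hmn, false_and, if_false]
    push_cast
    module

lemma sugawaraOp_commutator_sugawaraSum (hJ : IsSmoothRep B k J) (hC : IsCasimirPair B h v w)
    (hkh : k + h ≠ 0) (m n : ℤ) : sugawaraOp hJ h v w m * sugawaraSum hJ v w n -
      sugawaraSum hJ v w n * sugawaraOp hJ h v w m = (m - n : K) • sugawaraSum hJ v w (m + n) +
      (if m + n = 0 then (Fintype.card ι : K) * k * (((m : K) ^ 3 - m) / 6) else 0) • 1 := by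
  ext x
  have hfin := finite_support_normalTerm hJ.smooth v w (m + n) x
  have hweighted (c : ℤ → K) : HasFinSum (fun p => c p • normalTerm J v w (m + n) p x)
      (∑ᶠ p, c p • normalTerm J v w (m + n) p x) :=
    hasFinSum_finsum (hfin.subset (Function.support_smul_subset_right c _))
  have hshift := hweighted fun p => m - p
  have hstay := hweighted fun p => p - n
  have hsum := (hshift.add hstay).unique <|
    ((hasFinSum_sugawaraSum hJ v w (m + n) x).const_smul (m - n : K)).congr
      (fun p => by rw [← add_smul, sub_add_sub_cancel]) rfl
  have hcentral : HasFinSum (fun p : ℤ => if m + n = 0 then (Fintype.card ι : K) * k *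
        ((if 0 ≤ p then (p : K) * (p + m) else 0) - (if -m ≤ p then (p : K) * (p + m) else 0))
        else 0) (if m + n = 0 then (Fintype.card ι : K) * k * (((m : K) ^ 3 - m) / 6) else 0) := by
    split_ifs
    · exact (hasFinSum_central m).const_smul ((Fintype.card ι : K) * k)
    · exact hasFinSum_zero
  have hcomm := (hasFinSum_commutator (hasFinSum_sugawaraSum hJ v w n)
    (sugawaraOp hJ h v w m) x).neg
  rw [← LinearMap.neg_apply, neg_sub] at hcomm
  refine hcomm.unique ((((hshift.comp_add_right m).add hstay).add
    (hcentral.smul_const x)).congr (fun p => ?_) ?_)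
  · rw [← LinearMap.neg_apply, neg_sub, sugawaraOp_commutator_normalTerm hJ hC hkh]
    push_cast
    rw [sub_add_cancel_right]
    rfl
  · rw [hsum]
    rfl

theorem sugawaraOp_commutator (hJ : IsSmoothRep B k J) (hC : IsCasimirPair B h v w)
    (hkh : k + h ≠ 0) (m n : ℤ) : sugawaraOp hJ h v w m * sugawaraOp hJ h v w n -
      sugawaraOp hJ h v w n * sugawaraOp hJ h v w m = (m - n : K) • sugawaraOp hJ h v w (m + n) +
      (if m + n = 0 then k * Fintype.card ι / (k + h) / 12 * ((m : K) ^ 3 - m) else 0) • 1 := by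
  have hnorm := congrArg ((2 * (k + h))⁻¹ • ·)
    (sugawaraOp_commutator_sugawaraSum hJ hC hkh m n)
  simp only [smul_sub, smul_add] at hnorm
  rw [← mul_smul_comm, ← smul_mul_assoc] at hnorm
  refine hnorm.trans ?_
  rw [smul_comm, smul_smul (2 * (k + h))⁻¹ (ite _ _ _)]
  congr 2
  split_ifs
  · field_simp
    ring
  · rw [mul_zero]

end Sugawara

section Deformation

variable {K : Type*} [Field K] {g : Type*} [LieRing g] [LieAlgebra K g]
  {W : Type*} [AddCommGroup W] [Module K W]
  {B : LinearMap.BilinForm K g} {k : K} {J : ℤ → g →ₗ[K] Module.End K W}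

lemma finite_support_connection (hJ : IsSmoothRep B k J) (A : Connection g) (n : ℤ) (x : W) :
    (fun r => J (n - r) (A.1 r) x).support.Finite := by
  obtain ⟨N, hN⟩ := hJ.smooth x
  obtain ⟨N', hN'⟩ := A.2
  refine finite_support_of_window (a := n - N) (b := N') (fun r hr => hN _ (by lia) _)
    fun r hr => ?_
  rw [hN' r hr.le, map_zero, LinearMap.zero_apply]

/-- The operator `∑ r, (A_r)_(n - r)` of a connection `d + A`. -/
def connOp (hJ : IsSmoothRep B k J) (A : Connection g) (n : ℤ) : Module.End K W :=
  locSum (fun r => J (n - r) (A.1 r)) (finite_support_connection hJ A n)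

lemma hasFinSum_connOp (hJ : IsSmoothRep B k J) (A : Connection g) (n : ℤ) (x : W) :
    HasFinSum (fun r => J (n - r) (A.1 r) x) (connOp hJ A n x) :=
  hasFinSum_locSum _ x

lemma mode_connection_commutator (hJ : IsSmoothRep B k J) (A : Connection g) (m n r s : ℤ) :
    J (m - r) (A.1 r) * J (n - s) (A.1 s) - J (n - s) (A.1 s) * J (m - r) (A.1 r) =
      J (m + n - r - s) ⁅A.1 r, A.1 s⁆ +
        (if r + s = m + n then k * ((m - r : K) * B (A.1 r) (A.1 (m + n - r))) else 0) • 1 := by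
  rw [hJ.comm, add_assoc, add_sub_cancel_left, show m - r + (n - s) = m + n - r - s by ring]
  congr 2
  by_cases hrs : r + s = m + n
  · obtain rfl : s = m + n - r := by lia
    rw [if_pos (by ring), if_pos (by ring)]
    push_cast
    ring
  · rw [if_neg (by lia), if_neg hrs]

variable [CharZero K]

lemma hasFinSum_weighted_pairing (hB : B.IsSymm) (A : Connection g) (m n : ℤ) :
    HasFinSum (fun r : ℤ => (m - r : K) * B (A.1 r) (A.1 (m + n - r)))
      ((m - n : K) / 2 * ∑ᶠ r, B (A.1 r) (A.1 (m + n - r))) := by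
  have hfin := finite_support_pairing B A (m + n)
  have hweighted : HasFinSum (fun r : ℤ => (m - r : K) * B (A.1 r) (A.1 (m + n - r)))
      (∑ᶠ r : ℤ, (m - r : K) * B (A.1 r) (A.1 (m + n - r))) :=
    hasFinSum_finsum (hfin.subset (Function.support_smul_subset_right (fun r : ℤ => (m - r : K)) _))
  have hdouble := (hweighted.add (hweighted.comp_equiv (Equiv.subLeft (m + n)))).unique <|
    ((hasFinSum_finsum hfin).const_smul (m - n : K)).congr (fun r => by
      rw [Equiv.subLeft_apply, sub_sub_cancel, hB.eq (A.1 (m + n - r)) (A.1 r), smul_eq_mul]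
      push_cast
      ring) rfl
  refine hweighted.congr (fun _ => rfl) ?_
  rw [smul_eq_mul] at hdouble
  rw [div_mul_eq_mul_div, ← hdouble, add_self_div_two]

lemma connOp_commutator (hJ : IsSmoothRep B k J) (hB : B.IsSymm) (A : Connection g) (m n : ℤ) :
    connOp hJ A m * connOp hJ A n - connOp hJ A n * connOp hJ A m =
      (k * ((m - n : K) / 2 * ∑ᶠ r, B (A.1 r) (A.1 (m + n - r)))) • 1 := by
  have : IsAddTorsionFree W := .of_isTorsionFree K W
  ext x
  have hcomm := hasFinSum_commutator_prod (hasFinSum_connOp hJ A m) (hasFinSum_connOp hJ A n) x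
  have hcentral := ((((hasFinSum_weighted_pairing hB A m n).const_smul k).ite_add_eq
    (m + n)).smul_const x)
  rw [← sub_eq_zero]
  refine (hcomm.sub hcentral).eq_zero_of_antisymm fun r s => ?_
  simp only [mode_connection_commutator hJ, LinearMap.add_apply, LinearMap.smul_apply,
    Module.End.one_apply, smul_eq_mul, add_sub_cancel_right]
  rw [← lie_skew, map_neg, LinearMap.neg_apply, sub_right_comm]

variable {ι : Type*} [Fintype ι] {h : K}

/-- The Sugawara operators of a smooth representation of level `k`, deformed by a connection. -/
def deformedOp (hJ : IsSmoothRep B k J) (h : K) (v w : ι → g) (A : Connection g) (n : ℤ) :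
    Module.End K W :=
  sugawaraOp hJ h v w n - connOp hJ A n + (k / 2 * ∑ᶠ r, B (A.1 r) (A.1 (n - r))) • 1

variable [DecidableEq ι] {v w : Module.Basis ι K g}

lemma sugawaraOp_commutator_connOp (hJ : IsSmoothRep B k J) (hC : IsCasimirPair B h v w)
    (hkh : k + h ≠ 0) (A : Connection g) (m n : ℤ) :
    (sugawaraOp hJ h v w m * connOp hJ A n - connOp hJ A n * sugawaraOp hJ h v w m) -
      (sugawaraOp hJ h v w n * connOp hJ A m - connOp hJ A m * sugawaraOp hJ h v w n) =
      (m - n : K) • connOp hJ A (m + n) := by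
  ext x
  have hcomm (m n : ℤ) : HasFinSum (fun r : ℤ => (r - n : K) • J (m + n - r) (A.1 r) x)
      ((sugawaraOp hJ h v w m * connOp hJ A n - connOp hJ A n * sugawaraOp hJ h v w m) x) := by
    have := (hasFinSum_commutator (hasFinSum_connOp hJ A n) (sugawaraOp hJ h v w m) x).neg
    rw [← LinearMap.neg_apply, neg_sub] at this
    refine this.congr (fun r => ?_) rfl
    rw [sugawaraOp_mul_mode hJ hC hkh, sub_add_cancel_left, LinearMap.neg_apply, neg_neg,
      LinearMap.smul_apply, ← add_sub_assoc]
    push_cast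
    rw [neg_sub]
  refine ((hcomm m n).sub (hcomm n m)).unique ?_
  refine ((hasFinSum_connOp hJ A (m + n) x).const_smul (m - n : K)).congr (fun r => ?_) rfl
  rw [add_comm n m]
  module

theorem deformedOp_commutator (hJ : IsSmoothRep B k J) (hC : IsCasimirPair B h v w)
    (hkh : k + h ≠ 0) (A : Connection g) (m n : ℤ) :
    deformedOp hJ h v w A m * deformedOp hJ h v w A n -
      deformedOp hJ h v w A n * deformedOp hJ h v w A m =
      (m - n : K) • deformedOp hJ h v w A (m + n) +
      (if m + n = 0 then k * Fintype.card ι / (k + h) / 12 * ((m : K) ^ 3 - m) else 0) • 1 := by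
  have commutator_expand (x y x' y' : Module.End K W) (s t : K) :
      (x - y + s • 1) * (x' - y' + t • 1) - (x' - y' + t • 1) * (x - y + s • 1) =
        (x * x' - x' * x) - ((x * y' - y' * x) - (x' * y - y * x')) + (y * y' - y' * y) := by
    simp only [add_mul, mul_add, sub_mul, mul_sub, smul_mul_assoc, mul_smul_comm, mul_one, one_mul]
    module
  rw [deformedOp, deformedOp, commutator_expand, sugawaraOp_commutator hJ hC hkh,
    sugawaraOp_commutator_connOp hJ hC hkh, connOp_commutator hJ hC.symm, deformedOp]
  module

end Deformation

section ModeAlgebraModules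

variable {g : Type*} [LieRing g] [LieAlgebra ℂ g] {B : LinearMap.BilinForm ℂ g}
  {σ : Type*} {k : σ → ℂ} {W : Type*} [AddCommGroup W] [Module ℂ W]
  [Module (ModeAlgebra ℂ B k) W] [IsScalarTower ℂ (ModeAlgebra ℂ B k) W]

variable (B k W) in
/-- The action on a module of the modes of the factor `s`. -/
def modeRep (s : σ) (n : ℤ) : g →ₗ[ℂ] Module.End ℂ W :=
  (Algebra.lsmul ℂ ℂ W : ModeAlgebra ℂ B k →ₐ[ℂ] Module.End ℂ W).toLinearMap ∘ₗ modeLin ℂ B k s n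

lemma isSmoothRep_modeRep (hW : IsSmooth ℂ B k W) (s : σ) :
    IsSmoothRep B (k s) (modeRep B k W s) where
  comm a b m n := by
    have := congrArg (Algebra.lsmul ℂ ℂ W : ModeAlgebra ℂ B k →ₐ[ℂ] Module.End ℂ W)
      (mode_mul ℂ B k s a b m n)
    rwa [map_add, map_add, map_mul, map_mul, AlgHom.commutes,
      Algebra.algebraMap_eq_smul_one] at this
  smooth x := (hW x).imp fun _ hN n hn => hN n hn s

lemma sugawara_mode (hW : IsSmooth ℂ B k W) (s : σ) {ι : Type*} [Fintype ι] (h : ℂ) (v w : ι → g)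
    (n : ℤ) (x : W) : sugawara (mode ℂ B k s) (k s) h v w n x =
      sugawaraOp (isSmoothRep_modeRep hW s) h v w n x := by
  rw [sugawara, algebraMap_smul, sugawaraOp, LinearMap.smul_apply,
    ← (hasFinSum_sugawaraSum _ v w n x).2]
  congr 1
  refine finsum_congr fun m => ?_
  simp only [normalTerm, LinearMap.sum_apply]
  refine Finset.sum_congr rfl fun i _ => ?_
  simp only [normalOrdered]
  split_ifs <;> exact mul_smul _ _ _

end ModeAlgebraModules

section LevelOneModules

variable {g : Type*} [LieRing g] [LieAlgebra ℂ g] {ι : Type*} [Fintype ι]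
  {B : LinearMap.BilinForm ℂ g} {h : ℂ} {W : Type*} [AddCommGroup W] [Module (LevelOne B) W]

lemma deformedL_eq_deformedOp [Module ℂ W] [IsScalarTower ℂ (LevelOne B) W]
    (hW : IsSmooth ℂ B (fun _ : Unit => (1 : ℂ)) W) (v w : ι → g) (A : Connection g) (n : ℤ)
    (x : W) : deformedL B h v w A n x =
      deformedOp (isSmoothRep_modeRep hW ()) h v w A n x := by
  have hconn : ∑ᶠ m : ℤ, modeOne B (A.1 (n - m)) m • x =
      connOp (isSmoothRep_modeRep hW ()) A n x := by
    rw [← ((hasFinSum_connOp _ A n x).comp_equiv (Equiv.subLeft n)).2]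
    refine finsum_congr fun m => ?_
    change _ = modeOne B (A.1 (n - m)) (n - (n - m)) • x
    rw [sub_sub_cancel]
  rw [deformedL, hconn, algebraMap_smul]
  exact congrArg (fun y => y - connOp _ A n x + _) (sugawara_mode hW () h v w n x)

variable [DecidableEq ι] {v w : Module.Basis ι ℂ g}

theorem isVirasoroAction_deformedL (hC : IsCasimirPair B h v w) (h1 : 1 + h ≠ 0)
    (A : Connection g) (hW : IsSmooth ℂ B (fun _ : Unit => (1 : ℂ)) W) :
    IsVirasoroAction (LevelOne B) (deformedL (W := W) B h v w A)
      (Fintype.card ι / (1 + h)) := by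
  let _ : Module ℂ W := Module.compHom W (algebraMap ℂ (LevelOne B))
  have : IsScalarTower ℂ (LevelOne B) W := IsScalarTower.of_algebraMap_smul fun _ _ => rfl
  refine ⟨fun n x y => ?_, fun n t x => ?_, fun m n x => ?_⟩ <;>
    simp only [deformedL_eq_deformedOp hW, algebraMap_smul]
  · exact map_add _ x y
  · exact map_smul _ t x
  · have := LinearMap.congr_fun (deformedOp_commutator (isSmoothRep_modeRep hW ()) hC h1 A m n) x
    rw [one_mul] at this
    exact this

end LevelOneModules

section KillingForm

variable {K : Type*} [Field K] {g : Type*} [LieRing g] [LieAlgebra K g] {ι : Type*} [Fintype ι]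
  [DecidableEq ι] {B : LinearMap.BilinForm K g} {v w : Module.Basis ι K g}

lemma trace_eq_sum_dual {R M : Type*} [CommRing R] [AddCommGroup M] [Module R M]
    {B : LinearMap.BilinForm R M} {v : ι → M} {w : Module.Basis ι R M}
    (hvw : ∀ i j, B (v i) (w j) = if i = j then 1 else 0) (T : M →ₗ[R] M) :
    LinearMap.trace R M T = ∑ i, B (v i) (T (w i)) := by
  have hcoord (i : ι) : B (v i) = w.coord i := w.ext fun j => by
    simp only [hvw, Module.Basis.coord_apply, Module.Basis.repr_self, Finsupp.single_apply, eq_comm]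
  simp only [LinearMap.trace_eq_matrix_trace R w, Matrix.trace, Matrix.diag_apply,
    LinearMap.toMatrix_apply, hcoord, Module.Basis.coord_apply]

lemma isCasimirPair_of_killingForm_eq {h : K} (hB : B.IsSymm) (hB' : B.lieInvariant g)
    (hvw : ∀ i j, B (v i) (w j) = if i = j then 1 else 0)
    (hK : killingForm K g = (2 * h) • B) : IsCasimirPair B h v w := by
  refine ⟨hB, hB', hvw, fun a => ?_⟩
  have hpair (b : g) : B (∑ i, ⁅v i, ⁅w i, a⁆⁆) b = B ((2 * h) • a) b := by
    rw [map_smul, ← LinearMap.smul_apply, ← hK, LieModule.traceForm_comm, killingForm_apply_apply,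
      trace_eq_sum_dual hvw, map_sum, LinearMap.sum_apply]
    refine Finset.sum_congr rfl fun i _ => ?_
    rw [← lie_skew, map_neg, LinearMap.neg_apply, hB', neg_neg, LinearMap.comp_apply,
      LieAlgebra.ad_apply, LieAlgebra.ad_apply, ← lie_skew, ← lie_skew a, lie_neg]
  have hwv := dual_pairing_symm hB hvw
  rw [← sum_dual_smul hwv (∑ i, ⁅v i, ⁅w i, a⁆⁆)]
  simp only [hpair, sum_dual_smul hwv]

end KillingForm

section SimpleLieAlgebra

variable {g : Type*} [LieRing g] [LieAlgebra ℂ g] [FiniteDimensional ℂ g]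

lemma isCasimirPair_normalizedForm [LieAlgebra.IsKilling ℂ g] {H : LieSubalgebra ℂ g}
    [H.IsCartanSubalgebra] {θ : LieModule.Weight ℂ H g} (h0 : dualCoxeter H θ ≠ 0)
    {ι : Type*} [Fintype ι] [DecidableEq ι] {v w : Module.Basis ι ℂ g}
    (hvw : ∀ i j, normalizedForm H θ (v i) (w j) = if i = j then 1 else 0) :
    IsCasimirPair (normalizedForm H θ) (dualCoxeter H θ) v w :=
  isCasimirPair_of_killingForm_eq
    ((LinearMap.BilinForm.isSymm_iff.mpr (LieModule.traceForm_isSymm ℂ g g)).smul _)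
    (fun x y z => by
      simp only [normalizedForm, LinearMap.smul_apply, killingForm,
        LieModule.traceForm_lieInvariant ℂ g g x y z, smul_neg])
    hvw (smul_inv_smul₀ (mul_ne_zero two_ne_zero h0) _).symm

lemma killingForm_coroot_self [LieAlgebra.IsKilling ℂ g] (H : LieSubalgebra ℂ g)
    [H.IsCartanSubalgebra] (θ : LieModule.Weight ℂ H g) :
    killingForm ℂ g (LieAlgebra.IsKilling.coroot θ : H) (LieAlgebra.IsKilling.coroot θ : H) =
      ∑ α ∈ H.root, α (LieAlgebra.IsKilling.coroot θ) ^ 2 := by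
  refine (LinearMap.congr_fun₂ (LieAlgebra.IsKilling.restrict_killingForm_eq_sum (K := ℂ)
    (L := g) (H := H)) (LieAlgebra.IsKilling.coroot θ) (LieAlgebra.IsKilling.coroot θ)).trans ?_
  simp only [LinearMap.sum_apply, LinearMap.smulRight_apply, LinearMap.smul_apply, smul_eq_mul,
    sq]
  rfl

lemma exists_dualCoxeter_eq [LieAlgebra.IsKilling ℂ g] (H : LieSubalgebra ℂ g)
    [H.IsCartanSubalgebra] {θ : LieModule.Weight ℂ H g} (hθ : θ.IsNonZero) :
    ∃ n : ℤ, 0 < n ∧ dualCoxeter H θ = n / 4 := by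
  let z (α : LieModule.Weight ℂ H g) : ℤ :=
    LieModule.chainBotCoeff θ α - LieModule.chainTopCoeff θ α
  have hz (α : LieModule.Weight ℂ H g) : α (LieAlgebra.IsKilling.coroot θ) = z α :=
    LieAlgebra.IsKilling.apply_coroot_eq_cast θ α
  have hzθ : z θ ≠ 0 := by
    rw [← Int.cast_ne_zero (α := ℂ), ← hz, LieAlgebra.IsKilling.root_apply_coroot hθ]
    exact two_ne_zero
  refine ⟨∑ α ∈ H.root, z α ^ 2, Finset.sum_pos' (fun α _ => sq_nonneg _) ⟨θ, ?_, ?_⟩, ?_⟩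
  · simpa [LieSubalgebra.root] using hθ
  · positivity
  · rw [dualCoxeter, killingForm_coroot_self]
    simp only [hz]
    push_cast
    rfl

lemma dualCoxeter_ne_zero [LieAlgebra.IsKilling ℂ g] (H : LieSubalgebra ℂ g)
    [H.IsCartanSubalgebra] {θ : LieModule.Weight ℂ H g} (hθ : θ.IsNonZero) :
    dualCoxeter H θ ≠ 0 := by
  obtain ⟨n, hn, h⟩ := exists_dualCoxeter_eq H hθ
  rw [h]
  exact div_ne_zero (Int.cast_ne_zero.mpr hn.ne') (by norm_num)

lemma one_add_dualCoxeter_ne_zero [LieAlgebra.IsKilling ℂ g] (H : LieSubalgebra ℂ g)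
    [H.IsCartanSubalgebra] {θ : LieModule.Weight ℂ H g} (hθ : θ.IsNonZero) :
    1 + dualCoxeter H θ ≠ 0 := by
  obtain ⟨n, hn, h⟩ := exists_dualCoxeter_eq H hθ
  rw [h, show (1 + n / 4 : ℂ) = ((4 + n : ℤ) : ℂ) / 4 by push_cast; ring]
  exact div_ne_zero (Int.cast_ne_zero.mpr (by lia)) (by norm_num)

end SimpleLieAlgebra

end AffineCoset

end

theorem mainTheorem1_general {g : Type*} [LieRing g] [LieAlgebra ℂ g] {h : ℂ}
    {B : LinearMap.BilinForm ℂ g} {ι : Type*} [Fintype ι] [DecidableEq ι]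
    {v w : Module.Basis ι ℂ g} (hC : IsCasimirPair B h v w) (h1 : 1 + h ≠ 0) :
    (∃ e : functionRing B ⊗[ℂ] LevelOne B ≃ₐ[ℂ] Limit B,
      (∀ a n, e (coord B a n ⊗ₜ 1) = toLimit B (scaledDiag B a n)) ∧
      ∀ u, e (1 ⊗ₜ u) = toLimit B (inclOne B u)) ∧
    ∀ A : Connection g,
      (∃ e : LevelOne B ≃ₗ[LevelOne B] Coinv B A (intForm B), e 1 = Coinv.mk B A 1) ∧
      (∀ N : ℕ, IsSmooth (RatFunc ℂ) B ![kap - 1, 1] (UnivSmooth B N)) ∧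
      (∀ N : ℕ, (∀ n : ℤ, N ≤ n → A.1 n = 0) →
        ∃ e : (LevelOne B ⧸ highModes ℂ B (fun _ : Unit => (1 : ℂ)) N) ≃ₗ[LevelOne B]
            Coinv B A (univLattice B N),
          e (Submodule.Quotient.mk 1) = Coinv.mk B A (univLatticeVec B N)) ∧
      (∀ (V : Type*) [AddCommGroup V] [Module (Generic B) V],
        IsSmooth (RatFunc ℂ) B ![kap - 1, 1] V →
        ∀ M : Submodule (intForm B) V,
          IsSmooth ℂ B (fun _ : Unit => (1 : ℂ)) (Coinv B A M) ∧
          ∀ (n : ℤ) (z : M), ∃ hz : cosetL B h v w n (z : V) ∈ M,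
            Coinv.mk B A (⟨cosetL B h v w n (z : V), hz⟩ : M) =
              deformedL B h v w A n (Coinv.mk B A z)) ∧
      ∀ (W : Type*) [AddCommGroup W] [Module (LevelOne B) W],
        IsSmooth ℂ B (fun _ : Unit => (1 : ℂ)) W →
        IsVirasoroAction (LevelOne B) (deformedL (W := W) B h v w A)
          (Module.finrank ℂ g / (1 + h)) := by
  have : Module.Finite ℂ g := Module.Finite.of_basis v
  let b := Module.finBasis ℂ g
  refine ⟨exists_bundle_equiv b hC.symm hC.invariant hC.dual_symm, fun A =>
    ⟨exists_fibre_equiv b hC.symm hC.invariant A, isSmooth_univSmooth B,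
      exists_univ_fibre_equiv b hC.symm hC.invariant A, fun V _ _ hV M =>
      ⟨isSmooth_coinv B A hV M, cosetL_descends v w hC.dual_symm hC.dual h A hV M⟩,
      fun W _ _ hW => ?_⟩⟩
  rw [Module.finrank_eq_card_basis v]
  exact isVirasoroAction_deformedL hC h1 A hW

theorem mainTheorem1 {g : Type*} [LieRing g] [LieAlgebra ℂ g]
    [FiniteDimensional ℂ g] [LieAlgebra.IsSimple ℂ g]
    (H : LieSubalgebra ℂ g) [H.IsCartanSubalgebra] (hsl : IsSimplyLaced H)
    (θ : LieModule.Weight ℂ H g) (hθ : θ.IsNonZero)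
    (h : ℂ) (hh : h = dualCoxeter H θ)
    (B : LinearMap.BilinForm ℂ g) (hB : B = normalizedForm H θ)
    {ι : Type*} [Fintype ι] [DecidableEq ι] (v w : Module.Basis ι ℂ g)
    (hvw : ∀ i j, B (v i) (w j) = if i = j then 1 else 0) :
    -- the limit is a (trivial) bundle over the space of connections, with fibre the level one
    -- algebra, the function `⟨A_n, a⟩` being `a_n^{(κ)} / κ`
    (∃ e : functionRing B ⊗[ℂ] LevelOne B ≃ₐ[ℂ] Limit B,
      (∀ a n, e (coord B a n ⊗ₜ 1) = toLimit B (scaledDiag B a n)) ∧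
      ∀ u, e (1 ⊗ₜ u) = toLimit B (inclOne B u)) ∧
    ∀ A : Connection g,
      -- the fibre of the algebra at `d + A` is the level one algebra
      (∃ e : LevelOne B ≃ₗ[LevelOne B] Coinv B A (intForm B), e 1 = Coinv.mk B A 1) ∧
      -- likewise for the universal smooth modules
      (∀ N : ℕ, IsSmooth (RatFunc ℂ) B ![kap - 1, 1] (UnivSmooth B N)) ∧
      (∀ N : ℕ, (∀ n : ℤ, N ≤ n → A.1 n = 0) →
        ∃ e : (LevelOne B ⧸ highModes ℂ B (fun _ : Unit => (1 : ℂ)) N) ≃ₗ[LevelOne B]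
            Coinv B A (univLattice B N),
          e (Submodule.Quotient.mk 1) = Coinv.mk B A (univLatticeVec B N)) ∧
      -- the coset Virasoro operators preserve integral forms and descend to the fibre
      (∀ (V : Type*) [AddCommGroup V] [Module (Generic B) V],
        IsSmooth (RatFunc ℂ) B ![kap - 1, 1] V →
        ∀ M : Submodule (intForm B) V,
          IsSmooth ℂ B (fun _ : Unit => (1 : ℂ)) (Coinv B A M) ∧
          ∀ (n : ℤ) (z : M), ∃ hz : cosetL B h v w n (z : V) ∈ M,
            Coinv.mk B A (⟨cosetL B h v w n (z : V), hz⟩ : M) =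
              deformedL B h v w A n (Coinv.mk B A z)) ∧
      -- the deformed operators are a Virasoro action on smooth modules of level one
      ∀ (W : Type*) [AddCommGroup W] [Module (LevelOne B) W],
        IsSmooth ℂ B (fun _ : Unit => (1 : ℂ)) W →
        IsVirasoroAction (LevelOne B) (deformedL (W := W) B h v w A)
          (Module.finrank ℂ g / (1 + h)) := by
  subst hh hB
  exact mainTheorem1_general (isCasimirPair_normalizedForm (dualCoxeter_ne_zero H hθ) hvw)
    (one_add_dualCoxeter_ne_zero H hθ)
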